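/- **Notation and setting.** Let $d\ge 1$ be an integer, $\lambda\ge 1$ and $\epsilon=\sqrt{d/\lambda}$. Write points of $\mathbb R^{d+1}$ as $u=(x,t)$ with $x\in\mathbb R^d$, $t\in\mathbb R$. Let $D\subset\mathbb R^{d+1}$ be closed and let $z:D\to\mathbb R$. Assume: 1. $z\in C^2(D)$, meaning that $z$ has a $C^2$ extension to an open set containing $D$, with which its derivatives on $D$ are computed; $0\in\partial D$ is the unique minimizer of $z$ over $D$; and $\nabla z(0)=(0_d,1)$. 2. There are an open set $\Omega\ni 0_d$ in $\mathbb R^d$ and $\psi\in C^2(\Omega)$ with $\psi(0)=0$, $\nabla\psi(0)=0$ and $\partial D\cap(\Omega\times\mathbb R)=\{(x,\psi(x)):x\in\Omega\}$. 3. The matrix $H:=\nabla_x^2z(0)+\nabla^2\psi(0)$ is positive definite. Put $\|x\|_H=\sqrt{x^\top Hx}$, $\|(x,t)\|_{H,1}=\sqrt{\|x\|_H^2+t^2}$, $\mathcal U_H(r)=\{x\in\mathbb R^d:\|x\|_H\le r\}$ and $\Theta(x,y)=(x,\psi(x)+y)$. 4. There is $\rho_0>0$ with $\mathcal U_H(\rho_0)\subseteq\Omega$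 and $$\Theta(\mathcal U_H(\rho_0)\times(0,\rho_0))\subseteq D\cap(\mathcal U_H(\rho_0)\times\mathbb R)\subseteq\Theta(\mathcal U_H(\rho_0)\times[0,\infty)).$$ 5. $\partial_tz(u)>0$ for all $u\in D$ with $\|u\|_{H,1}\le\rho_0$. Assume moreover that $D$ is star-shaped about $0$ and that the restriction of $z$ to every line segment in $D$ emanating from $0$ is convex. For a $k$-linear form $T$ on $\mathbb R^d$, $k\ge1$, let $\|T\|_H=\sup\{T(v_1,\dots,v_k):\|v_1\|_H=\dots=\|v_k\|_H=1\}$; for a scalar let $\|T\|_H=|T|$. Let $w(x,y)=z(x,\psi(x)+y)$ and $$\omega_{\ell,j}(r,r')=\sup_{x\in\mathcal U_H(r),\,y\in[0,r']}\|\nabla_x^\ell\partial_y^jw(x,y)\|_H,\qquad \omega_{\ell,j}=\omega_{\ell,j}(0,0),\qquad \delta_2(r)=\sup_{x\in\mathcal U_H(r)}\|\nabla^2\psi(x)\|_H .$$ **Proposition.** There is a function $C:(0,\infty)^2\to(0,\infty)$, increasing in each argument, such that the following holds for all $d,\lambda,D,z,\Omega,\psi,\rho_0$ as above, all real $M\ge1$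 and all $C_{34}>0$. Let $R=24+2(1+2M)(\log\lambda)/d$ and suppose that $w\in C^4(\mathcal U_H(R\epsilon)\times[0,(R\epsilon)^2])$ and $$R\epsilon\le\min(1,\rho_0),\qquad R\epsilon\,\delta_2(R\epsilon/2)\le2,$$ $$R\epsilon\big(\omega_{1,1}+\omega_{0,2}(R\epsilon,R\epsilon)\big)+(R\epsilon)^2\omega_{2,1}(R\epsilon,0)\le\tfrac12,\qquad \big(\omega_{3,0}^2+\omega_{4,0}(R\epsilon,0)\big)\frac{d^2}{\lambda}\le C_{34},$$ $$R\epsilon\,\omega_{3,0}(R\epsilon,0)\le3 .$$ Then $e^{-\lambda z}$ is integrable on $D$ and $$\int_De^{-\lambda z(u)}\,du=\frac{(2\pi/\lambda)^{d/2}e^{-\lambda z(0)}}{\lambda\sqrt{\det H}}\,(1+\mathrm{Rem}_1),$$ where $$|\mathrm{Rem}_1|\le C(R,C_{34})\left[\big(\omega_{3,0}^2+\omega_{4,0}(R\epsilon,0)\big)\frac{d^2}{\lambda}+\big(\omega_{1,1}^2+\omega_{2,1}(R\epsilon,0)\big)\frac d\lambda+\omega_{0,2}(R\epsilon,(R\epsilon)^2)\frac1\lambda+\frac1{\lambda^M}\right].$$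 -/

import Mathlib

open Real Set MeasureTheory
open scoped Matrix

noncomputable section

/-- Euclidean space `ℝ^d`.  Points `u = (x, t)` of `ℝ^{d+1}` are elements of `RVec d × ℝ`. -/
abbrev RVec (d : ℕ) : Type := EuclideanSpace ℝ (Fin d)

/-- The Hessian matrix `∇²f(x)` of `f : ℝ^d → ℝ`. -/
def hessianMatrix {d : ℕ} (f : RVec d → ℝ) (x : RVec d) : Matrix (Fin d) (Fin d) ℝ :=
  Matrix.of fun i j =>
    iteratedFDeriv ℝ 2 f x ![EuclideanSpace.single i 1, EuclideanSpace.single j 1]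

/-- The weighted norm `‖x‖_H = √(xᵀ H x)`. -/
def normH {d : ℕ} (H : Matrix (Fin d) (Fin d) ℝ) (x : RVec d) : ℝ :=
  √(x.ofLp ⬝ᵥ (H *ᵥ x.ofLp))

/-- The norm `‖(x, t)‖_{H,1} = √(‖x‖_H² + t²)`. -/
def normH1 {d : ℕ} (H : Matrix (Fin d) (Fin d) ℝ) (u : RVec d × ℝ) : ℝ :=
  √(normH H u.1 ^ 2 + u.2 ^ 2)

/-- The closed ball `U_H(r) = {x : ‖x‖_H ≤ r}`. -/
def ballH {d : ℕ} (H : Matrix (Fin d) (Fin d) ℝ) (r : ℝ) : Set (RVec d) :=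
  {x | normH H x ≤ r}

/-- The `H`-weighted operator norm of a `k`-linear form,
`sup {|T(v₁, …, v_k)| : ‖v₁‖_H = ⋯ = ‖v_k‖_H = 1}`.
For `k ≥ 1` the absolute value changes nothing, because `v₁` may be replaced by `-v₁`;
for `k = 0` it makes this the absolute value of a scalar. -/
def tensorNormH {d k : ℕ} (H : Matrix (Fin d) (Fin d) ℝ)
    (T : ContinuousMultilinearMap ℝ (fun _ : Fin k => RVec d) ℝ) : ℝ :=
  sSup {a : ℝ | ∃ v : Fin k → RVec d, (∀ i, normH H (v i) = 1) ∧ a = |T v|}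

/-- The map `Θ(x, y) = (x, ψ(x) + y)`. -/
def boundaryMap {d : ℕ} (ψ : RVec d → ℝ) (p : RVec d × ℝ) : RVec d × ℝ :=
  (p.1, ψ p.1 + p.2)

/-- The function `w(x, y) = z(x, ψ(x) + y)`, that is `z ∘ Θ`. -/
def pullbackW {d : ℕ} (z : RVec d × ℝ → ℝ) (ψ : RVec d → ℝ) (p : RVec d × ℝ) : ℝ :=
  z (boundaryMap ψ p)

/-- The partial derivative `∂_y^j w(x, y)` for `y ≥ 0` (one-sided at `y = 0`). -/
def partialY {d : ℕ} (w : RVec d × ℝ → ℝ) (j : ℕ) (x : RVec d) (y : ℝ) : ℝ :=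
  iteratedDerivWithin j (fun t => w (x, t)) (Ici 0) y

/-- `ω_{ℓ,j}(r, r') = sup {‖∇_x^ℓ ∂_y^j w(x, y)‖_H : x ∈ U_H(r), y ∈ [0, r']}`.
The derivatives in `x` are those of the function on `S`, the set on which `w` is smooth in `x`;
in the interior of `S` they are the ordinary derivatives, at its boundary they are the continuous
extensions of these. -/
def omegaSup {d : ℕ} (H : Matrix (Fin d) (Fin d) ℝ) (w : RVec d × ℝ → ℝ) (S : Set (RVec d))
    (l j : ℕ) (r r' : ℝ) : ℝ :=
  sSup {a : ℝ | ∃ x ∈ ballH H r, ∃ y ∈ Icc (0 : ℝ) r',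
    a = tensorNormH H (iteratedFDerivWithin ℝ l (fun x' => partialY w j x' y) S x)}

/-- `δ_ℓ(r) = sup {‖∇^ℓ ψ(x)‖_H : x ∈ U_H(r)}`. -/
def deltaSup {d : ℕ} (H : Matrix (Fin d) (Fin d) ℝ) (ψ : RVec d → ℝ) (l : ℕ) (r : ℝ) : ℝ :=
  sSup {a : ℝ | ∃ x ∈ ballH H r, a = tensorNormH H (iteratedFDeriv ℝ l ψ x)}

/-- The matrix `H = ∇_x² z(0) + ∇² ψ(0)`. -/
def matH {d : ℕ} (z : RVec d × ℝ → ℝ) (ψ : RVec d → ℝ) : Matrix (Fin d) (Fin d) ℝ :=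
  hessianMatrix (fun x => z (x, 0)) 0 + hessianMatrix ψ 0

/-- The standing assumptions on the closed set `D ⊆ ℝ^{d+1}`, the function `z`, the local
parametrization `ψ : Ω → ℝ` of the boundary of `D`, and the radius `ρ₀`.
The letter `z` denotes the `C²` extension of the given function on `D` to an open set `U ⊇ D`
(values of `z` off `U` and of `ψ` off `Ω` play no role). -/
structure BoundaryMinSetting {d : ℕ} (D : Set (RVec d × ℝ)) (z : RVec d × ℝ → ℝ)
    (Ω : Set (RVec d)) (ψ : RVec d → ℝ) (ρ₀ : ℝ) : Prop where
  isClosed_D : IsClosed D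
  z_smooth : ∃ U : Set (RVec d × ℝ), IsOpen U ∧ D ⊆ U ∧ ContDiffOn ℝ 2 z U
  zero_mem_frontier : (0 : RVec d × ℝ) ∈ frontier D
  zero_argmin : ∀ u ∈ D, u ≠ 0 → z 0 < z u
  /-- `∇z(0) = (0, 1)` -/
  grad_z : HasFDerivAt z (ContinuousLinearMap.snd ℝ (RVec d) ℝ) 0
  isOpen_Ω : IsOpen Ω
  zero_mem_Ω : (0 : RVec d) ∈ Ω
  ψ_smooth : ContDiffOn ℝ 2 ψ Ω
  ψ_zero : ψ 0 = 0
  grad_ψ : HasFDerivAt ψ (0 : RVec d →L[ℝ] ℝ) 0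
  frontier_eq : frontier D ∩ (Ω ×ˢ univ) = (fun x => (x, ψ x)) '' Ω
  posDef_H : (matH z ψ).PosDef
  ρ₀_pos : 0 < ρ₀
  ball_subset : ballH (matH z ψ) ρ₀ ⊆ Ω
  strip_subset :
    boundaryMap ψ '' (ballH (matH z ψ) ρ₀ ×ˢ Ioo 0 ρ₀) ⊆ D ∩ (ballH (matH z ψ) ρ₀ ×ˢ univ)
  above_boundary :
    D ∩ (ballH (matH z ψ) ρ₀ ×ˢ univ) ⊆ boundaryMap ψ '' (ballH (matH z ψ) ρ₀ ×ˢ Ici 0)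
  /-- `∂_t z > 0` on `U_{H,1}(ρ₀) = D ∩ {‖u‖_{H,1} ≤ ρ₀}` -/
  dz_pos : ∀ u ∈ D, normH1 (matH z ψ) u ≤ ρ₀ → 0 < fderiv ℝ z u (0, 1)

end

/-! Put r = Rε. The coordinates (x, y) with t = ψ(x) + y straighten the boundary of D and preserve
volume. Over the cap ‖x‖_H ≤ r/2, 0 ≤ y < r², the integral is taken first in y. There w(x, y) - w(x,
0) ≥ y/2, so λ ∫ exp(-λ (w(x, y) - w(x, 0))) dy is close to 1/∂_y w(x, 0), hence to 1 - a(x) with a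
linear; the errors are governed by ω_{1,1}², ω_{2,1} and ω_{0,2}. After a linear change X with ‖X‖ =
√λ ‖x‖_H the remaining phase is ‖X‖²/2 + t(X) plus a quartic remainder, on the ball of radius ρ =
R√d/2, where t is a cubic form of norm at most b = ω_{3,0}/√λ.

The difficulty is the dimension. On this ball t may be of size b d^{3/2}, while only b d is under
control. The remedy is Gaussian integration by parts. Write E for the average over the Gaussian with
a radial cutoff. Euler's identity 3t = ⟨x, ∇t⟩ turns 3 E[t sinh t] into E[Δt sinh t + |∇t|² cosh t]
plus a cutoff term of favourable sign. The Laplacian is Δt = ⟨x, w⟩ for a vector w with ‖w‖ ≤ b d,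
and a second integration by parts replaces ⟨x, w⟩ sinh t by ⟨∇t, w⟩ cosh t. Since |∇t| ≤ bρ²/2 = R²
b d/8 on the ball, E[t sinh t] is at most R⁴ (b d)² E[cosh t] plus a tail
(`cutoffIntegral_cubic_mul_sinh_le`).

Two elementary inequalities exploit this. From cosh t ≤ cosh K + (2/K) t sinh t with K large, E[cosh
t] is bounded independently of d (`CubicBound.cutoffIntegral_cosh_le`). From cosh t - 1 ≤ t sinh t,
the Gaussian mass changes only by O((b d)²). Odd integrands vanish, so exp(-t)(1 - a) contributes
cosh t + a sinh t, with errors quadratic in b d and in the slope of a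
(`CubicBound.abs_cutoffIntegral_exp_mul_sub_le`).

Away from the cap, quadratic growth of z on the sphere ‖u‖_{H,1} = r/2 propagates by convexity along
rays to linear growth (`BoundaryMinSetting.linear_growth`). The choice of R makes 8^d exp(-R²d/128)
at most λ^{-M-1/2}, so this part costs only O(λ^{-M}). -/

open scoped RealInnerProductSpace

/-! ### The weighted norm, multilinear forms, and Taylor's formula along rays -/

open scoped MatrixOrder in
/-- A positive definite quadratic norm is the pull-back of the Euclidean norm. -/
theorem exists_equiv_normH {d : ℕ} {H : Matrix (Fin d) (Fin d) ℝ} (hH : H.PosDef) :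
    ∃ L : RVec d ≃L[ℝ] RVec d, (∀ x, normH H x = ‖L x‖) ∧
      |LinearMap.det (L : RVec d →ₗ[ℝ] RVec d)| = √H.det := by
  obtain ⟨B, hB, hHB⟩ := CStarAlgebra.isStrictlyPositive_iff_eq_star_mul_self.mp
    hH.isStrictlyPositive
  have hdetB : B.det ≠ 0 := by
    have := (Matrix.isUnit_iff_isUnit_det B).mp hB
    exact this.ne_zero
  have hdet : LinearMap.det (Matrix.toEuclideanLin B) = B.det := by
    rw [Matrix.toEuclideanLin_eq_toLin_orthonormal, LinearMap.det_toLin]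
  let e : RVec d ≃ₗ[ℝ] RVec d := LinearEquiv.ofIsUnitDet (f := Matrix.toEuclideanLin B)
    (v := (EuclideanSpace.basisFun (Fin d) ℝ).toBasis)
    (v' := (EuclideanSpace.basisFun (Fin d) ℝ).toBasis) (by
      rw [LinearMap.det_toMatrix, hdet]; exact hdetB.isUnit)
  have he : ∀ x, e x = Matrix.toEuclideanLin B x := fun x => rfl
  refine ⟨e.toContinuousLinearEquiv, fun x => ?_, ?_⟩
  · change _ = ‖e x‖
    rw [he, normH, EuclideanSpace.norm_eq]
    congr 1
    rw [hHB, Matrix.star_eq_conjTranspose, ← Matrix.mulVec_mulVec, Matrix.dotProduct_mulVec,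
      Matrix.vecMul_conjTranspose]
    simp only [star_trivial, Real.norm_eq_abs, sq_abs, dotProduct, Matrix.ofLp_toEuclideanLin_apply]
    exact Finset.sum_congr rfl fun i _ => (sq _).symm
  · have h1 : LinearMap.det ((e.toContinuousLinearEquiv : RVec d ≃L[ℝ] RVec d) :
        RVec d →ₗ[ℝ] RVec d) = B.det := by
      rw [← hdet]; rfl
    rw [h1, hHB, Matrix.det_mul, Matrix.star_eq_conjTranspose, Matrix.det_conjTranspose]
    simp only [star_trivial]
    rw [Real.sqrt_mul_self_eq_abs]

section EquivNorm

variable {d : ℕ} {H : Matrix (Fin d) (Fin d) ℝ}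

theorem normH_nonneg (H : Matrix (Fin d) (Fin d) ℝ) (x : RVec d) : 0 ≤ normH H x :=
  Real.sqrt_nonneg _

variable {L : RVec d ≃L[ℝ] RVec d}

theorem ballH_eq_preimage (hL : ∀ x, normH H x = ‖L x‖) (r : ℝ) :
    ballH H r = L ⁻¹' Metric.closedBall 0 r := by
  ext x; simp [ballH, hL]

theorem isCompact_ballH (hL : ∀ x, normH H x = ‖L x‖) (r : ℝ) : IsCompact (ballH H r) := by
  rw [ballH_eq_preimage hL]
  exact L.toHomeomorph.isCompact_preimage.mpr (isCompact_closedBall 0 r)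

theorem convex_ballH (hL : ∀ x, normH H x = ‖L x‖) (r : ℝ) : Convex ℝ (ballH H r) := by
  rw [ballH_eq_preimage hL]
  exact (convex_closedBall 0 r).linear_preimage (L : RVec d →ₗ[ℝ] RVec d)

theorem zero_mem_interior_ballH (hL : ∀ x, normH H x = ‖L x‖) {r : ℝ} (hr : 0 < r) :
    (0 : RVec d) ∈ interior (ballH H r) := by
  rw [ballH_eq_preimage hL]
  refine mem_interior_iff_mem_nhds.mpr (L.continuous.continuousAt.preimage_mem_nhds ?_)
  rw [map_zero]
  exact Metric.closedBall_mem_nhds 0 hr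

theorem uniqueDiffOn_ballH (hL : ∀ x, normH H x = ‖L x‖) {r : ℝ} (hr : 0 < r) :
    UniqueDiffOn ℝ (ballH H r) :=
  uniqueDiffOn_convex (convex_ballH hL r) ⟨0, zero_mem_interior_ballH hL hr⟩

theorem continuous_normH (hL : ∀ x, normH H x = ‖L x‖) : Continuous (normH H) := by
  have : normH H = fun x => ‖L x‖ := funext hL
  rw [this]; fun_prop

theorem normH_smul (hL : ∀ x, normH H x = ‖L x‖) (c : ℝ) (x : RVec d) :
    normH H (c • x) = |c| * normH H x := by
  rw [hL, hL, map_smul, norm_smul, Real.norm_eq_abs]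

theorem abs_le_norm_mul_of_normH_eq_one (hL : ∀ x, normH H x = ‖L x‖) {k : ℕ}
    (T : ContinuousMultilinearMap ℝ (fun _ : Fin k => RVec d) ℝ) (v : Fin k → RVec d)
    (hv : ∀ i, normH H (v i) = 1) :
    |T v| ≤ ‖T‖ * ‖(L.symm : RVec d →L[ℝ] RVec d)‖ ^ k := by
  refine (T.le_opNorm v).trans ?_
  gcongr
  calc ∏ i, ‖v i‖ ≤ ∏ _i : Fin k, ‖(L.symm : RVec d →L[ℝ] RVec d)‖ := by
        refine Finset.prod_le_prod (fun i _ => norm_nonneg _) fun i _ => ?_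
        have := (L.symm : RVec d →L[ℝ] RVec d).le_opNorm (L (v i))
        rw [← hL, hv i, mul_one] at this
        simpa using this
    _ = _ := by simp

theorem tensorNormH_le (hL : ∀ x, normH H x = ‖L x‖) {k : ℕ}
    (T : ContinuousMultilinearMap ℝ (fun _ : Fin k => RVec d) ℝ) :
    tensorNormH H T ≤ ‖T‖ * ‖(L.symm : RVec d →L[ℝ] RVec d)‖ ^ k := by
  refine Real.sSup_le ?_ (by positivity)
  rintro a ⟨v, hv, rfl⟩
  exact abs_le_norm_mul_of_normH_eq_one hL T v hv

theorem tensorNormH_nonneg {k : ℕ}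
    (T : ContinuousMultilinearMap ℝ (fun _ : Fin k => RVec d) ℝ) : 0 ≤ tensorNormH H T := by
  refine Real.sSup_nonneg ?_
  rintro a ⟨v, -, rfl⟩
  exact abs_nonneg _

theorem abs_le_tensorNormH_mul_prod (hL : ∀ x, normH H x = ‖L x‖) {k : ℕ}
    (T : ContinuousMultilinearMap ℝ (fun _ : Fin k => RVec d) ℝ) (v : Fin k → RVec d) :
    |T v| ≤ tensorNormH H T * ∏ i, normH H (v i) := by
  by_cases h0 : ∃ i, v i = 0
  · obtain ⟨i, hi⟩ := h0
    rw [T.map_coord_zero i hi, abs_zero]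
    exact mul_nonneg (tensorNormH_nonneg T) (Finset.prod_nonneg fun i _ => normH_nonneg H _)
  · push Not at h0
    have hpos : ∀ i, 0 < normH H (v i) := fun i => by
      rw [hL]; exact norm_pos_iff.mpr fun h => h0 i (by simpa using h)
    have hv : v = fun i => normH H (v i) • ((normH H (v i))⁻¹ • v i) := by
      ext1 i; rw [smul_smul, mul_inv_cancel₀ (hpos i).ne', one_smul]
    have hle : |T fun i => (normH H (v i))⁻¹ • v i| ≤ tensorNormH H T := by
      refine le_csSup ⟨‖T‖ * ‖(L.symm : RVec d →L[ℝ] RVec d)‖ ^ k, ?_⟩ ⟨_, fun i => ?_, rfl⟩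
      · rintro a ⟨v, hv, rfl⟩
        exact abs_le_norm_mul_of_normH_eq_one hL T v hv
      · rw [normH_smul hL, abs_of_pos (inv_pos.mpr (hpos i)), inv_mul_cancel₀ (hpos i).ne']
    conv_lhs => rw [hv, T.map_smul_univ, smul_eq_mul, abs_mul,
      abs_of_pos (Finset.prod_pos fun i _ => hpos i), mul_comm]
    gcongr
    exact Finset.prod_nonneg fun i _ => normH_nonneg H _

theorem abs_const_le_tensorNormH (hL : ∀ x, normH H x = ‖L x‖) {k : ℕ}
    (T : ContinuousMultilinearMap ℝ (fun _ : Fin k => RVec d) ℝ) (v : RVec d) :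
    |T fun _ => v| ≤ tensorNormH H T * normH H v ^ k := by
  simpa using abs_le_tensorNormH_mul_prod hL T fun _ => v

end EquivNorm

/-- Taylor's formula with Lagrange remainder along rays from the origin, in a convex set. -/
theorem exists_taylor_ray {E : Type*} [NormedAddCommGroup E] [NormedSpace ℝ E]
    {f : E → ℝ} {S : Set E} (hS : Convex ℝ S) (h0 : (0 : E) ∈ interior S) {n : ℕ}
    (hf : ContDiffOn ℝ (n + 1 : ℕ) f S) {x : E} (hx : x ∈ S) :
    ∃ ξ ∈ Ioo (0 : ℝ) 1, f x =
      (∑ k ∈ Finset.range (n + 1),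
        (k.factorial : ℝ)⁻¹ * iteratedFDerivWithin ℝ k f S 0 fun _ => x) +
      ((n + 1).factorial : ℝ)⁻¹ * iteratedFDerivWithin ℝ (n + 1) f S (ξ • x) fun _ => x := by
  have hSu : UniqueDiffOn ℝ S := uniqueDiffOn_convex hS ⟨0, h0⟩
  let g : ℝ →L[ℝ] E := ContinuousLinearMap.toSpanSingleton ℝ x
  have hg : ∀ s, g s = s • x := fun s => by simp [g]
  have hSub : Icc (0 : ℝ) 1 ⊆ g ⁻¹' S := fun s hs => by
    rw [mem_preimage, hg]
    exact hS.starConvex (interior_subset h0) |>.smul_mem hx hs.1 hs.2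
  have hgu : UniqueDiffOn ℝ (g ⁻¹' S) := by
    refine uniqueDiffOn_convex (hS.linear_preimage (g : ℝ →ₗ[ℝ] E)) ⟨0, ?_⟩
    refine preimage_interior_subset_interior_preimage g.continuous ?_
    simpa using h0
  have hgf : ContDiffOn ℝ (n + 1 : ℕ) (f ∘ g) (g ⁻¹' S) :=
    hf.comp_continuousLinearMap g
  -- The chain rule applies on `g ⁻¹' S`; restricting to `[0, 1]` does not change the derivatives,
  -- because both sets have unique derivatives.
  have key : ∀ k ≤ n + 1, ∀ s ∈ Icc (0 : ℝ) 1, iteratedDerivWithin k (f ∘ g) (Icc 0 1) s =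
      iteratedFDerivWithin ℝ k f S (s • x) fun _ => x := by
    intro k hk s hs
    have hk' : ((k : ℕ) : WithTop ℕ∞) ≤ ((n + 1 : ℕ) : WithTop ℕ∞) := by exact_mod_cast hk
    rw [iteratedDerivWithin_eq_iteratedFDerivWithin,
      iteratedFDerivWithin_subset hSub (uniqueDiffOn_Icc zero_lt_one) hgu (hgf.of_le hk') hs,
      g.iteratedFDerivWithin_comp_right hf hSu hgu (hSub hs) hk']
    simp [hg]
  have hu : uIcc (0 : ℝ) 1 = Icc 0 1 := uIcc_of_le zero_le_one
  have hc : ContDiffOn ℝ (n + 1 : ℕ) (f ∘ g) (Icc 0 1) := hgf.mono hSub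
  obtain ⟨ξ, hξ, h⟩ := taylor_mean_remainder_lagrange (f := f ∘ g) (n := n) zero_ne_one
    (by rw [hu]; exact hc.of_le (by exact_mod_cast Nat.le_succ n))
    (by
      rw [hu]
      refine (hc.differentiableOn_iteratedDerivWithin (by exact_mod_cast Nat.lt_succ_self n)
        (uniqueDiffOn_Icc zero_lt_one)).mono ?_
      rw [uIoo_of_le zero_le_one]; exact Ioo_subset_Icc_self)
  rw [uIoo_of_le zero_le_one] at hξ
  refine ⟨ξ, hξ, ?_⟩
  rw [hu, taylor_within_apply, key _ le_rfl _ (Ioo_subset_Icc_self hξ)] at h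
  have hx1 : (f ∘ g) 1 = f x := by simp [hg]
  rw [hx1, sub_eq_iff_eq_add'] at h
  rw [h]
  congr 1
  · refine Finset.sum_congr rfl fun k hk => ?_
    rw [key k (Finset.mem_range.mp hk).le 0 (by simp)]
    simp
  · simp; ring

/-! ### Hyperbolic inequalities and the profile of the cutoff -/

/-- Convexity: the tangent to cosh at `t` lies below cosh at the point 0. Smallness of the average
of `t sinh t` thereby gives smallness of that of `cosh t - 1`. -/
theorem Real.cosh_sub_one_le_mul_sinh (t : ℝ) : cosh t - 1 ≤ t * sinh t := by
  rw [cosh_eq, sinh_eq]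
  have h1 := add_one_le_exp t
  have h2 := add_one_le_exp (-t)
  have h3 : exp t * exp (-t) = 1 := by rw [← exp_add]; simp
  nlinarith [exp_pos t, exp_pos (-t)]

theorem Real.mul_sinh_nonneg (t : ℝ) : 0 ≤ t * sinh t := by
  rcases le_total 0 t with h | h
  · exact mul_nonneg h (sinh_nonneg_iff.mpr h)
  · exact mul_nonneg_of_nonpos_of_nonpos h (sinh_nonpos_iff.mpr h)

/-- For `|t| ≤ K` the first term suffices; beyond `K ≥ 1` one has `cosh |t| ≤ 2 sinh |t|` and `|t| /
K ≥ 1`. The coefficient `2 / K` can be made small, which is what an absorption argument needs. -/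
theorem Real.cosh_le_cosh_add_mul_sinh {K : ℝ} (hK : 1 ≤ K) (t : ℝ) :
    cosh t ≤ cosh K + 2 / K * (t * sinh t) := by
  have hK0 : 0 < K := by linarith
  wlog ht : 0 ≤ t generalizing t
  · have := this (-t) (by linarith)
    simpa using this
  rcases le_or_gt t K with h | h
  · have h1 : cosh t ≤ cosh K := by
      rw [cosh_le_cosh, abs_of_nonneg ht, abs_of_pos hK0]; exact h
    have : 0 ≤ 2 / K * (t * sinh t) := mul_nonneg (by positivity) (mul_sinh_nonneg t)
    linarith
  · have h1 : cosh t ≤ 2 * sinh t := by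
      rw [cosh_eq, sinh_eq]
      have h2 := add_one_le_exp (2 * t)
      have h3 : exp t = exp (2 * t) * exp (-t) := by rw [← exp_add]; ring_nf
      have h4 := exp_pos (-t)
      nlinarith
    have h2 : 1 ≤ t / K := by rw [le_div_iff₀ hK0]; linarith
    have h3 : 0 ≤ sinh t := sinh_nonneg_iff.mpr ht
    have h4 : 2 / K * (t * sinh t) = t / K * (2 * sinh t) := by field_simp
    rw [h4]
    nlinarith [cosh_pos K]

theorem Real.abs_sinh_le_exp_abs (t : ℝ) : |sinh t| ≤ exp |t| := by
  rw [abs_sinh, sinh_eq]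
  have := exp_pos (-|t|); have := exp_pos |t|; linarith

/-- The derivative is continuous and lives on `[0, 1]`. The number `B` is absolute, so the final
constant may depend on it. -/
theorem Real.exists_bound_deriv_smoothTransition :
    ∃ B : ℝ, 0 < B ∧ (∀ x, |deriv smoothTransition x| ≤ B) ∧
      (∀ x, 0 ≤ deriv smoothTransition x) ∧
      ∀ x, x ∉ Icc (0 : ℝ) 1 → deriv smoothTransition x = 0 := by
  have hc : Continuous (deriv smoothTransition) :=
    (smoothTransition.contDiff (n := 1)).continuous_deriv le_rfl
  have hz : ∀ x, x ∉ Icc (0 : ℝ) 1 → deriv smoothTransition x = 0 := by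
    intro x hx
    rw [mem_Icc, not_and_or, not_le, not_le] at hx
    rcases hx with h | h
    · have : smoothTransition =ᶠ[nhds x] fun _ => 0 := by
        filter_upwards [Iio_mem_nhds h] with y hy
        exact smoothTransition.zero_of_nonpos (le_of_lt hy)
      rw [this.deriv_eq]; simp
    · have : smoothTransition =ᶠ[nhds x] fun _ => 1 := by
        filter_upwards [Ioi_mem_nhds h] with y hy
        exact smoothTransition.one_of_one_le (le_of_lt hy)
      rw [this.deriv_eq]; simp
  obtain ⟨B, hB⟩ := isCompact_Icc.exists_bound_of_continuousOn (s := Icc (0 : ℝ) 1) hc.continuousOn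
  refine ⟨|B| + 1, by positivity, fun x => ?_, fun x => smoothTransition.monotone.deriv_nonneg, hz⟩
  by_cases hx : x ∈ Icc (0 : ℝ) 1
  · have := hB x hx
    rw [Real.norm_eq_abs] at this
    exact this.trans ((le_abs_self B).trans (by linarith))
  · rw [hz x hx, abs_zero]; positivity

/-- The radial cutoff of radius `ρ`: equal to `1` for `‖x‖² ≤ ρ² / 2` and to `0` for `‖x‖ ≥ ρ`. -/
noncomputable def radialCutoff {d : ℕ} (ρ : ℝ) (x : RVec d) : ℝ :=
  smoothTransition (2 - 2 / ρ ^ 2 * ‖x‖ ^ 2)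

/-- The radial factor of the gradient of `radialCutoff`, which is `x ↦ radialCutoffSlope ρ x • x`. -/
noncomputable def radialCutoffSlope {d : ℕ} (ρ : ℝ) (x : RVec d) : ℝ :=
  -(4 / ρ ^ 2) * deriv smoothTransition (2 - 2 / ρ ^ 2 * ‖x‖ ^ 2)

/-! ### Gaussian integration by parts with a radial cutoff -/

section Cutoff

variable {d : ℕ} {ρ : ℝ}

theorem continuous_radialCutoff : Continuous (radialCutoff (d := d) ρ) := by
  unfold radialCutoff; fun_prop

theorem continuous_radialCutoffSlope : Continuous (radialCutoffSlope (d := d) ρ) := by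
  have hc : Continuous (deriv smoothTransition) :=
    (smoothTransition.contDiff (n := 1)).continuous_deriv le_rfl
  unfold radialCutoffSlope
  exact continuous_const.mul (hc.comp (by fun_prop))

theorem radialCutoff_nonneg (x : RVec d) : 0 ≤ radialCutoff ρ x := smoothTransition.nonneg _

theorem radialCutoff_le_one (x : RVec d) : radialCutoff ρ x ≤ 1 := smoothTransition.le_one _

theorem radialCutoff_neg (x : RVec d) : radialCutoff ρ (-x) = radialCutoff ρ x := by
  simp [radialCutoff]

theorem radialCutoff_eq_zero (hρ : 0 < ρ) {x : RVec d} (hx : ρ ≤ ‖x‖) : radialCutoff ρ x = 0 := by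
  refine smoothTransition.zero_of_nonpos ?_
  have h : ρ ^ 2 ≤ ‖x‖ ^ 2 := by gcongr
  have : 2 / ρ ^ 2 * ρ ^ 2 ≤ 2 / ρ ^ 2 * ‖x‖ ^ 2 := by gcongr
  rw [div_mul_cancel₀ _ (by positivity)] at this
  linarith

theorem radialCutoff_eq_one (hρ : 0 < ρ) {x : RVec d} (hx : ‖x‖ ^ 2 ≤ ρ ^ 2 / 2) :
    radialCutoff ρ x = 1 := by
  refine smoothTransition.one_of_one_le ?_
  have : 2 / ρ ^ 2 * ‖x‖ ^ 2 ≤ 2 / ρ ^ 2 * (ρ ^ 2 / 2) := by gcongr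
  have h2 : 2 / ρ ^ 2 * (ρ ^ 2 / 2) = 1 := by field_simp
  linarith

/-- The cutoff decreases along rays. This sign allows the cutoff term to be dropped from an upper
bound when its other factors are nonnegative. -/
theorem radialCutoffSlope_nonpos (x : RVec d) : radialCutoffSlope ρ x ≤ 0 := by
  have : 0 ≤ deriv smoothTransition (2 - 2 / ρ ^ 2 * ‖x‖ ^ 2) :=
    smoothTransition.monotone.deriv_nonneg
  unfold radialCutoffSlope
  rw [neg_mul, neg_nonpos]; positivity

theorem abs_radialCutoffSlope_le {B : ℝ} (hB : ∀ x, |deriv smoothTransition x| ≤ B) (x : RVec d) :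
    |radialCutoffSlope ρ x| ≤ 4 / ρ ^ 2 * B := by
  unfold radialCutoffSlope
  rw [abs_mul, abs_neg, abs_of_nonneg (by positivity : (0 : ℝ) ≤ 4 / ρ ^ 2)]
  gcongr; exact hB _

theorem radialCutoffSlope_eq_zero (hρ : 0 < ρ) {x : RVec d}
    (hx : ‖x‖ ^ 2 < ρ ^ 2 / 2 ∨ ρ < ‖x‖) : radialCutoffSlope ρ x = 0 := by
  obtain ⟨B, -, -, -, hB⟩ := exists_bound_deriv_smoothTransition
  unfold radialCutoffSlope
  rw [hB, mul_zero]
  rw [mem_Icc, not_and_or, not_le, not_le]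
  rcases hx with h | h
  · right
    have : 2 / ρ ^ 2 * ‖x‖ ^ 2 < 2 / ρ ^ 2 * (ρ ^ 2 / 2) := by gcongr
    have h2 : 2 / ρ ^ 2 * (ρ ^ 2 / 2) = 1 := by field_simp
    linarith
  · left
    have h : ρ ^ 2 < ‖x‖ ^ 2 := by gcongr
    have : 2 / ρ ^ 2 * ρ ^ 2 < 2 / ρ ^ 2 * ‖x‖ ^ 2 := by gcongr
    rw [div_mul_cancel₀ _ (by positivity)] at this
    linarith

theorem hasDerivAt_norm_sq_line (x v : RVec d) :
    HasDerivAt (fun s : ℝ => ‖x + s • v‖ ^ 2) (2 * ⟪x, v⟫) 0 := by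
  have h : HasDerivAt (fun s : ℝ => x + s • v) v 0 := by
    simpa using ((hasDerivAt_id (0 : ℝ)).smul_const v).const_add x
  simpa using h.norm_sq

theorem hasLineDerivAt_radialCutoff (x v : RVec d) :
    HasLineDerivAt ℝ (radialCutoff ρ) (radialCutoffSlope ρ x * ⟪x, v⟫) x v := by
  unfold HasLineDerivAt radialCutoff radialCutoffSlope
  have h := ((hasDerivAt_norm_sq_line x v).const_mul (2 / ρ ^ 2)).const_sub 2
  have hs : HasDerivAt smoothTransition (deriv smoothTransition (2 - 2 / ρ ^ 2 * ‖x‖ ^ 2))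
      (2 - 2 / ρ ^ 2 * ‖x + (0 : ℝ) • v‖ ^ 2) := by
    have := ((smoothTransition.contDiff (n := 1)).differentiable (by norm_num)
      (2 - 2 / ρ ^ 2 * ‖x‖ ^ 2)).hasDerivAt
    simpa using this
  refine (hs.comp (0 : ℝ) h).congr_deriv ?_
  ring

theorem hasLineDerivAt_gaussian (x v : RVec d) :
    HasLineDerivAt ℝ (fun y : RVec d => exp (-‖y‖ ^ 2 / 2)) (-⟪x, v⟫ * exp (-‖x‖ ^ 2 / 2)) x v := by
  unfold HasLineDerivAt
  refine ((hasDerivAt_norm_sq_line x v).neg.div_const 2).exp.congr_deriv ?_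
  simp; ring

theorem integrable_of_eq_zero_of_lt_norm {f : RVec d → ℝ} (hf : Continuous f)
    (hz : ∀ x, ρ < ‖x‖ → f x = 0) : Integrable f := by
  refine hf.integrable_of_hasCompactSupport
    (HasCompactSupport.of_support_subset_isCompact (isCompact_closedBall (0 : RVec d) ρ) ?_)
  intro x hx
  by_contra h
  exact hx (hz x (by simpa using h))

theorem integrable_radialCutoff_mul (hρ : 0 < ρ) {f : RVec d → ℝ} (hf : Continuous f) :
    Integrable fun x => exp (-‖x‖ ^ 2 / 2) * (radialCutoff ρ x * f x) := by
  refine integrable_of_eq_zero_of_lt_norm (ρ := ρ) ?_ fun x hx => ?_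
  · have := continuous_radialCutoff (d := d) (ρ := ρ)
    fun_prop
  · rw [radialCutoff_eq_zero hρ hx.le]; ring

theorem integrable_radialCutoffSlope_mul (hρ : 0 < ρ) {f : RVec d → ℝ} (hf : Continuous f) :
    Integrable fun x => exp (-‖x‖ ^ 2 / 2) * (radialCutoffSlope ρ x * f x) := by
  refine integrable_of_eq_zero_of_lt_norm (ρ := ρ) ?_ fun x hx => ?_
  · have := continuous_radialCutoffSlope (d := d) (ρ := ρ)
    fun_prop
  · rw [radialCutoffSlope_eq_zero hρ (Or.inr hx)]; ring

/-- Gaussian integration by parts in the direction `v` with a radial cutoff. -/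
theorem integral_gaussian_cutoff_by_parts (hρ : 0 < ρ) {u u' : RVec d → ℝ} {v : RVec d}
    (hu : Continuous u) (hu' : Continuous u') (h : ∀ x, HasLineDerivAt ℝ u (u' x) x v) :
    ∫ x, exp (-‖x‖ ^ 2 / 2) * (radialCutoff ρ x * (⟪x, v⟫ * u x)) =
      (∫ x, exp (-‖x‖ ^ 2 / 2) * (radialCutoffSlope ρ x * (⟪x, v⟫ * u x))) +
        ∫ x, exp (-‖x‖ ^ 2 / 2) * (radialCutoff ρ x * u' x) := by
  have hi1 := integrable_radialCutoff_mul hρ hu'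
  have hi2 := integrable_radialCutoff_mul hρ (f := fun x => ⟪x, v⟫ * u x) (by fun_prop)
  have hi3 := integrable_radialCutoffSlope_mul hρ (f := fun x => ⟪x, v⟫ * u x) (by fun_prop)
  have hi0 := integrable_radialCutoff_mul hρ hu
  have hprod : ∀ x, HasLineDerivAt ℝ (fun x => radialCutoff ρ x * u x)
      (radialCutoffSlope ρ x * ⟪x, v⟫ * u x + radialCutoff ρ x * u' x) x v := by
    intro x
    have h1 := hasLineDerivAt_radialCutoff (ρ := ρ) x v
    have h2 := h x
    unfold HasLineDerivAt at h1 h2 ⊢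
    have := h1.fun_mul h2
    simpa using this
  have key := integral_bilinear_hasLineDerivAt_right_eq_neg_left_of_integrable
    (μ := (volume : Measure (RVec d))) (B := ContinuousLinearMap.mul ℝ ℝ)
    (f := fun x => radialCutoff ρ x * u x)
    (f' := fun x => radialCutoffSlope ρ x * ⟪x, v⟫ * u x + radialCutoff ρ x * u' x)
    (g := fun y : RVec d => exp (-‖y‖ ^ 2 / 2))
    (g' := fun x => -⟪x, v⟫ * exp (-‖x‖ ^ 2 / 2)) (v := v)
    ((hi3.add hi1).congr (.of_forall fun x => by simp; ring))
    (hi2.neg.congr (.of_forall fun x => by simp; ring))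
    (hi0.congr (.of_forall fun x => by simp; ring))
    (fun x _ => hprod x) (fun x _ => hasLineDerivAt_gaussian x v)
  rw [← integral_add hi3 hi1]
  have e1 : ∫ x, exp (-‖x‖ ^ 2 / 2) * (radialCutoff ρ x * (⟪x, v⟫ * u x)) =
      - ∫ x, (ContinuousLinearMap.mul ℝ ℝ) (radialCutoff ρ x * u x)
        (-⟪x, v⟫ * exp (-‖x‖ ^ 2 / 2)) := by
    rw [← integral_neg]; congr 1; ext x; simp; ring
  rw [e1, key, neg_neg]
  congr 1; ext x; simp; ring

end Cutoff

/-- Riesz representation and Parseval: the sum of squares is the squared norm of the gradient, so no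
factor `d` is lost. -/
theorem sum_sq_apply_basisFun_le {d : ℕ} (φ : RVec d →L[ℝ] ℝ) {c : ℝ}
    (hφ : ∀ v, |φ v| ≤ c * ‖v‖) (hc : 0 ≤ c) :
    ∑ i, φ (EuclideanSpace.basisFun (Fin d) ℝ i) ^ 2 ≤ c ^ 2 := by
  set w := (InnerProductSpace.toDual ℝ (RVec d)).symm φ with hw
  have h1 : ∀ v, φ v = ⟪w, v⟫ := fun v => by
    rw [hw, InnerProductSpace.toDual_symm_apply]
  have h2 := OrthonormalBasis.sum_sq_norm_inner_right (EuclideanSpace.basisFun (Fin d) ℝ) w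
  have h3 : ‖w‖ ≤ c := by
    rw [hw, LinearIsometryEquiv.norm_map]
    exact φ.opNorm_le_bound hc hφ
  calc ∑ i, φ (EuclideanSpace.basisFun (Fin d) ℝ i) ^ 2 = ‖w‖ ^ 2 := by
        rw [← h2]
        refine Finset.sum_congr rfl fun i _ => ?_
        rw [h1, Real.norm_eq_abs, sq_abs, real_inner_comm]
    _ ≤ c ^ 2 := by gcongr

/-! ### Cubic forms and their derivatives -/

section Cubic

variable {d : ℕ} {E : Type*} [NormedAddCommGroup E] [NormedSpace ℝ E]

/-- The cubic form `x ↦ A(x, x, x) / 6`. -/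
noncomputable def cubicForm (A : E →L[ℝ] E →L[ℝ] E →L[ℝ] ℝ) (x : E) : ℝ := A x x x / 6

/-- The derivative of `cubicForm A` at `x`. -/
noncomputable def cubicDeriv (A : E →L[ℝ] E →L[ℝ] E →L[ℝ] ℝ) (x : E) : E →L[ℝ] ℝ :=
  (6 : ℝ)⁻¹ • ((A.flip x).flip x + (A x).flip x + A x x)

/-- The second derivative of `cubicForm A` in a direction `v`, as a linear form in the base point. -/
noncomputable def cubicHess (A : E →L[ℝ] E →L[ℝ] E →L[ℝ] ℝ) (v : E) : E →L[ℝ] ℝ :=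
  (3 : ℝ)⁻¹ • (A v v + (A v).flip v + (A.flip v).flip v)

variable {A : E →L[ℝ] E →L[ℝ] E →L[ℝ] ℝ} {b : ℝ}

theorem cubicDeriv_apply (x v : E) : cubicDeriv A x v = (A v x x + A x v x + A x x v) / 6 := by
  simp [cubicDeriv]; ring

theorem cubicHess_apply (v x : E) : cubicHess A v x = (A v v x + A v x v + A x v v) / 3 := by
  simp [cubicHess]; ring

/-- Euler's identity for a form of degree 3. -/
theorem cubicDeriv_self (x : E) : cubicDeriv A x x = 3 * cubicForm A x := by
  rw [cubicDeriv_apply, cubicForm]; ring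

theorem cubicForm_neg (x : E) : cubicForm A (-x) = -cubicForm A x := by
  simp [cubicForm]; ring

theorem continuous_cubicForm : Continuous (cubicForm A) := by
  unfold cubicForm; fun_prop

theorem continuous_cubicDeriv_apply (v : E) : Continuous fun x => cubicDeriv A x v := by
  simp only [cubicDeriv_apply]; fun_prop

theorem hasDerivAt_add_smul (x v : E) : HasDerivAt (fun s : ℝ => x + s • v) v 0 := by
  simpa using ((hasDerivAt_id (0 : ℝ)).smul_const v).const_add x

theorem ContinuousLinearMap.comp_hasDerivAt_path {E F : Type*} [NormedAddCommGroup E]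
    [NormedSpace ℝ E] [NormedAddCommGroup F] [NormedSpace ℝ F] (A : E →L[ℝ] F) {f : ℝ → E} {f' : E}
    {t : ℝ} (hf : HasDerivAt f f' t) : HasDerivAt (fun s => A (f s)) (A f') t :=
  A.hasFDerivAt.comp_hasDerivAt t hf

theorem HasDerivAt.trilinear (A : E →L[ℝ] E →L[ℝ] E →L[ℝ] ℝ) {f g h : ℝ → E} {f' g' h' : E} {t : ℝ}
    (hf : HasDerivAt f f' t) (hg : HasDerivAt g g' t) (hh : HasDerivAt h h' t) :
    HasDerivAt (fun s => A (f s) (g s) (h s))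
      (A f' (g t) (h t) + A (f t) g' (h t) + A (f t) (g t) h') t := by
  have h1 : HasDerivAt (fun s => A (f s)) (A f') t :=
    ContinuousLinearMap.comp_hasDerivAt_path (F := E →L[ℝ] E →L[ℝ] ℝ) A hf
  have := (h1.clm_apply hg).clm_apply hh
  simpa using this

theorem hasLineDerivAt_cubicForm (x v : E) :
    HasLineDerivAt ℝ (cubicForm A) (cubicDeriv A x v) x v := by
  unfold HasLineDerivAt cubicForm
  have h := hasDerivAt_add_smul x v
  refine ((HasDerivAt.trilinear A h h h).div_const 6).congr_deriv ?_
  rw [cubicDeriv_apply]; simp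

theorem hasLineDerivAt_cubicDeriv (x v : E) :
    HasLineDerivAt ℝ (fun y => cubicDeriv A y v) (cubicHess A v x) x v := by
  unfold HasLineDerivAt
  simp only [cubicDeriv_apply]
  have h := hasDerivAt_add_smul x v
  have hc := hasDerivAt_const (0 : ℝ) v
  refine ((((HasDerivAt.trilinear A hc h h).add (HasDerivAt.trilinear A h hc h)).add
    (HasDerivAt.trilinear A h h hc)).div_const 6).congr_deriv ?_
  rw [cubicHess_apply]; simp; ring

theorem abs_cubicForm_le (hA : ∀ x y z, |A x y z| ≤ b * (‖x‖ * ‖y‖ * ‖z‖)) (x : E) :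
    |cubicForm A x| ≤ b * ‖x‖ ^ 3 / 6 := by
  rw [cubicForm, abs_div, abs_of_pos (by norm_num : (0 : ℝ) < 6)]
  have := hA x x x
  gcongr
  linarith

theorem abs_cubicDeriv_le (hA : ∀ x y z, |A x y z| ≤ b * (‖x‖ * ‖y‖ * ‖z‖)) (x v : E) :
    |cubicDeriv A x v| ≤ b * ‖x‖ ^ 2 / 2 * ‖v‖ := by
  rw [cubicDeriv_apply, abs_div, abs_of_pos (by norm_num : (0 : ℝ) < 6)]
  have h1 := hA v x x
  have h2 := hA x v x
  have h3 := hA x x v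
  have := abs_add_three (A v x x) (A x v x) (A x x v)
  rw [div_le_iff₀ (by norm_num)]
  linarith

theorem abs_cubicHess_le (hA : ∀ x y z, |A x y z| ≤ b * (‖x‖ * ‖y‖ * ‖z‖)) (v x : E) :
    |cubicHess A v x| ≤ b * ‖v‖ ^ 2 * ‖x‖ := by
  rw [cubicHess_apply, abs_div, abs_of_pos (by norm_num : (0 : ℝ) < 3)]
  have h1 := hA v v x
  have h2 := hA v x v
  have h3 := hA x v v
  have := abs_add_three (A v v x) (A v x v) (A x v v)
  rw [div_le_iff₀ (by norm_num)]
  linarith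

/-- The Laplacian of `cubicForm A` is `x ↦ ⟪w, x⟫` with `‖w‖ ≤ b d`. -/
theorem exists_laplacian_cubicForm {A : RVec d →L[ℝ] RVec d →L[ℝ] RVec d →L[ℝ] ℝ}
    (hb : 0 ≤ b) (hA : ∀ x y z, |A x y z| ≤ b * (‖x‖ * ‖y‖ * ‖z‖)) :
    ∃ w : RVec d, ‖w‖ ≤ b * d ∧
      ∀ x, ∑ i, cubicHess A (EuclideanSpace.basisFun (Fin d) ℝ i) x = ⟪x, w⟫ := by
  set φ : RVec d →L[ℝ] ℝ := ∑ i, cubicHess A (EuclideanSpace.basisFun (Fin d) ℝ i) with hφ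
  refine ⟨(InnerProductSpace.toDual ℝ (RVec d)).symm φ, ?_, fun x => ?_⟩
  · rw [LinearIsometryEquiv.norm_map]
    refine φ.opNorm_le_bound (by positivity) fun x => ?_
    rw [hφ, sum_apply, Real.norm_eq_abs]
    refine (Finset.abs_sum_le_sum_abs _ _).trans ?_
    calc ∑ i, |cubicHess A (EuclideanSpace.basisFun (Fin d) ℝ i) x|
        ≤ ∑ _i : Fin d, b * ‖x‖ := by
          refine Finset.sum_le_sum fun i _ => ?_
          have := abs_cubicHess_le hA (EuclideanSpace.basisFun (Fin d) ℝ i) x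
          rwa [OrthonormalBasis.norm_eq_one, one_pow, mul_one] at this
      _ = b * d * ‖x‖ := by simp; ring
  · rw [real_inner_comm, InnerProductSpace.toDual_symm_apply, hφ, sum_apply]

end Cubic

/-! ### Gaussian averages of hyperbolic functions of a cubic form -/

section GaussianCubic

variable {d : ℕ} {ρ b B : ℝ} {A : RVec d →L[ℝ] RVec d →L[ℝ] RVec d →L[ℝ] ℝ}

/-- The integral of `φ` against the Gaussian weight with the radial cutoff of radius `ρ`. -/
noncomputable def cutoffIntegral {d : ℕ} (ρ : ℝ) (φ : RVec d → ℝ) : ℝ :=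
  ∫ x, exp (-‖x‖ ^ 2 / 2) * (radialCutoff ρ x * φ x)

/-- The integral of `exp(-‖x‖²/4)` over the complement of a ball. -/
noncomputable def gaussianTail (d : ℕ) (ρ : ℝ) : ℝ :=
  ∫ x in {x : RVec d | ρ ^ 2 / 2 ≤ ‖x‖ ^ 2}, exp (-‖x‖ ^ 2 / 4)

theorem integrable_exp_neg_mul_norm_sq {c : ℝ} (hc : 0 < c) :
    Integrable fun x : RVec d => exp (-c * ‖x‖ ^ 2) := by
  have := GaussianFourier.integrable_cexp_neg_mul_sq_norm_add (V := RVec d) (b := (c : ℂ))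
    (by simpa using hc) 0 0
  refine this.norm.congr (.of_forall fun x => ?_)
  simp only [Complex.norm_exp]
  congr 1
  norm_cast
  simp

theorem integrable_exp_neg_norm_sq_div {c : ℝ} (hc : 0 < c) :
    Integrable fun x : RVec d => exp (-‖x‖ ^ 2 / c) :=
  (integrable_exp_neg_mul_norm_sq (d := d) (inv_pos.mpr hc)).congr
    (.of_forall fun x => by simp only; congr 1; field_simp)

theorem integral_exp_neg_norm_sq_div {c : ℝ} (hc : 0 < c) :
    ∫ x : RVec d, exp (-‖x‖ ^ 2 / c) = (π * c) ^ ((d : ℝ) / 2) := by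
  have := GaussianFourier.integral_rexp_neg_mul_sq_norm (V := RVec d) (inv_pos.mpr hc)
  rw [finrank_euclideanSpace_fin, div_inv_eq_mul] at this
  rw [← this]
  congr 1; ext x; congr 1; field_simp

theorem measurableSet_normSq_ge : MeasurableSet {x : RVec d | ρ ^ 2 / 2 ≤ ‖x‖ ^ 2} :=
  measurableSet_le (by fun_prop) (by fun_prop)

theorem gaussianTail_nonneg : 0 ≤ gaussianTail d ρ :=
  integral_nonneg fun _ => (exp_pos _).le

/-- Half of the exponent `‖x‖² / 4` yields the small factor, since `‖x‖² ≥ ρ² / 2` there; the other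
half keeps the integral convergent. -/
theorem gaussianTail_le : gaussianTail d ρ ≤ exp (-ρ ^ 2 / 16) * (8 * π) ^ ((d : ℝ) / 2) := by
  rw [mul_comm 8 π, ← integral_exp_neg_norm_sq_div (by norm_num), ← integral_const_mul,
    gaussianTail]
  have hi : Integrable fun x : RVec d => exp (-ρ ^ 2 / 16) * exp (-‖x‖ ^ 2 / 8) :=
    (integrable_exp_neg_norm_sq_div (by norm_num)).const_mul _
  refine (setIntegral_mono_on (integrable_exp_neg_norm_sq_div (by norm_num)).integrableOn
    hi.integrableOn measurableSet_normSq_ge fun x hx => ?_).trans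
    (setIntegral_le_integral hi (.of_forall fun x => by positivity))
  rw [← exp_add, exp_le_exp]
  rw [mem_ofPred_eq] at hx
  linarith

theorem abs_integral_le_mul_gaussianTail {f : RVec d → ℝ} {c : ℝ} (hc : 0 ≤ c)
    (hf : ∀ x, ρ ^ 2 / 2 ≤ ‖x‖ ^ 2 → |f x| ≤ c * exp (-‖x‖ ^ 2 / 4))
    (hz : ∀ x, ‖x‖ ^ 2 < ρ ^ 2 / 2 → f x = 0) : |∫ x, f x| ≤ c * gaussianTail d ρ := by
  rw [gaussianTail, ← integral_const_mul, ← integral_indicator measurableSet_normSq_ge,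
    ← Real.norm_eq_abs]
  refine norm_integral_le_of_norm_le
    (((integrable_exp_neg_norm_sq_div (by norm_num)).const_mul c).indicator
      measurableSet_normSq_ge) (.of_forall fun x => ?_)
  by_cases hx : ρ ^ 2 / 2 ≤ ‖x‖ ^ 2
  · rw [indicator_of_mem (by exact hx)]; exact hf x hx
  · rw [hz x (not_le.mp hx), norm_zero]
    exact indicator_nonneg (fun _ _ => by positivity) _

theorem cutoffIntegral_mono (hρ : 0 < ρ) {f g : RVec d → ℝ} (hf : Continuous f) (hg : Continuous g)
    (h : ∀ x, ‖x‖ ≤ ρ → f x ≤ g x) : cutoffIntegral ρ f ≤ cutoffIntegral ρ g := by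
  refine integral_mono (integrable_radialCutoff_mul hρ hf) (integrable_radialCutoff_mul hρ hg)
    fun x => ?_
  simp only
  rcases le_or_gt ‖x‖ ρ with hx | hx
  · have := radialCutoff_nonneg (ρ := ρ) x
    gcongr; exact h x hx
  · rw [radialCutoff_eq_zero hρ hx.le]; simp

theorem cutoffIntegral_add (hρ : 0 < ρ) {f g : RVec d → ℝ} (hf : Continuous f) (hg : Continuous g) :
    cutoffIntegral ρ (fun x => f x + g x) = cutoffIntegral ρ f + cutoffIntegral ρ g := by
  rw [cutoffIntegral, cutoffIntegral, cutoffIntegral,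
    ← integral_add (integrable_radialCutoff_mul hρ hf) (integrable_radialCutoff_mul hρ hg)]
  congr 1; ext x; ring

theorem cutoffIntegral_const_mul (c : ℝ) (f : RVec d → ℝ) :
    cutoffIntegral ρ (fun x => c * f x) = c * cutoffIntegral ρ f := by
  rw [cutoffIntegral, cutoffIntegral, ← integral_const_mul]
  congr 1; ext x; ring

theorem cutoffIntegral_eq_zero_of_odd {f : RVec d → ℝ} (hf : ∀ x, f (-x) = -f x) :
    cutoffIntegral ρ f = 0 := by
  have h := integral_neg_eq_self (fun x : RVec d => exp (-‖x‖ ^ 2 / 2) * (radialCutoff ρ x * f x))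
    volume
  have h2 : ∫ x : RVec d, exp (-‖-x‖ ^ 2 / 2) * (radialCutoff ρ (-x) * f (-x)) =
      -cutoffIntegral ρ f := by
    rw [cutoffIntegral, ← integral_neg]
    congr 1; ext x; rw [norm_neg, radialCutoff_neg, hf]; ring
  rw [h2] at h
  change -cutoffIntegral ρ f = cutoffIntegral ρ f at h
  linarith

/-- Since `b ‖x‖³ / 6 ≤ (3/2) ‖x‖² / 6`, the cubic term uses up at most half of the Gaussian
exponent on the ball; a weight `exp (-‖x‖² / 4)` is left. -/
theorem abs_cubicForm_le_norm_sq (hA : ∀ x y z, |A x y z| ≤ b * (‖x‖ * ‖y‖ * ‖z‖)) (hb : 0 ≤ b)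
    (hbρ : b * ρ ≤ 3 / 2) {x : RVec d} (hx : ‖x‖ ≤ ρ) : |cubicForm A x| ≤ ‖x‖ ^ 2 / 4 := by
  refine (abs_cubicForm_le hA x).trans ?_
  have h1 : b * ‖x‖ ≤ 3 / 2 := (by gcongr : b * ‖x‖ ≤ b * ρ).trans hbρ
  nlinarith [sq_nonneg ‖x‖]

theorem exp_mul_abs_sinh_cubicForm_le (hA : ∀ x y z, |A x y z| ≤ b * (‖x‖ * ‖y‖ * ‖z‖)) (hb : 0 ≤ b)
    (hbρ : b * ρ ≤ 3 / 2) {x : RVec d} (hx : ‖x‖ ≤ ρ) :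
    exp (-‖x‖ ^ 2 / 2) * |sinh (cubicForm A x)| ≤ exp (-‖x‖ ^ 2 / 4) := by
  calc exp (-‖x‖ ^ 2 / 2) * |sinh (cubicForm A x)|
      ≤ exp (-‖x‖ ^ 2 / 2) * exp (‖x‖ ^ 2 / 4) := by
        gcongr
        exact (abs_sinh_le_exp_abs _).trans
          (exp_le_exp.mpr (abs_cubicForm_le_norm_sq hA hb hbρ hx))
    _ = exp (-‖x‖ ^ 2 / 4) := by rw [← exp_add]; ring_nf

/-- The gradient of the cutoff lives in the shell `ρ² / 2 ≤ ‖x‖² ≤ ρ²`. There the slope is at most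
`4 B / ρ²` and `|⟪x, w⟫| ≤ ρ ‖w‖`, which produces the factor `4 B / ρ`. -/
theorem abs_integral_slope_linear_sinh_le (hρ : 0 < ρ)
    (hB : ∀ x, |deriv smoothTransition x| ≤ B)
    (hA : ∀ x y z, |A x y z| ≤ b * (‖x‖ * ‖y‖ * ‖z‖)) (hb : 0 ≤ b)
    (hbρ : b * ρ ≤ 3 / 2) (w : RVec d) :
    |∫ x, exp (-‖x‖ ^ 2 / 2) * (radialCutoffSlope ρ x * (⟪x, w⟫ * sinh (cubicForm A x)))| ≤
      4 * B / ρ * ‖w‖ * gaussianTail d ρ := by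
  have hB0 : 0 ≤ B := (abs_nonneg _).trans (hB 0)
  refine abs_integral_le_mul_gaussianTail (by positivity) (fun x _ => ?_) fun x hx => ?_
  · rcases le_or_gt ‖x‖ ρ with h | h
    · have h1 := exp_mul_abs_sinh_cubicForm_le hA hb hbρ h
      have h2 := abs_radialCutoffSlope_le (ρ := ρ) hB x
      have h3 : |⟪x, w⟫| ≤ ρ * ‖w‖ := (abs_real_inner_le_norm x w).trans (by gcongr)
      rw [abs_mul, abs_mul, abs_mul, abs_of_pos (exp_pos _)]
      calc exp (-‖x‖ ^ 2 / 2) * (|radialCutoffSlope ρ x| * (|⟪x, w⟫| * |sinh (cubicForm A x)|))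
          = |radialCutoffSlope ρ x| * |⟪x, w⟫| *
              (exp (-‖x‖ ^ 2 / 2) * |sinh (cubicForm A x)|) := by ring
        _ ≤ 4 / ρ ^ 2 * B * (ρ * ‖w‖) * exp (-‖x‖ ^ 2 / 4) := by gcongr
        _ = _ := by field_simp
    · rw [radialCutoffSlope_eq_zero hρ (Or.inr h)]
      simp only [zero_mul, mul_zero, abs_zero]; positivity
  · rw [radialCutoffSlope_eq_zero hρ (Or.inl hx)]; ring

theorem continuous_cosh_cubicForm : Continuous fun x => cosh (cubicForm A x) :=
  continuous_cosh.comp continuous_cubicForm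

theorem continuous_sinh_cubicForm : Continuous fun x => sinh (cubicForm A x) :=
  continuous_sinh.comp continuous_cubicForm

/-- Integrating by parts in the direction `w` trades the factor `⟪x, w⟫` for a derivative of the
cubic form, of size `b ρ² ‖w‖ / 2`. A pointwise bound by `ρ ‖w‖` times the cubic form would be
larger by a factor of order `ρ²`. -/
theorem abs_cutoffIntegral_linear_sinh_le (hρ : 0 < ρ)
    (hB : ∀ x, |deriv smoothTransition x| ≤ B)
    (hA : ∀ x y z, |A x y z| ≤ b * (‖x‖ * ‖y‖ * ‖z‖)) (hb : 0 ≤ b)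
    (hbρ : b * ρ ≤ 3 / 2) (w : RVec d) :
    |cutoffIntegral ρ fun x => ⟪x, w⟫ * sinh (cubicForm A x)| ≤
      4 * B / ρ * ‖w‖ * gaussianTail d ρ +
        b * ρ ^ 2 / 2 * ‖w‖ * cutoffIntegral ρ fun x => cosh (cubicForm A x) := by
  have hc := continuous_cosh_cubicForm (A := A)
  have hs := continuous_sinh_cubicForm (A := A)
  have hd := continuous_cubicDeriv_apply (A := A) w
  have key := integral_gaussian_cutoff_by_parts hρ (v := w) hs (hd.mul hc) fun x => by
    have := hasLineDerivAt_cubicForm (A := A) x w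
    unfold HasLineDerivAt at this ⊢
    refine this.sinh.congr_deriv ?_
    simp; ring
  rw [cutoffIntegral, key]
  refine (abs_add_le _ _).trans (add_le_add
    (abs_integral_slope_linear_sinh_le hρ hB hA hb hbρ w) ?_)
  have hle : ∀ x, ‖x‖ ≤ ρ → |cubicDeriv A x w * cosh (cubicForm A x)| ≤
      b * ρ ^ 2 / 2 * ‖w‖ * cosh (cubicForm A x) := by
    intro x hx
    rw [abs_mul, abs_of_pos (cosh_pos _)]
    refine mul_le_mul_of_nonneg_right ((abs_cubicDeriv_le hA x w).trans ?_) (cosh_pos _).le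
    gcongr
  rw [← cutoffIntegral_const_mul, abs_le]
  constructor
  · have h1 : -cutoffIntegral ρ (fun x => b * ρ ^ 2 / 2 * ‖w‖ * cosh (cubicForm A x)) =
        cutoffIntegral ρ (fun x => -1 * (b * ρ ^ 2 / 2 * ‖w‖ * cosh (cubicForm A x))) := by
      rw [cutoffIntegral_const_mul (-1)]; ring
    rw [h1]
    refine cutoffIntegral_mono hρ (by fun_prop) (hd.mul hc) fun x hx => ?_
    have := (abs_le.mp (hle x hx)).1
    simp only [Pi.mul_apply]
    linarith
  · exact cutoffIntegral_mono hρ (hd.mul hc) (by fun_prop) fun x hx => (abs_le.mp (hle x hx)).2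

/-- With `t` the cubic form, Euler's identity writes `3 t sinh t` as the radial field `x` paired
with `sinh t ∇t`. Integration by parts over an orthonormal basis leaves `Δt sinh t + |∇t|² cosh t`.
The Laplacian is linear in `x`, so its term can be integrated by parts once more; the gradient term
is bounded pointwise on the ball. -/
theorem cutoffIntegral_cubic_mul_sinh_le (hρ : 0 < ρ)
    (hB : ∀ x, |deriv smoothTransition x| ≤ B)
    (hA : ∀ x y z, |A x y z| ≤ b * (‖x‖ * ‖y‖ * ‖z‖)) (hb : 0 ≤ b)
    (hbρ : b * ρ ≤ 3 / 2) :
    3 * cutoffIntegral ρ (fun x => cubicForm A x * sinh (cubicForm A x)) ≤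
      4 * B / ρ * (b * d) * gaussianTail d ρ +
        (b * ρ ^ 2 / 2 * (b * d) + (b * ρ ^ 2 / 2) ^ 2) *
          cutoffIntegral ρ fun x => cosh (cubicForm A x) := by
  have hB0 : 0 ≤ B := (abs_nonneg _).trans (hB 0)
  have hc := continuous_cosh_cubicForm (A := A)
  have hs := continuous_sinh_cubicForm (A := A)
  have ht := continuous_cubicForm (A := A)
  obtain ⟨w, hw, hlap⟩ := exists_laplacian_cubicForm hb hA
  set e := EuclideanSpace.basisFun (Fin d) ℝ with he
  have hd := fun i => continuous_cubicDeriv_apply (A := A) (e i)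
  have hh : ∀ i, Continuous fun x => cubicHess A (e i) x := fun i => by fun_prop
  have hparts := fun i => integral_gaussian_cutoff_by_parts hρ (v := e i)
    (u := fun x => cubicDeriv A x (e i) * sinh (cubicForm A x))
    (u' := fun x => cubicHess A (e i) x * sinh (cubicForm A x) +
      cubicDeriv A x (e i) ^ 2 * cosh (cubicForm A x)) ((hd i).mul hs)
    (((hh i).mul hs).add (((hd i).pow 2).mul hc)) fun x => by
      have h1 := hasLineDerivAt_cubicForm (A := A) x (e i)
      have h2 := hasLineDerivAt_cubicDeriv (A := A) x (e i)
      unfold HasLineDerivAt at h1 h2 ⊢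
      refine (h2.fun_mul h1.sinh).congr_deriv ?_
      simp; ring
  have hEuler : ∀ x, ∑ i, ⟪x, e i⟫ * (cubicDeriv A x (e i) * sinh (cubicForm A x)) =
      3 * (cubicForm A x * sinh (cubicForm A x)) := by
    intro x
    have hx : cubicDeriv A x x = ∑ i, ⟪x, e i⟫ * cubicDeriv A x (e i) := by
      conv_lhs => rw [← e.sum_repr' x, map_sum]
      refine Finset.sum_congr rfl fun i _ => ?_
      rw [map_smul, smul_eq_mul, real_inner_comm, e.sum_repr' x]
    rw [← mul_assoc, ← cubicDeriv_self, hx, Finset.sum_mul]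
    exact Finset.sum_congr rfl fun i _ => by ring
  have hL : ∑ i, ∫ x, exp (-‖x‖ ^ 2 / 2) * (radialCutoff ρ x *
      (⟪x, e i⟫ * (cubicDeriv A x (e i) * sinh (cubicForm A x)))) =
      3 * cutoffIntegral ρ (fun x => cubicForm A x * sinh (cubicForm A x)) := by
    rw [← integral_finsetSum _ fun i _ => integrable_radialCutoff_mul hρ
      (f := fun x => ⟪x, e i⟫ * (cubicDeriv A x (e i) * sinh (cubicForm A x)))
      (Continuous.mul (by fun_prop) ((hd i).mul hs)), ← cutoffIntegral_const_mul, cutoffIntegral]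
    congr 1; ext x
    rw [← hEuler, Finset.mul_sum, Finset.mul_sum]
  -- Summed over the basis, the cutoff terms are a nonpositive slope times `3 t sinh t ≥ 0`, so they
  -- only help.
  have hR1 : ∑ i, ∫ x, exp (-‖x‖ ^ 2 / 2) * (radialCutoffSlope ρ x *
      (⟪x, e i⟫ * (cubicDeriv A x (e i) * sinh (cubicForm A x)))) ≤ 0 := by
    rw [← integral_finsetSum _ fun i _ => integrable_radialCutoffSlope_mul hρ
      (f := fun x => ⟪x, e i⟫ * (cubicDeriv A x (e i) * sinh (cubicForm A x)))
      (Continuous.mul (by fun_prop) ((hd i).mul hs))]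
    refine integral_nonpos fun x => ?_
    simp only [← Finset.mul_sum]
    rw [hEuler]
    exact mul_nonpos_of_nonneg_of_nonpos (exp_pos _).le
      (mul_nonpos_of_nonpos_of_nonneg (radialCutoffSlope_nonpos x)
        (mul_nonneg (by norm_num) (mul_sinh_nonneg _)))
  have hR2 : ∑ i, ∫ x, exp (-‖x‖ ^ 2 / 2) * (radialCutoff ρ x *
      (cubicHess A (e i) x * sinh (cubicForm A x) +
        cubicDeriv A x (e i) ^ 2 * cosh (cubicForm A x))) =
      cutoffIntegral ρ (fun x => ⟪x, w⟫ * sinh (cubicForm A x)) +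
      cutoffIntegral ρ (fun x => (∑ i, cubicDeriv A x (e i) ^ 2) * cosh (cubicForm A x)) := by
    rw [← integral_finsetSum _ fun i _ => integrable_radialCutoff_mul hρ
      (f := fun x => cubicHess A (e i) x * sinh (cubicForm A x) +
        cubicDeriv A x (e i) ^ 2 * cosh (cubicForm A x))
      (((hh i).mul hs).add (((hd i).pow 2).mul hc)), ← cutoffIntegral_add hρ
      (f := fun x => ⟪x, w⟫ * sinh (cubicForm A x))
      (g := fun x => (∑ i, cubicDeriv A x (e i) ^ 2) * cosh (cubicForm A x))
      (Continuous.mul (by fun_prop) hs)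
      (Continuous.mul (continuous_finsetSum _ fun i _ => (hd i).pow 2) hc), cutoffIntegral]
    congr 1; ext x
    rw [← hlap, Finset.sum_mul, Finset.sum_mul, ← Finset.sum_add_distrib, Finset.mul_sum,
      Finset.mul_sum]
  have hlin := (le_abs_self _).trans (abs_cutoffIntegral_linear_sinh_le hρ hB hA hb hbρ w)
  have hgrad : cutoffIntegral ρ (fun x => (∑ i, cubicDeriv A x (e i) ^ 2) * cosh (cubicForm A x)) ≤
      (b * ρ ^ 2 / 2) ^ 2 * cutoffIntegral ρ fun x => cosh (cubicForm A x) := by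
    rw [← cutoffIntegral_const_mul]
    refine cutoffIntegral_mono hρ
      (Continuous.mul (continuous_finsetSum _ fun i _ => (hd i).pow 2) hc) (by fun_prop)
      fun x hx => ?_
    refine mul_le_mul_of_nonneg_right ?_ (cosh_pos _).le
    refine (sum_sq_apply_basisFun_le _ (abs_cubicDeriv_le hA x) (by positivity)).trans ?_
    gcongr
  have hcosh : 0 ≤ cutoffIntegral ρ fun x => cosh (cubicForm A x) :=
    integral_nonneg fun x => mul_nonneg (exp_pos _).le
      (mul_nonneg (radialCutoff_nonneg x) (cosh_pos _).le)
  have hT := gaussianTail_nonneg (d := d) (ρ := ρ)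
  rw [← hL, Finset.sum_congr rfl fun i _ => hparts i, Finset.sum_add_distrib, hR2]
  have hm1 : 4 * B / ρ * ‖w‖ * gaussianTail d ρ ≤ 4 * B / ρ * (b * d) * gaussianTail d ρ := by
    gcongr
  have hm2 : b * ρ ^ 2 / 2 * ‖w‖ * cutoffIntegral ρ (fun x => cosh (cubicForm A x)) ≤
      b * ρ ^ 2 / 2 * (b * d) * cutoffIntegral ρ fun x => cosh (cubicForm A x) := by
    gcongr
  linarith

end GaussianCubic

/-! ### Dimension-free Laplace approximation in Gaussian coordinates -/

section GaussianLaplace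

variable {d : ℕ} {R ρ b B c : ℝ} {A : RVec d →L[ℝ] RVec d →L[ℝ] RVec d →L[ℝ] ℝ}

/-- A bound on the exponential moment of a cubic form, relative to the Gaussian mass. -/
noncomputable def cubicMomentConst (B R c : ℝ) : ℝ := 2 * (exp (1 + 4 * (R ^ 4 * c)) + 4 * B)

/-- Passing from `8π` to `2π` costs `2^d ≤ exp d`, while the decay is `exp (-R² d / 64)`. Half of
that decay pays for `2^d` because `R ≥ 24`. -/
theorem gaussianTail_le_mass (hρR : ρ = R * √d / 2) (hR : 24 ≤ R) :
    gaussianTail d ρ ≤ exp (-(R ^ 2 * d / 128)) * (2 * π) ^ ((d : ℝ) / 2) := by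
  refine gaussianTail_le.trans ?_
  have h1 : (8 * π) ^ ((d : ℝ) / 2) = exp ((d : ℝ) * log 2) * (2 * π) ^ ((d : ℝ) / 2) := by
    rw [show (8 : ℝ) * π = 4 * (2 * π) by ring, mul_rpow (by norm_num) (by positivity),
      mul_comm (d : ℝ) (log 2), ← Real.rpow_def_of_pos (by norm_num : (0 : ℝ) < 2),
      show (4 : ℝ) = 2 ^ (2 : ℝ) by norm_num, ← rpow_mul (by norm_num)]
    congr 2; ring
  rw [h1, ← mul_assoc, ← exp_add]
  gcongr
  rw [hρR, div_pow, mul_pow, sq_sqrt (Nat.cast_nonneg d)]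
  have hl : log 2 ≤ 1 := by have := log_two_lt_d9; linarith
  have hd : (0 : ℝ) ≤ d := Nat.cast_nonneg d
  nlinarith [mul_nonneg hd (sub_nonneg.mpr hl), mul_nonneg hd (by nlinarith : (0 : ℝ) ≤ R ^ 2 - 576)]

theorem gaussianTail_le_mass' (hρR : ρ = R * √d / 2) (hR : 24 ≤ R) :
    gaussianTail d ρ ≤ (2 * π) ^ ((d : ℝ) / 2) := by
  refine (gaussianTail_le_mass hρR hR).trans (mul_le_of_le_one_left (by positivity) ?_)
  rw [exp_le_one_iff, neg_nonpos]; positivity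

theorem cutoffIntegral_cosh_nonneg :
    0 ≤ cutoffIntegral ρ fun x : RVec d => cosh (cubicForm A x) :=
  integral_nonneg fun x => mul_nonneg (exp_pos _).le
    (mul_nonneg (radialCutoff_nonneg x) (cosh_pos _).le)

theorem cutoffIntegral_one_le (hρ : 0 < ρ) :
    cutoffIntegral ρ (fun _ : RVec d => 1) ≤ (2 * π) ^ ((d : ℝ) / 2) := by
  rw [mul_comm 2 π, ← integral_exp_neg_norm_sq_div (by norm_num)]
  refine integral_mono (integrable_radialCutoff_mul hρ continuous_const)
    (integrable_exp_neg_norm_sq_div (by norm_num)) fun x => ?_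
  simp only [mul_one]
  exact mul_le_of_le_one_right (exp_pos _).le (radialCutoff_le_one x)

theorem le_cutoffIntegral_one (hρ : 0 < ρ) :
    (2 * π) ^ ((d : ℝ) / 2) - gaussianTail d ρ ≤ cutoffIntegral ρ (fun _ : RVec d => 1) := by
  rw [mul_comm 2 π, ← integral_exp_neg_norm_sq_div (by norm_num), sub_le_comm, cutoffIntegral,
    ← integral_sub (integrable_exp_neg_norm_sq_div (by norm_num))
      (integrable_radialCutoff_mul hρ continuous_const)]
  refine (le_abs_self _).trans ((abs_integral_le_mul_gaussianTail zero_le_one (fun x _ => ?_)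
    fun x hx => ?_).trans_eq (one_mul _))
  · have h0 := radialCutoff_nonneg (ρ := ρ) x
    have h1 := radialCutoff_le_one (ρ := ρ) x
    rw [mul_one, ← mul_one_sub, abs_of_nonneg (mul_nonneg (exp_pos _).le (by linarith)), one_mul]
    refine (mul_le_of_le_one_right (exp_pos _).le (by linarith)).trans (exp_le_exp.mpr ?_)
    nlinarith [sq_nonneg ‖x‖]
  · rw [radialCutoff_eq_one hρ hx.le]; ring

/-- The standing assumptions on the radius and on a cubic form. -/
structure CubicBound (A : RVec d →L[ℝ] RVec d →L[ℝ] RVec d →L[ℝ] ℝ) (b R ρ c : ℝ) : Prop where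
  one_le_dim : 1 ≤ d
  le_R : 24 ≤ R
  rho_eq : ρ = R * √d / 2
  nonneg : 0 ≤ b
  bound : ∀ x y z, |A x y z| ≤ b * (‖x‖ * ‖y‖ * ‖z‖)
  mul_rho_le : b * ρ ≤ 3 / 2
  sq_le : (b * d) ^ 2 ≤ c

namespace CubicBound

theorem le_rho (h : CubicBound A b R ρ c) : 12 ≤ ρ := by
  rw [h.rho_eq]
  have h1 : (1 : ℝ) ≤ √d := by
    rw [Real.one_le_sqrt]; exact_mod_cast h.one_le_dim
  nlinarith [h.le_R]

theorem rho_pos (h : CubicBound A b R ρ c) : 0 < ρ := by linarith [h.le_rho]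

theorem c_nonneg (h : CubicBound A b R ρ c) : 0 ≤ c := (sq_nonneg _).trans h.sq_le

theorem rho_sq (h : CubicBound A b R ρ c) : ρ ^ 2 = R ^ 2 * d / 4 := by
  rw [h.rho_eq, div_pow, mul_pow, sq_sqrt (Nat.cast_nonneg d)]; norm_num

theorem mul_dim_le (h : CubicBound A b R ρ c) : b * d ≤ ρ / 8 := by
  have h1 := h.rho_sq
  have h2 : (d : ℝ) ≤ ρ ^ 2 / 12 := by
    have : (0 : ℝ) ≤ d := Nat.cast_nonneg d
    have := h.le_R
    rw [h1]
    nlinarith [mul_nonneg (Nat.cast_nonneg (α := ℝ) d)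
      (by nlinarith : (0 : ℝ) ≤ R ^ 2 - 576)]
  have h3 : b * d ≤ b * (ρ ^ 2 / 12) := mul_le_mul_of_nonneg_left h2 h.nonneg
  nlinarith [h.mul_rho_le, h.rho_pos]

/-- As `ρ` is of order `√d`, the bound on the gradient of the cubic form over the ball is `b d` up
to a power of `R`. Hence `b d`, and not `b d^{3/2}`, is the small parameter. -/
theorem half_mul_rho_sq (h : CubicBound A b R ρ c) : b * ρ ^ 2 / 2 = R ^ 2 / 8 * (b * d) := by
  rw [h.rho_sq]; ring

theorem cutoffIntegral_cubic_mul_sinh_le' (h : CubicBound A b R ρ c)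
    (hB : ∀ x, |deriv smoothTransition x| ≤ B) :
    cutoffIntegral ρ (fun x => cubicForm A x * sinh (cubicForm A x)) ≤
      R ^ 4 * (b * d) ^ 2 * cutoffIntegral ρ (fun x => cosh (cubicForm A x)) +
        B * gaussianTail d ρ := by
  have hB0 : 0 ≤ B := (abs_nonneg _).trans (hB 0)
  have h1 := cutoffIntegral_cubic_mul_sinh_le h.rho_pos hB h.bound h.nonneg h.mul_rho_le
  have hA := cutoffIntegral_cosh_nonneg (ρ := ρ) (A := A)
  have hT := gaussianTail_nonneg (d := d) (ρ := ρ)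
  have hR := h.le_R
  have h2 : 4 * B / ρ * (b * d) * gaussianTail d ρ ≤ 3 * (B * gaussianTail d ρ) := by
    have : (b * d) / ρ ≤ 1 / 8 := by rw [div_le_iff₀ h.rho_pos]; linarith [h.mul_dim_le]
    calc 4 * B / ρ * (b * d) * gaussianTail d ρ = 4 * (B * gaussianTail d ρ) * (b * d / ρ) := by ring
      _ ≤ 4 * (B * gaussianTail d ρ) * (1 / 8) := by gcongr
      _ ≤ _ := by nlinarith [mul_nonneg hB0 hT]
  have h3 : b * ρ ^ 2 / 2 * (b * d) + (b * ρ ^ 2 / 2) ^ 2 ≤ 3 * (R ^ 4 * (b * d) ^ 2) := by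
    rw [h.half_mul_rho_sq]
    have : R ^ 2 ≤ R ^ 4 := pow_le_pow_right₀ (by linarith) (by norm_num)
    nlinarith [sq_nonneg (b * d), mul_le_mul_of_nonneg_right this (sq_nonneg (b * d)),
      mul_nonneg (sq_nonneg (R ^ 2)) (sq_nonneg (b * d))]
  have h4 := mul_le_mul_of_nonneg_right h3 hA
  linarith

/-- An absorption argument. The average of `t sinh t` is at most `R⁴ (b d)²` times that of `cosh t`
plus a tail; multiplied by `2 / K` this returns at most half of the average of `cosh t`, which is
moved to the left. -/
theorem cutoffIntegral_cosh_le (h : CubicBound A b R ρ c)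
    (hB : ∀ x, |deriv smoothTransition x| ≤ B) :
    cutoffIntegral ρ (fun x => cosh (cubicForm A x)) ≤
      cubicMomentConst B R c * (2 * π) ^ ((d : ℝ) / 2) := by
  have hB0 : 0 ≤ B := (abs_nonneg _).trans (hB 0)
  have h1 := h.cutoffIntegral_cubic_mul_sinh_le' hB
  have hA := cutoffIntegral_cosh_nonneg (ρ := ρ) (A := A)
  have hT := gaussianTail_le_mass' (d := d) h.rho_eq h.le_R
  have hc0 := h.c_nonneg
  set Z := (2 * π) ^ ((d : ℝ) / 2) with hZ
  -- Chosen so that `2 / K * (R ^ 4 * (b * d) ^ 2) ≤ 1 / 2`; the summand 1 ensures `K ≥ 1`.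
  set K := 1 + 4 * (R ^ 4 * c) with hK
  set I := cutoffIntegral ρ (fun x => cosh (cubicForm A x)) with hI
  have hK1 : 1 ≤ K := by rw [hK]; have : 0 ≤ R ^ 4 * c := by positivity
                         linarith
  have hZ0 : 0 ≤ Z := by positivity
  have h2 : I ≤ cosh K * cutoffIntegral ρ (fun _ : RVec d => 1) +
      2 / K * cutoffIntegral ρ (fun x => cubicForm A x * sinh (cubicForm A x)) := by
    have hc := continuous_cosh_cubicForm (A := A)
    have hs := continuous_sinh_cubicForm (A := A)
    have ht := continuous_cubicForm (A := A)
    rw [← cutoffIntegral_const_mul, ← cutoffIntegral_const_mul,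
      ← cutoffIntegral_add h.rho_pos (by fun_prop) (by fun_prop)]
    refine cutoffIntegral_mono h.rho_pos hc (by fun_prop) fun x _ => ?_
    rw [mul_one]
    exact cosh_le_cosh_add_mul_sinh hK1 _
  have h3 : cosh K ≤ exp K := by
    rw [cosh_eq]
    have : exp (-K) ≤ exp K := exp_le_exp.mpr (by linarith)
    linarith
  have h4 : cosh K * cutoffIntegral ρ (fun _ : RVec d => 1) ≤ exp K * Z :=
    mul_le_mul h3 (cutoffIntegral_one_le h.rho_pos)
      (integral_nonneg fun x => mul_nonneg (exp_pos _).le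
        (mul_nonneg (radialCutoff_nonneg x) zero_le_one)) (exp_pos _).le
  have h5 : 2 / K * (R ^ 4 * (b * d) ^ 2 * I) ≤ I / 2 := by
    have : R ^ 4 * (b * d) ^ 2 ≤ K / 4 := by
      have := mul_le_mul_of_nonneg_left h.sq_le (by positivity : (0 : ℝ) ≤ R ^ 4)
      rw [hK]; linarith
    calc 2 / K * (R ^ 4 * (b * d) ^ 2 * I) ≤ 2 / K * (K / 4 * I) := by gcongr
      _ = I / 2 := by field_simp; norm_num
  have h6 : 2 / K * (B * gaussianTail d ρ) ≤ 2 * (B * Z) := by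
    have : 2 / K ≤ 2 := by rw [div_le_iff₀ (by linarith)]; linarith
    have hT0 := gaussianTail_nonneg (d := d) (ρ := ρ)
    gcongr
  have h7 : 2 / K * cutoffIntegral ρ (fun x => cubicForm A x * sinh (cubicForm A x)) ≤
      2 / K * (R ^ 4 * (b * d) ^ 2 * I + B * gaussianTail d ρ) := by gcongr
  rw [cubicMomentConst, ← hK]
  nlinarith [mul_nonneg hB0 hZ0]

/-- By parity only `cosh t + ⟪x, g⟫ sinh t` survives. The first term lies between 1 and `1 + t sinh
t`, and the second is integrated by parts, giving the product `‖g‖ * (b * d)` up to powers of `R`,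
which is split into squares. No term of first order in `b d` or `‖g‖` remains. -/
theorem abs_cutoffIntegral_exp_mul_sub_le (h : CubicBound A b R ρ c)
    (hB : ∀ x, |deriv smoothTransition x| ≤ B) {g : RVec d} (hg : ‖g‖ * ρ ≤ 1 / 2) :
    |cutoffIntegral ρ (fun x => exp (-cubicForm A x) * (1 - ⟪x, g⟫)) - (2 * π) ^ ((d : ℝ) / 2)| ≤
      (1 + 2 * B) * gaussianTail d ρ + R ^ 4 * (‖g‖ ^ 2 + 2 * (b * d) ^ 2) *
        cutoffIntegral ρ (fun x => cosh (cubicForm A x)) := by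
  have hB0 : 0 ≤ B := (abs_nonneg _).trans (hB 0)
  have hT0 := gaussianTail_nonneg (d := d) (ρ := ρ)
  have hA := cutoffIntegral_cosh_nonneg (ρ := ρ) (A := A)
  have hc := continuous_cosh_cubicForm (A := A)
  have hs := continuous_sinh_cubicForm (A := A)
  have ht := continuous_cubicForm (A := A)
  have hR := h.le_R
  have hR4 : R ^ 2 ≤ R ^ 4 := pow_le_pow_right₀ (by linarith) (by norm_num)
  have hsplit : cutoffIntegral ρ (fun x => exp (-cubicForm A x) * (1 - ⟪x, g⟫)) =
      cutoffIntegral ρ (fun x => cosh (cubicForm A x)) +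
        cutoffIntegral ρ (fun x => ⟪x, g⟫ * sinh (cubicForm A x)) := by
    have hodd : cutoffIntegral ρ (fun x => -sinh (cubicForm A x) - ⟪x, g⟫ * cosh (cubicForm A x))
        = 0 := cutoffIntegral_eq_zero_of_odd fun x => by
      rw [cubicForm_neg, sinh_neg, cosh_neg, inner_neg_left]; ring
    rw [← add_zero (cutoffIntegral ρ (fun x => cosh (cubicForm A x)) + _), ← hodd,
      ← cutoffIntegral_add h.rho_pos (by fun_prop) (by fun_prop),
      ← cutoffIntegral_add h.rho_pos (by fun_prop) (by fun_prop)]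
    congr 1; ext x
    rw [← cosh_sub_sinh]; ring
  have h1 := h.cutoffIntegral_cubic_mul_sinh_le' hB
  have h2 := abs_cutoffIntegral_linear_sinh_le h.rho_pos hB h.bound h.nonneg h.mul_rho_le g
  have h3 := cutoffIntegral_one_le (d := d) h.rho_pos
  have h4 := le_cutoffIntegral_one (d := d) h.rho_pos
  have h5 : cutoffIntegral ρ (fun _ : RVec d => 1) ≤
      cutoffIntegral ρ (fun x => cosh (cubicForm A x)) :=
    cutoffIntegral_mono h.rho_pos continuous_const hc fun x _ => one_le_cosh _
  have h6 : cutoffIntegral ρ (fun x => cosh (cubicForm A x)) ≤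
      cutoffIntegral ρ (fun x => cubicForm A x * sinh (cubicForm A x)) +
        cutoffIntegral ρ (fun _ : RVec d => 1) := by
    rw [← cutoffIntegral_add h.rho_pos (by fun_prop) continuous_const]
    refine cutoffIntegral_mono h.rho_pos hc (by fun_prop) fun x _ => ?_
    linarith [cosh_sub_one_le_mul_sinh (cubicForm A x)]
  have h7 : 4 * B / ρ * ‖g‖ * gaussianTail d ρ ≤ B * gaussianTail d ρ := by
    have h8 : ‖g‖ / ρ ≤ 1 / 4 := by
      rw [div_le_iff₀ h.rho_pos]
      nlinarith [h.le_rho, norm_nonneg g]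
    calc 4 * B / ρ * ‖g‖ * gaussianTail d ρ = 4 * (B * gaussianTail d ρ) * (‖g‖ / ρ) := by ring
      _ ≤ 4 * (B * gaussianTail d ρ) * (1 / 4) := by gcongr
      _ = _ := by ring
  have h8 : b * ρ ^ 2 / 2 * ‖g‖ ≤ R ^ 4 * (‖g‖ ^ 2 + (b * d) ^ 2) := by
    rw [h.half_mul_rho_sq]
    have hx : ‖g‖ * (b * d) ≤ ‖g‖ ^ 2 + (b * d) ^ 2 := by
      nlinarith [sq_nonneg (‖g‖ - b * d), sq_nonneg ‖g‖, sq_nonneg (b * d)]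
    have hbd : 0 ≤ b * d := mul_nonneg h.nonneg (Nat.cast_nonneg d)
    calc R ^ 2 / 8 * (b * d) * ‖g‖ = R ^ 2 / 8 * (‖g‖ * (b * d)) := by ring
      _ ≤ R ^ 4 * (‖g‖ ^ 2 + (b * d) ^ 2) := by
        gcongr
        nlinarith [sq_nonneg R]
  have h9 := mul_le_mul_of_nonneg_right h8 hA
  rw [hsplit, abs_le]
  have h10 := abs_le.mp h2
  have h11 : 0 ≤ R ^ 4 * (b * d) ^ 2 * cutoffIntegral ρ (fun x => cosh (cubicForm A x)) := by
    positivity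
  constructor <;> nlinarith

/-- Laplace approximation in Gaussian coordinates, with bounds that do not depend on the
dimension beyond the size `b d` of the cubic term. -/
theorem abs_setIntegral_sub_le (h : CubicBound A b R ρ c)
    (hB : ∀ x, |deriv smoothTransition x| ≤ B) {g : RVec d} (hg : ‖g‖ * ρ ≤ 1 / 2)
    {F J : RVec d → ℝ} {q e : ℝ} (hq : q ≤ R ^ 4 * c) (he : 0 ≤ e)
    (hF : ∀ x, ‖x‖ ≤ ρ → |F x - (‖x‖ ^ 2 / 2 + cubicForm A x)| ≤ q)
    (hF4 : ∀ x, ‖x‖ ≤ ρ → ‖x‖ ^ 2 / 4 ≤ F x)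
    (hJ : ∀ x, ‖x‖ ≤ ρ → |J x - (1 - ⟪x, g⟫)| ≤ e) (hJ2 : ∀ x, ‖x‖ ≤ ρ → |J x| ≤ 2)
    (hint : IntegrableOn (fun x => exp (-F x) * J x) (Metric.closedBall 0 ρ)) :
    |(∫ x in Metric.closedBall 0 ρ, exp (-F x) * J x) - (2 * π) ^ ((d : ℝ) / 2)| ≤
      (2 * π) ^ ((d : ℝ) / 2) *
        (cubicMomentConst B R c * (2 * exp (R ^ 4 * c) + 2 * R ^ 4) *
          ((b * d) ^ 2 + q + ‖g‖ ^ 2 + e + exp (-(R ^ 2 * d / 128)))) := by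
  have hB0 : 0 ≤ B := (abs_nonneg _).trans (hB 0)
  have hρ := h.rho_pos
  have hq0 : 0 ≤ q := (abs_nonneg _).trans (hF 0 (by simpa using hρ.le))
  set S := Metric.closedBall (0 : RVec d) ρ with hS
  have hmemS : ∀ x, x ∈ S ↔ ‖x‖ ≤ ρ := fun x => by rw [hS, mem_closedBall_zero_iff]
  have hSm : MeasurableSet S := Metric.isClosed_closedBall.measurableSet
  have ht := continuous_cubicForm (A := A)
  have hc := continuous_cosh_cubicForm (A := A)
  -- the part of the integral removed by the cutoff
  have hintχ : IntegrableOn (fun x => radialCutoff ρ x * (exp (-F x) * J x)) S :=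
    hint.bdd_mul (continuous_radialCutoff.aestronglyMeasurable) (c := 1)
      (.of_forall fun x => by
        rw [Real.norm_eq_abs, abs_of_nonneg (radialCutoff_nonneg x)]; exact radialCutoff_le_one x)
  have step1 : |(∫ x in S, exp (-F x) * J x) - ∫ x in S, radialCutoff ρ x * (exp (-F x) * J x)| ≤
      2 * gaussianTail d ρ := by
    rw [← integral_sub hint hintχ, ← integral_indicator hSm]
    refine abs_integral_le_mul_gaussianTail (by norm_num) (fun x _ => ?_) fun x hx => ?_
    · by_cases hxS : x ∈ S
      · rw [indicator_of_mem hxS]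
        have h0 := radialCutoff_nonneg (ρ := ρ) x
        have h1 := radialCutoff_le_one (ρ := ρ) x
        have hxρ := (hmemS x).mp hxS
        have h2 := hF4 x hxρ
        have h3 := hJ2 x hxρ
        rw [← one_sub_mul, abs_mul, abs_mul, abs_of_pos (exp_pos _), abs_of_nonneg (by linarith)]
        calc (1 - radialCutoff ρ x) * (exp (-F x) * |J x|)
            ≤ 1 * (exp (-‖x‖ ^ 2 / 4) * 2) := by
              gcongr
              · linarith
              · linarith
          _ = 2 * exp (-‖x‖ ^ 2 / 4) := by ring
      · rw [indicator_of_notMem hxS, abs_zero]; positivity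
    · by_cases hxS : x ∈ S
      · rw [indicator_of_mem hxS, radialCutoff_eq_one hρ hx.le]; ring
      · rw [indicator_of_notMem hxS]
  -- replacing the phase and the amplitude by their leading terms
  have hset : ∀ f : RVec d → ℝ, cutoffIntegral ρ f =
      ∫ x in S, exp (-‖x‖ ^ 2 / 2) * (radialCutoff ρ x * f x) := fun f => by
    rw [cutoffIntegral, setIntegral_eq_integral_of_forall_compl_eq_zero]
    intro x hx
    rw [hmemS, not_le] at hx
    rw [radialCutoff_eq_zero hρ hx.le]; ring
  have step2 : |(∫ x in S, radialCutoff ρ x * (exp (-F x) * J x)) -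
      cutoffIntegral ρ (fun x => exp (-cubicForm A x) * (1 - ⟪x, g⟫))| ≤
      exp q * (e + 2 * q) * cutoffIntegral ρ (fun x => cosh (cubicForm A x)) := by
    -- The error is majorized pointwise by a multiple of `exp (-t)`, whose average equals that of
    -- `cosh t` because `sinh t` is odd.
    have hcosh : cutoffIntegral ρ (fun x => cosh (cubicForm A x)) =
        cutoffIntegral ρ (fun x => exp (-cubicForm A x)) := by
      have hodd : cutoffIntegral ρ (fun x => -sinh (cubicForm A x)) = 0 :=
        cutoffIntegral_eq_zero_of_odd fun x => by rw [cubicForm_neg, sinh_neg]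
      have hs := continuous_sinh_cubicForm (A := A)
      rw [← add_zero (cutoffIntegral ρ _), ← hodd, ← cutoffIntegral_add hρ hc (by fun_prop)]
      congr 1; ext x; rw [← cosh_sub_sinh]; ring
    have hi1 := integrable_radialCutoff_mul hρ
      (f := fun x => exp (-cubicForm A x) * (1 - ⟪x, g⟫)) (by fun_prop)
    have hi2 := integrable_radialCutoff_mul hρ
      (f := fun x => exp q * (e + 2 * q) * exp (-cubicForm A x)) (by fun_prop)
    rw [hcosh, ← cutoffIntegral_const_mul, hset, hset, ← integral_sub hintχ hi1.integrableOn,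
      ← Real.norm_eq_abs]
    refine norm_integral_le_of_norm_le hi2.integrableOn ?_
    filter_upwards [ae_restrict_mem hSm] with x hxS
    have hxρ := (hmemS x).mp hxS
    have h1 := hJ x hxρ
    set r := F x - (‖x‖ ^ 2 / 2 + cubicForm A x) with hr
    have h2 : |r| ≤ q := hF x hxρ
    have hFx : exp (-F x) = exp (-‖x‖ ^ 2 / 2) * exp (-cubicForm A x) * exp (-r) := by
      rw [← exp_add, ← exp_add, hr]; congr 1; ring
    have h3 : exp (-r) ≤ exp q := exp_le_exp.mpr ((neg_le_abs r).trans h2)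
    have h4 : |exp (-r) - 1| ≤ q * exp q := by
      have hrq := abs_le.mp h2
      rw [abs_le]
      constructor
      · have h5 := add_one_le_exp (-r)
        have h6 := add_one_le_exp q
        nlinarith
      · have h5 := add_one_le_exp (-q)
        have h6 : exp (-q) * exp q = 1 := by rw [← exp_add]; simp
        nlinarith [exp_pos q]
    have h5 : |1 - ⟪x, g⟫| ≤ 2 := by
      have : |⟪x, g⟫| ≤ 1 / 2 := (abs_real_inner_le_norm x g).trans (by
        refine le_trans ?_ hg; rw [mul_comm]; gcongr)
      have := abs_le.mp this
      rw [abs_le]; constructor <;> linarith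
    have h6 : |exp (-r) * J x - (1 - ⟪x, g⟫)| ≤ exp q * (e + 2 * q) := by
      calc |exp (-r) * J x - (1 - ⟪x, g⟫)|
          = |exp (-r) * (J x - (1 - ⟪x, g⟫)) + (exp (-r) - 1) * (1 - ⟪x, g⟫)| := by ring_nf
        _ ≤ exp (-r) * |J x - (1 - ⟪x, g⟫)| + |exp (-r) - 1| * |1 - ⟪x, g⟫| := by
          refine (abs_add_le _ _).trans_eq ?_
          rw [abs_mul, abs_mul, abs_of_pos (exp_pos _)]
        _ ≤ exp q * e + q * exp q * 2 := by gcongr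
        _ = _ := by ring
    rw [Real.norm_eq_abs, hFx]
    calc |radialCutoff ρ x * (exp (-‖x‖ ^ 2 / 2) * exp (-cubicForm A x) * exp (-r) * J x) -
          exp (-‖x‖ ^ 2 / 2) * (radialCutoff ρ x * (exp (-cubicForm A x) * (1 - ⟪x, g⟫)))|
        = |exp (-‖x‖ ^ 2 / 2) * (radialCutoff ρ x * exp (-cubicForm A x)) *
            (exp (-r) * J x - (1 - ⟪x, g⟫))| := by ring_nf
      _ = exp (-‖x‖ ^ 2 / 2) * (radialCutoff ρ x * exp (-cubicForm A x)) *
            |exp (-r) * J x - (1 - ⟪x, g⟫)| := by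
          rw [abs_mul, abs_of_nonneg]
          have := radialCutoff_nonneg (ρ := ρ) x
          positivity
      _ ≤ exp (-‖x‖ ^ 2 / 2) * (radialCutoff ρ x * exp (-cubicForm A x)) *
            (exp q * (e + 2 * q)) := by
          have := radialCutoff_nonneg (ρ := ρ) x
          gcongr
      _ = _ := by ring
  have step3 := h.abs_cutoffIntegral_exp_mul_sub_le hB hg
  have hI := h.cutoffIntegral_cosh_le hB
  have hI0 := cutoffIntegral_cosh_nonneg (ρ := ρ) (A := A)
  have hT := gaussianTail_le_mass (d := d) h.rho_eq h.le_R
  have hT0 := gaussianTail_nonneg (d := d) (ρ := ρ)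
  set Z := (2 * π) ^ ((d : ℝ) / 2) with hZ
  set I := cutoffIntegral ρ (fun x => cosh (cubicForm A x)) with hIdef
  set δ := exp (-(R ^ 2 * d / 128)) with hδ
  set CA := cubicMomentConst B R c with hCA
  have hZ0 : 0 < Z := by positivity
  have hδ0 : 0 < δ := exp_pos _
  have hc0 := h.c_nonneg
  have hCA3 : 3 + 8 * B ≤ CA := by
    rw [hCA, cubicMomentConst]
    have : 0 ≤ R ^ 4 * c := by positivity
    have := add_one_le_exp (1 + 4 * (R ^ 4 * c))
    linarith
  have hCA0 : 0 ≤ CA := by linarith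
  have hQ : exp q ≤ exp (R ^ 4 * c) := exp_le_exp.mpr hq
  have hQ1 : 1 ≤ exp (R ^ 4 * c) := one_le_exp (by positivity)
  have tri : |(∫ x in S, exp (-F x) * J x) - Z| ≤ 2 * gaussianTail d ρ +
      exp q * (e + 2 * q) * I + ((1 + 2 * B) * gaussianTail d ρ +
        R ^ 4 * (‖g‖ ^ 2 + 2 * (b * d) ^ 2) * I) :=
    (abs_sub_le _ _ _).trans (add_le_add ((abs_sub_le _ _ _).trans (add_le_add step1 step2)) step3)
  refine tri.trans ?_
  have t1 : 2 * gaussianTail d ρ + (1 + 2 * B) * gaussianTail d ρ ≤ CA * (δ * Z) := by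
    calc 2 * gaussianTail d ρ + (1 + 2 * B) * gaussianTail d ρ = (3 + 2 * B) * gaussianTail d ρ := by
          ring
      _ ≤ CA * (δ * Z) := by gcongr; linarith
  have t2 : exp q * (e + 2 * q) * I ≤ exp (R ^ 4 * c) * (2 * e + 2 * q) * (CA * Z) := by
    gcongr
    linarith
  have t3 : R ^ 4 * (‖g‖ ^ 2 + 2 * (b * d) ^ 2) * I ≤
      R ^ 4 * (2 * ‖g‖ ^ 2 + 2 * (b * d) ^ 2) * (CA * Z) := by
    gcongr
    linarith [sq_nonneg ‖g‖]
  have t4 : Z * (CA * (2 * exp (R ^ 4 * c) + 2 * R ^ 4) *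
      ((b * d) ^ 2 + q + ‖g‖ ^ 2 + e + δ)) - (CA * (δ * Z) +
      exp (R ^ 4 * c) * (2 * e + 2 * q) * (CA * Z) +
      R ^ 4 * (2 * ‖g‖ ^ 2 + 2 * (b * d) ^ 2) * (CA * Z)) =
      CA * Z * (2 * exp (R ^ 4 * c) * ((b * d) ^ 2 + ‖g‖ ^ 2) + 2 * R ^ 4 * (q + e) +
        2 * R ^ 4 * δ + (2 * exp (R ^ 4 * c) - 1) * δ) := by ring
  have t5 : 0 ≤ CA * Z * (2 * exp (R ^ 4 * c) * ((b * d) ^ 2 + ‖g‖ ^ 2) + 2 * R ^ 4 * (q + e) +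
        2 * R ^ 4 * δ + (2 * exp (R ^ 4 * c) - 1) * δ) := by
    have : 0 ≤ 2 * exp (R ^ 4 * c) - 1 := by linarith
    positivity
  linarith

end CubicBound

end GaussianLaplace

/-! ### Linear changes of variables and exponential tails -/

theorem abs_det_equiv_pos {E : Type*} [NormedAddCommGroup E] [NormedSpace ℝ E] (e : E ≃L[ℝ] E) :
    0 < |LinearMap.det (e : E →ₗ[ℝ] E)| := by
  have h1 : LinearMap.det (e.symm : E →ₗ[ℝ] E) * LinearMap.det (e : E →ₗ[ℝ] E) = 1 :=
    e.toLinearEquiv.det_symm_mul_det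
  exact abs_pos.mpr (right_ne_zero_of_mul_eq_one h1)

section ChangeOfVariables

variable {E : Type*} [NormedAddCommGroup E] [NormedSpace ℝ E] [FiniteDimensional ℝ E]
  [MeasurableSpace E] [BorelSpace E] {μ : Measure E} [μ.IsAddHaarMeasure]

theorem map_equiv_symm_addHaar (e : E ≃L[ℝ] E) :
    Measure.map e.symm μ = ENNReal.ofReal |LinearMap.det (e : E →ₗ[ℝ] E)| • μ := by
  have h1 : LinearMap.det (e.symm : E →ₗ[ℝ] E) * LinearMap.det (e : E →ₗ[ℝ] E) = 1 :=
    e.toLinearEquiv.det_symm_mul_det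
  have h := Measure.map_linearMap_addHaar_eq_smul_addHaar μ
    (f := (e.symm : E →ₗ[ℝ] E)) (left_ne_zero_of_mul_eq_one h1)
  rw [inv_eq_of_mul_eq_one_right h1] at h
  exact h

theorem integral_comp_equiv_symm (e : E ≃L[ℝ] E) (G : E → ℝ) :
    ∫ x, G (e.symm x) ∂μ = |LinearMap.det (e : E →ₗ[ℝ] E)| * ∫ x, G x ∂μ := by
  have h := e.symm.toHomeomorph.measurableEmbedding.integral_map (μ := μ) G
  change ∫ x, G x ∂(Measure.map e.symm μ) = ∫ x, G (e.symm x) ∂μ at h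
  rw [← h, map_equiv_symm_addHaar, integral_smul_measure, ENNReal.toReal_ofReal (abs_nonneg _),
    smul_eq_mul]

theorem setIntegral_comp_equiv_symm (e : E ≃L[ℝ] E) (G : E → ℝ) {S : Set E}
    (hS : MeasurableSet S) :
    ∫ x in e.symm ⁻¹' S, G (e.symm x) ∂μ = |LinearMap.det (e : E →ₗ[ℝ] E)| * ∫ x in S, G x ∂μ := by
  rw [← integral_indicator hS, ← integral_comp_equiv_symm,
    ← integral_indicator (e.symm.continuous.measurable hS)]
  rfl

theorem integrableOn_comp_equiv_symm (e : E ≃L[ℝ] E) {G : E → ℝ} {S : Set E}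
    (hG : IntegrableOn G S μ) : IntegrableOn (fun x => G (e.symm x)) (e.symm ⁻¹' S) μ := by
  have h := e.symm.toHomeomorph.measurableEmbedding.integrableOn_map_iff (f := G) (μ := μ) (s := S)
  refine h.mp ?_
  change IntegrableOn G S (Measure.map e.symm μ)
  rw [map_equiv_symm_addHaar, IntegrableOn, Measure.restrict_smul]
  exact hG.smul_measure ENNReal.ofReal_ne_top

theorem integrable_comp_equiv (e : E ≃L[ℝ] E) {G : E → ℝ} (hG : Integrable G μ) :
    Integrable (fun x => G (e x)) μ := by
  have := integrableOn_comp_equiv_symm e.symm (S := univ) (integrableOn_univ.mpr hG)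
  simpa [IntegrableOn] using this

end ChangeOfVariables

/-- The Jacobian of these Gaussian coordinates supplies the factor `λ^{d/2} √(det H)` in the
denominator of the leading term. -/
theorem exists_equiv_scaled {d : ℕ} {H : Matrix (Fin d) (Fin d) ℝ} (hH : H.PosDef) {lam : ℝ}
    (hlam : 0 < lam) : ∃ e : RVec d ≃L[ℝ] RVec d, (∀ x, ‖e x‖ = √lam * normH H x) ∧
      |LinearMap.det (e : RVec d →ₗ[ℝ] RVec d)| = lam ^ ((d : ℝ) / 2) * √H.det := by
  obtain ⟨L, hL, hdet⟩ := exists_equiv_normH hH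
  have hs : √lam ≠ 0 := (Real.sqrt_pos.mpr hlam).ne'
  refine ⟨L.trans (ContinuousLinearEquiv.smulLeft (Units.mk0 (√lam) hs)), fun x => ?_, ?_⟩
  · change ‖√lam • L x‖ = _
    rw [norm_smul, hL, Real.norm_eq_abs, abs_of_nonneg (Real.sqrt_nonneg _)]
  · have : ((L.trans (ContinuousLinearEquiv.smulLeft (Units.mk0 (√lam) hs)) :
        RVec d ≃L[ℝ] RVec d) : RVec d →ₗ[ℝ] RVec d) = √lam • (L : RVec d →ₗ[ℝ] RVec d) := rfl
    rw [this, LinearMap.det_smul, abs_mul, hdet, finrank_euclideanSpace_fin, abs_pow,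
      abs_of_nonneg (Real.sqrt_nonneg _), Real.sqrt_eq_rpow, ← Real.rpow_mul_natCast hlam.le]
    congr 2; ring

theorem integral_exp_neg_mul_abs {c : ℝ} (hc : 0 < c) : ∫ t : ℝ, exp (-(c * |t|)) = 2 / c := by
  rw [integral_comp_abs (f := fun t => exp (-(c * t)))]
  have := integral_exp_mul_Ioi (a := -c) (by linarith) 0
  simp only [neg_mul] at this
  rw [this]; simp; ring

theorem integrable_exp_neg_mul_abs {c : ℝ} (hc : 0 < c) :
    Integrable fun t : ℝ => exp (-(c * |t|)) := by
  refine Integrable.of_integral_ne_zero ?_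
  rw [integral_exp_neg_mul_abs hc]; positivity

theorem integral_exp_neg_mul_sum_abs {d : ℕ} {c : ℝ} (hc : 0 < c) :
    ∫ x : RVec d, exp (-(c * ∑ i, |x i|)) = (2 / c) ^ d := by
  have h := (EuclideanSpace.volume_preserving_symm_measurableEquiv_toLp (Fin d)).integral_comp'
    (g := fun y : Fin d → ℝ => ∏ i, exp (-(c * |y i|)))
  rw [integral_fintype_prod_volume_eq_pow fun t : ℝ => exp (-(c * |t|)),
    integral_exp_neg_mul_abs hc, Fintype.card_fin] at h
  rw [← h]
  congr 1; ext x
  rw [← exp_sum]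
  congr 1
  rw [Finset.sum_neg_distrib, Finset.mul_sum]
  rfl

theorem sum_abs_le_sqrt_mul_norm {d : ℕ} (x : RVec d) : ∑ i, |x i| ≤ √d * ‖x‖ := by
  rw [EuclideanSpace.norm_eq, ← Real.sqrt_mul (Nat.cast_nonneg d)]
  refine Real.le_sqrt_of_sq_le ?_
  have := sq_sum_le_card_mul_sum_sq (s := Finset.univ) (f := fun i => |x i|)
  simpa using this

theorem integrable_exp_neg_mul_sum_abs {d : ℕ} {c : ℝ} (hc : 0 < c) :
    Integrable fun x : RVec d => exp (-(c * ∑ i, |x i|)) := by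
  refine Integrable.of_integral_ne_zero ?_
  rw [integral_exp_neg_mul_sum_abs hc]; positivity

theorem integrable_exp_neg_mul_norm {d : ℕ} {c : ℝ} (hc : 0 < c) :
    Integrable fun x : RVec d => exp (-(c * (√d * ‖x‖))) := by
  refine (integrable_exp_neg_mul_sum_abs (d := d) hc).mono' (by fun_prop) (.of_forall fun x => ?_)
  rw [Real.norm_eq_abs, abs_of_pos (exp_pos _), exp_le_exp, neg_le_neg_iff]
  gcongr; exact sum_abs_le_sqrt_mul_norm x

/-- Cauchy–Schwarz bounds the ℓ¹ norm by `√d ‖x‖`, and the integral of the ℓ¹ exponential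
factorizes. The resulting loss is only exponential in `d`. -/
theorem integral_exp_neg_mul_norm_le {d : ℕ} {c : ℝ} (hc : 0 < c) :
    ∫ x : RVec d, exp (-(c * (√d * ‖x‖))) ≤ (2 / c) ^ d := by
  rw [← integral_exp_neg_mul_sum_abs hc]
  refine integral_mono (integrable_exp_neg_mul_norm hc) (integrable_exp_neg_mul_sum_abs hc)
    fun x => ?_
  simp only
  rw [exp_le_exp, neg_le_neg_iff]
  gcongr; exact sum_abs_le_sqrt_mul_norm x

/-- The number 2/3 is a rational below 1/√2. The bound separates the variables `x` and `t`. -/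
theorem add_abs_le_normH1 {d : ℕ} (H : Matrix (Fin d) (Fin d) ℝ) (u : RVec d × ℝ) :
    2 / 3 * (normH H u.1 + |u.2|) ≤ normH1 H u := by
  refine Real.le_sqrt_of_sq_le ?_
  rw [← sq_abs u.2]
  nlinarith [sq_nonneg (normH H u.1 - |u.2|), sq_nonneg (normH H u.1), sq_nonneg |u.2|]

theorem continuous_normH1 {d : ℕ} {H : Matrix (Fin d) (Fin d) ℝ} (hH : H.PosDef) :
    Continuous (normH1 H) := by
  obtain ⟨L, hL, -⟩ := exists_equiv_normH hH
  have := continuous_normH hL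
  unfold normH1
  fun_prop

section Tail

variable {d : ℕ} {H : Matrix (Fin d) (Fin d) ℝ} {lam R ε : ℝ}

/-- The factor 2/3 turns 1/64 into 1/96. Since `λ ε = √λ √d`, the hypothesis `R ≥ 24` gives `R / 96
≥ 1/4` in front of `√d ‖e x‖`. -/
theorem exp_neg_normH1_le (hlam : 0 < lam) (hε : ε = √(d / lam)) (hR : 24 ≤ R)
    {e : RVec d ≃L[ℝ] RVec d} (he : ∀ x, ‖e x‖ = √lam * normH H x) (u : RVec d × ℝ) :
    exp (-(lam * (R * ε) / 64 * normH1 H u)) ≤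
      exp (-(1 / 4 * (√d * ‖e u.1‖))) * exp (-(lam * (R * ε) / 96 * |u.2|)) := by
  rw [← exp_add, exp_le_exp]
  have hε0 : 0 ≤ ε := by rw [hε]; positivity
  have hle : lam * ε = √lam * √d := by
    rw [hε, Real.sqrt_div (Nat.cast_nonneg d)]
    have h2 : √lam ≠ 0 := (Real.sqrt_pos.mpr hlam).ne'
    field_simp
    rw [Real.sq_sqrt hlam.le]; ring
  have h1 : 1 / 4 * (√d * ‖e u.1‖) ≤ lam * (R * ε) / 96 * normH H u.1 := by
    rw [he]
    have h0 : 0 ≤ √lam * √d * normH H u.1 := by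
      have := normH_nonneg H u.1
      positivity
    calc 1 / 4 * (√d * (√lam * normH H u.1)) = 24 / 96 * (√lam * √d * normH H u.1) := by ring
      _ ≤ R / 96 * (√lam * √d * normH H u.1) := by gcongr
      _ = _ := by rw [← hle]; ring
  have h2 := mul_le_mul_of_nonneg_left (add_abs_le_normH1 H u)
    (by positivity : 0 ≤ lam * (R * ε) / 64)
  linarith

theorem integrable_exp_neg_normH1 (hH : H.PosDef) (hlam : 0 < lam) (hd : 1 ≤ d)
    (hε : ε = √(d / lam)) (hR : 24 ≤ R) :
    Integrable fun u : RVec d × ℝ => exp (-(lam * (R * ε) / 64 * normH1 H u)) := by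
  obtain ⟨e, he, -⟩ := exists_equiv_scaled hH hlam
  have hd0 : (0 : ℝ) < d := by exact_mod_cast hd
  have hε0 : 0 < ε := by rw [hε]; positivity
  have hc : 0 < lam * (R * ε) / 96 := by positivity
  have hi := (integrable_comp_equiv e (integrable_exp_neg_mul_norm (d := d)
    (by norm_num : (0 : ℝ) < 1 / 4))).mul_prod (integrable_exp_neg_mul_abs hc)
  have hcont := continuous_normH1 hH
  refine hi.mono' (by fun_prop) (.of_forall fun u => ?_)
  rw [Real.norm_eq_abs, abs_of_pos (exp_pos _)]
  exact exp_neg_normH1_le hlam hε hR he u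

theorem integral_exp_neg_normH1_le (hH : H.PosDef) (hlam : 0 < lam) (hd : 1 ≤ d)
    (hε : ε = √(d / lam)) (hR : 24 ≤ R) :
    ∫ u : RVec d × ℝ, exp (-(lam * (R * ε) / 64 * normH1 H u)) ≤
      8 ^ d / (lam ^ ((d : ℝ) / 2) * √H.det) * (192 / (lam * (R * ε))) := by
  obtain ⟨e, he, hdet⟩ := exists_equiv_scaled hH hlam
  have hd0 : (0 : ℝ) < d := by exact_mod_cast hd
  have hε0 : 0 < ε := by rw [hε]; positivity
  have hc : 0 < lam * (R * ε) / 96 := by positivity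
  have hi := (integrable_comp_equiv e (integrable_exp_neg_mul_norm (d := d)
    (by norm_num : (0 : ℝ) < 1 / 4))).mul_prod (integrable_exp_neg_mul_abs hc)
  refine (integral_mono (integrable_exp_neg_normH1 hH hlam hd hε hR) hi
    fun u => exp_neg_normH1_le hlam hε hR he u).trans ?_
  have hD := abs_det_equiv_pos e
  have hx : ∫ x : RVec d, exp (-(1 / 4 * (√d * ‖e x‖))) ≤
      8 ^ d / (lam ^ ((d : ℝ) / 2) * √H.det) := by
    have h1 := integral_comp_equiv_symm (μ := (volume : Measure (RVec d))) e
      fun x => exp (-(1 / 4 * (√d * ‖e x‖)))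
    simp only [ContinuousLinearEquiv.apply_symm_apply] at h1
    rw [← hdet, le_div_iff₀ hD, mul_comm, ← h1]
    refine (integral_exp_neg_mul_norm_le (by norm_num)).trans_eq ?_
    norm_num
  rw [Measure.volume_eq_prod, integral_prod_mul (fun x : RVec d => exp (-(1 / 4 * (√d * ‖e x‖))))
    (fun t : ℝ => exp (-(lam * (R * ε) / 96 * |t|))), integral_exp_neg_mul_abs hc]
  have h2 : 2 / (lam * (R * ε) / 96) = 192 / (lam * (R * ε)) := by field_simp; norm_num
  rw [h2]
  gcongr

/-- The smallness of the Gaussian tails in terms of `λ`, by the choice of `R`. -/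
theorem exp_neg_sq_mul_dim_le (hlam : 1 ≤ lam) (hd : 1 ≤ d) {M : ℝ} (hM : 1 ≤ M)
    (hR : R = 24 + 2 * (1 + 2 * M) * log lam / d) :
    8 ^ d * exp (-(R ^ 2 * d / 128)) ≤ 1 / lam ^ M / √lam := by
  have hd0 : (0 : ℝ) < d := by exact_mod_cast hd
  have hlog : 0 ≤ log lam := log_nonneg hlam
  have hlam0 : 0 < lam := by linarith
  have h8 : (8 : ℝ) ^ d = exp (d * log 8) := by
    rw [mul_comm, ← Real.rpow_def_of_pos (by norm_num), rpow_natCast]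
  have hr : 1 / lam ^ M / √lam = exp (-((M + 1 / 2) * log lam)) := by
    rw [Real.sqrt_eq_rpow, Real.rpow_def_of_pos hlam0, Real.rpow_def_of_pos hlam0, one_div,
      ← exp_neg, ← exp_sub]
    congr 1; ring
  rw [h8, ← exp_add, hr, exp_le_exp]
  have hl8 : log 8 ≤ 4 := by
    rw [show (8 : ℝ) = 2 ^ (3 : ℕ) by norm_num, log_pow]
    have := log_two_lt_d9; push_cast; linarith
  have hRd : R * d = 24 * d + 4 * ((M + 1 / 2) * log lam) := by rw [hR]; field_simp; ring
  have hS : 0 ≤ (M + 1 / 2) * log lam := by positivity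
  have hR24 : 24 * d ≤ R * d := by linarith
  have hR24' : 24 ≤ R := le_of_mul_le_mul_right hR24 hd0
  have h1 : R ^ 2 * d ≥ 24 * (R * d) := by nlinarith
  -- With `S = (M + 1/2) log λ` and `R d = 24 d + 4 S` this reads `R² d ≥ 576 d + 192 S`; divided by
  -- 128 it exceeds `4 d + S`.
  have h2 : R ^ 2 * d ≥ 48 * (R * d) - 576 * d := by
    nlinarith [mul_nonneg hd0.le (sq_nonneg (R - 24))]
  nlinarith [mul_nonneg hd0.le (sub_nonneg.mpr hl8)]

end Tail

/-! ### Attained values against suprema, and the Hessian along the boundary -/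

section SupBounds

variable {d : ℕ} {H : Matrix (Fin d) (Fin d) ℝ} {L : RVec d ≃L[ℝ] RVec d}

theorem ballH_mono {r r' : ℝ} (h : r ≤ r') : ballH H r ⊆ ballH H r' := fun _ hx => le_trans hx h

theorem zero_mem_ballH (hL : ∀ x, normH H x = ‖L x‖) {r : ℝ} (hr : 0 ≤ r) :
    (0 : RVec d) ∈ ballH H r := by
  rw [ballH, mem_ofPred_eq, hL]; simpa using hr

/-- A real `sSup` bounds its set only when the set is bounded above. Boundedness follows from
continuity of the derivative on the compact ball. -/
theorem tensorNormH_le_omegaSup_zero (hL : ∀ x, normH H x = ‖L x‖) {w : RVec d × ℝ → ℝ} {j l : ℕ}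
    {n : WithTop ℕ∞} {r r₁ : ℝ} (hr : 0 < r) (hr₁ : r₁ ≤ r)
    (h : ContDiffOn ℝ n (fun x => partialY w j x 0) (ballH H r)) (hl : l ≤ n) {x : RVec d}
    (hx : x ∈ ballH H r₁) :
    tensorNormH H (iteratedFDerivWithin ℝ l (fun x' => partialY w j x' 0) (ballH H r) x) ≤
      omegaSup H w (ballH H r) l j r₁ 0 := by
  have hc := h.continuousOn_iteratedFDerivWithin hl (uniqueDiffOn_ballH hL hr)
  obtain ⟨C, hC⟩ := (isCompact_ballH hL r).exists_bound_of_continuousOn hc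
  refine le_csSup ⟨C * ‖(L.symm : RVec d →L[ℝ] RVec d)‖ ^ l, ?_⟩ ⟨x, hx, 0, by simp, rfl⟩
  rintro a ⟨x, hx, y, hy, rfl⟩
  obtain rfl : y = 0 := le_antisymm hy.2 hy.1
  refine (tensorNormH_le hL _).trans ?_
  gcongr
  exact hC x (ballH_mono hr₁ hx)

theorem tensorNormH_le_deltaSup (hL : ∀ x, normH H x = ‖L x‖) {ψ : RVec d → ℝ} {Ω : Set (RVec d)}
    (hΩ : IsOpen Ω) (hψ : ContDiffOn ℝ 2 ψ Ω) {r : ℝ} (hr : ballH H r ⊆ Ω) {x : RVec d}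
    (hx : x ∈ ballH H r) :
    tensorNormH H (iteratedFDeriv ℝ 2 ψ x) ≤ deltaSup H ψ 2 r := by
  have hc : ContinuousOn (fun x => iteratedFDeriv ℝ 2 ψ x) Ω :=
    (hψ.continuousOn_iteratedFDerivWithin (m := 2) le_rfl hΩ.uniqueDiffOn).congr fun x hx =>
      (iteratedFDerivWithin_of_isOpen 2 hΩ hx).symm
  obtain ⟨C, hC⟩ := (isCompact_ballH hL r).exists_bound_of_continuousOn (hc.mono hr)
  refine le_csSup ⟨C * ‖(L.symm : RVec d →L[ℝ] RVec d)‖ ^ 2, ?_⟩ ⟨x, hx, rfl⟩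
  rintro a ⟨x, hx, rfl⟩
  refine (tensorNormH_le hL _).trans ?_
  gcongr
  exact hC x hx

end SupBounds

section Hessian

variable {d : ℕ}

theorem hasFDerivAt_fderiv_of_contDiffAt {E : Type*} [NormedAddCommGroup E] [NormedSpace ℝ E]
    {f : E → ℝ} {x : E} (hf : ContDiffAt ℝ 2 f x) :
    HasFDerivAt (fderiv ℝ f) (fderiv ℝ (fderiv ℝ f) x) x :=
  ((hf.fderiv_right (m := 1) (by norm_num)).differentiableAt (by norm_num)).hasFDerivAt

theorem eventually_differentiableAt_of_contDiffAt {E : Type*} [NormedAddCommGroup E]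
    [NormedSpace ℝ E] {f : E → ℝ} {x : E} (hf : ContDiffAt ℝ 2 f x) :
    ∀ᶠ y in nhds x, DifferentiableAt ℝ f y :=
  (hf.eventually (by simp)).mono fun _ hy => hy.differentiableAt (by norm_num)

/-- The second derivative at `0` along a graph over a horizontal tangent plane. -/
theorem fderiv_fderiv_graph {z : RVec d × ℝ → ℝ} {ψ : RVec d → ℝ} (hz : ContDiffAt ℝ 2 z 0)
    (hψ : ContDiffAt ℝ 2 ψ 0) (hψ0 : ψ 0 = 0)
    (hz' : HasFDerivAt z (ContinuousLinearMap.snd ℝ (RVec d) ℝ) 0)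
    (hψ' : HasFDerivAt ψ (0 : RVec d →L[ℝ] ℝ) 0) (v : RVec d) :
    fderiv ℝ (fderiv ℝ fun x => z (x, ψ x)) 0 v v =
      fderiv ℝ (fderiv ℝ z) 0 (v, 0) (v, 0) + fderiv ℝ (fderiv ℝ ψ) 0 v v := by
  have h00 : ((0 : RVec d), ψ 0) = 0 := by rw [hψ0]; rfl
  have hgr : ContDiffAt ℝ 2 (fun x => (x, ψ x)) (0 : RVec d) := contDiffAt_id.prodMk hψ
  have hf : ContDiffAt ℝ 2 (fun x => z (x, ψ x)) 0 :=
    ContDiffAt.comp (0 : RVec d) (by rw [h00]; exact hz) hgr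
  have hev : ∀ᶠ x in nhds (0 : RVec d), fderiv ℝ (fun x => z (x, ψ x)) x v =
      fderiv ℝ z (x, ψ x) (v, fderiv ℝ ψ x v) := by
    have h1 : ∀ᶠ x in nhds (0 : RVec d), DifferentiableAt ℝ z (x, ψ x) := by
      have := eventually_differentiableAt_of_contDiffAt hz
      rw [← h00] at this
      exact hgr.continuousAt.eventually this
    filter_upwards [h1, eventually_differentiableAt_of_contDiffAt hψ] with x hx1 hx2
    have := hx1.hasFDerivAt.comp x ((hasFDerivAt_id x).prodMk hx2.hasFDerivAt)
    have h2 : HasFDerivAt (fun x => z (x, ψ x)) _ x := this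
    rw [h2.fderiv]; simp
  have hL : HasFDerivAt (fun x => fderiv ℝ (fun x => z (x, ψ x)) x v)
      ((fderiv ℝ (fderiv ℝ fun x => z (x, ψ x)) 0).flip v) 0 := by
    simpa using (hasFDerivAt_fderiv_of_contDiffAt hf).clm_apply (hasFDerivAt_const v 0)
  have hgr' : HasFDerivAt (fun x => (x, ψ x))
      ((ContinuousLinearMap.id ℝ (RVec d)).prod 0) (0 : RVec d) :=
    (hasFDerivAt_id 0).prodMk hψ'
  have hz2 : HasFDerivAt (fun x => fderiv ℝ z (x, ψ x))
      ((fderiv ℝ (fderiv ℝ z) 0).comp ((ContinuousLinearMap.id ℝ (RVec d)).prod 0)) 0 := by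
    refine HasFDerivAt.comp (0 : RVec d) (f := fun x => (x, ψ x)) ?_ hgr'
    rw [h00]; exact hasFDerivAt_fderiv_of_contDiffAt hz
  have hψ2 : HasFDerivAt (fun x => fderiv ℝ ψ x v) ((fderiv ℝ (fderiv ℝ ψ) 0).flip v) 0 := by
    simpa using (hasFDerivAt_fderiv_of_contDiffAt hψ).clm_apply (hasFDerivAt_const v 0)
  have hR := hz2.clm_apply ((hasFDerivAt_const v (0 : RVec d)).prodMk hψ2)
  have hEq := hL.unique (hR.congr_of_eventuallyEq hev)
  have := congrArg (fun φ => φ v) hEq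
  simp only [ContinuousLinearMap.flip_apply] at this
  -- As `∇ψ(0) = 0`, the curve has velocity `(v, 0)`; as `∇z(0) = (0, 1)`, its acceleration
  -- contributes exactly `D²ψ(0)(v, v)`.
  rw [this, h00, hz'.fderiv, hψ'.fderiv]
  simp [add_comm]

theorem dotProduct_hessianMatrix_mulVec {f : RVec d → ℝ} (x : RVec d) :
    x.ofLp ⬝ᵥ (hessianMatrix f 0 *ᵥ x.ofLp) = fderiv ℝ (fderiv ℝ f) 0 x x := by
  have hx : x = ∑ i, x i • EuclideanSpace.single i (1 : ℝ) := by
    have := (EuclideanSpace.basisFun (Fin d) ℝ).sum_repr x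
    simpa using this.symm
  conv_rhs => rw [hx]
  simp only [map_sum, map_smul, sum_apply, dotProduct, Matrix.mulVec, hessianMatrix,
    Matrix.of_apply, smul_eq_mul, Finset.mul_sum, smul_apply]
  rw [Finset.sum_comm]
  refine Finset.sum_congr rfl fun i _ => Finset.sum_congr rfl fun j _ => ?_
  rw [iteratedFDeriv_two_apply]
  simp; ring

end Hessian

/-! ### The boundary chart and the regularity of the pulled-back phase -/

namespace BoundaryMinSetting

variable {d : ℕ} {D : Set (RVec d × ℝ)} {z : RVec d × ℝ → ℝ} {Ω : Set (RVec d)}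
  {ψ : RVec d → ℝ} {ρ₀ : ℝ}

theorem zero_mem (h : BoundaryMinSetting D z Ω ψ ρ₀) : (0 : RVec d × ℝ) ∈ D :=
  h.isClosed_D.frontier_subset h.zero_mem_frontier

theorem contDiffAt_z (h : BoundaryMinSetting D z Ω ψ ρ₀) {u : RVec d × ℝ} (hu : u ∈ D) :
    ContDiffAt ℝ 2 z u := by
  obtain ⟨U, hU, hDU, hz⟩ := h.z_smooth
  exact hz.contDiffAt (hU.mem_nhds (hDU hu))

theorem contDiffAt_ψ (h : BoundaryMinSetting D z Ω ψ ρ₀) {x : RVec d} (hx : x ∈ Ω) :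
    ContDiffAt ℝ 2 ψ x := h.ψ_smooth.contDiffAt (h.isOpen_Ω.mem_nhds hx)

theorem continuousOn_z (h : BoundaryMinSetting D z Ω ψ ρ₀) : ContinuousOn z D :=
  fun _ hu => (h.contDiffAt_z hu).continuousAt.continuousWithinAt

theorem z_zero_le (h : BoundaryMinSetting D z Ω ψ ρ₀) {u : RVec d × ℝ} (hu : u ∈ D) :
    z 0 ≤ z u := by
  by_cases h0 : u = 0
  · rw [h0]
  · exact (h.zero_argmin u hu h0).le

/-- The setting provides only the open range of heights; the endpoints follow because `D` is closed.
-/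
theorem boundaryMap_mem (h : BoundaryMinSetting D z Ω ψ ρ₀) {x : RVec d}
    (hx : x ∈ ballH (matH z ψ) ρ₀) {y : ℝ} (hy : y ∈ Icc 0 ρ₀) : boundaryMap ψ (x, y) ∈ D := by
  have hc : Continuous fun y : ℝ => boundaryMap ψ (x, y) := by simp only [boundaryMap]; fun_prop
  have hcl : IsClosed ((fun y : ℝ => boundaryMap ψ (x, y)) ⁻¹' D) := h.isClosed_D.preimage hc
  have hsub : Ioo 0 ρ₀ ⊆ (fun y : ℝ => boundaryMap ψ (x, y)) ⁻¹' D := fun y hy =>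
    (h.strip_subset ⟨(x, y), ⟨hx, hy⟩, rfl⟩).1
  have := closure_minimal hsub hcl
  rw [closure_Ioo h.ρ₀_pos.ne] at this
  exact this hy

/-- The form `D²(w(·, 0))(0)` is the quadratic form of `H`. -/
theorem fderiv_fderiv_pullbackW (h : BoundaryMinSetting D z Ω ψ ρ₀) (x : RVec d) :
    fderiv ℝ (fderiv ℝ fun x => pullbackW z ψ (x, 0)) 0 x x = normH (matH z ψ) x ^ 2 := by
  have hz := h.contDiffAt_z h.zero_mem
  have hψ := h.contDiffAt_ψ h.zero_mem_Ω
  have h1 : (fun x => pullbackW z ψ (x, 0)) = fun x => z (x, ψ x) := by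
    ext x; simp [pullbackW, boundaryMap]
  -- The flat graph `ψ = 0` identifies the form of `∇_x² z(0)` with the second derivative of `z` in
  -- horizontal directions.
  have h2 := fderiv_fderiv_graph hz (ψ := fun _ => 0) contDiffAt_const rfl h.grad_z
    (hasFDerivAt_const _ _) x
  have h3 : fderiv ℝ (fderiv ℝ fun _ : RVec d => (0 : ℝ)) 0 x x = 0 := by
    have : fderiv ℝ (fun _ : RVec d => (0 : ℝ)) = fun _ => 0 := by ext1 x; simp
    rw [this]; simp
  rw [h1, fderiv_fderiv_graph hz hψ h.ψ_zero h.grad_z h.grad_ψ, normH, Real.sq_sqrt]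
  · rw [matH, Matrix.add_mulVec, dotProduct_add, dotProduct_hessianMatrix_mulVec,
      dotProduct_hessianMatrix_mulVec, h2, h3, add_zero]
  · have := h.posDef_H.posSemidef.dotProduct_mulVec_nonneg x.ofLp
    simpa using this

/-- Both `ψ` and `∇ψ` vanish at 0, so `|ψ|` is at most half the supremum of the second derivative
times the squared norm; the hypothesis bounds that supremum by `2 / r`. -/
theorem abs_ψ_le (h : BoundaryMinSetting D z Ω ψ ρ₀) {r : ℝ} (hr : 0 < r) (hrρ : r ≤ ρ₀)
    (hδ : r * deltaSup (matH z ψ) ψ 2 (r / 2) ≤ 2) {x : RVec d}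
    (hx : x ∈ ballH (matH z ψ) (r / 2)) : |ψ x| ≤ normH (matH z ψ) x ^ 2 / r := by
  obtain ⟨L, hL, -⟩ := exists_equiv_normH h.posDef_H
  have hsub : ballH (matH z ψ) (r / 2) ⊆ Ω :=
    (ballH_mono (by linarith)).trans h.ball_subset
  have hr2 : 0 < r / 2 := by linarith
  have huniq := uniqueDiffOn_ballH (H := matH z ψ) hL hr2
  have heq : ∀ k ≤ 2, ∀ y ∈ ballH (matH z ψ) (r / 2),
      iteratedFDerivWithin ℝ k ψ (ballH (matH z ψ) (r / 2)) y = iteratedFDeriv ℝ k ψ y :=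
    fun k hk y hy => iteratedFDerivWithin_eq_iteratedFDeriv huniq
      ((h.contDiffAt_ψ (hsub hy)).of_le (by exact_mod_cast hk)) hy
  have h0 := zero_mem_ballH (H := matH z ψ) hL hr2.le
  obtain ⟨ξ, hξ, hT⟩ := exists_taylor_ray (f := ψ) (n := 1) (convex_ballH hL (r / 2))
    (zero_mem_interior_ballH hL hr2) (by simpa using h.ψ_smooth.mono hsub) hx
  have hξx : ξ • x ∈ ballH (matH z ψ) (r / 2) :=
    (convex_ballH hL (r / 2)).starConvex h0 |>.smul_mem hx hξ.1.le hξ.2.le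
  rw [Finset.sum_range_succ, Finset.sum_range_one, heq 0 (by norm_num) 0 h0,
    heq 1 (by norm_num) 0 h0, heq 2 le_rfl _ hξx] at hT
  simp only [iteratedFDeriv_zero_apply, iteratedFDeriv_one_apply, h.ψ_zero, h.grad_ψ.fderiv] at hT
  have hle := abs_const_le_tensorNormH hL (iteratedFDeriv ℝ 2 ψ (ξ • x)) x
  have hle2 := tensorNormH_le_deltaSup hL h.isOpen_Ω h.ψ_smooth hsub hξx
  have hn := sq_nonneg (normH (matH z ψ) x)
  have hψx : ψ x = 1 / 2 * iteratedFDeriv ℝ 2 ψ (ξ • x) fun _ => x := by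
    rw [hT]; norm_num [Nat.factorial]
  rw [hψx, abs_mul, abs_of_pos (by norm_num : (0 : ℝ) < 1 / 2), le_div_iff₀ hr]
  have hle3 := hle.trans (mul_le_mul_of_nonneg_right hle2 hn)
  nlinarith

end BoundaryMinSetting

/-- Second-order Taylor bound in one variable. -/
theorem abs_sub_taylor_one_le {g : ℝ → ℝ} {s W : ℝ} (hg : ∀ t ∈ Icc 0 s, ContDiffAt ℝ 2 g t)
    (hW : ∀ t ∈ Icc 0 s, |iteratedDeriv 2 g t| ≤ W) {y : ℝ} (hy : y ∈ Icc 0 s) :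
    |g y - g 0 - deriv g 0 * y| ≤ W * y ^ 2 / 2 := by
  rcases hy.1.eq_or_lt with rfl | hy0
  · simp
  have hsub : Icc 0 y ⊆ Icc 0 s := Icc_subset_Icc_right hy.2
  have hc : ContDiffOn ℝ 2 g (Icc 0 y) := fun t ht => (hg t (hsub ht)).contDiffWithinAt
  have hu : uIcc 0 y = Icc 0 y := uIcc_of_le hy0.le
  have huo : uIoo 0 y = Ioo 0 y := uIoo_of_le hy0.le
  have huniq := uniqueDiffOn_Icc hy0
  obtain ⟨ξ, hξ, h⟩ := taylor_mean_remainder_lagrange (f := g) (n := 1) hy0.ne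
    (by rw [hu]; exact hc.of_le (by norm_num))
    (by
      rw [hu, huo]
      exact (hc.differentiableOn_iteratedDerivWithin (m := 1) (by norm_num) huniq).mono
        Ioo_subset_Icc_self)
  rw [huo] at hξ
  have h0 : (0 : ℝ) ∈ Icc 0 y := ⟨le_rfl, hy0.le⟩
  rw [hu, taylor_within_apply, Finset.sum_range_succ, Finset.sum_range_one,
    iteratedDerivWithin_eq_iteratedDeriv huniq (hg ξ (hsub (Ioo_subset_Icc_self hξ)))
      (Ioo_subset_Icc_self hξ), iteratedDerivWithin_one,
    ((hg 0 (hsub h0)).differentiableAt (by norm_num)).derivWithin (huniq 0 h0)] at h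
  have h2 : g y - g 0 - deriv g 0 * y = iteratedDeriv 2 g ξ * y ^ 2 / 2 := by
    norm_num [Nat.factorial] at h
    linarith
  rw [h2, abs_div, abs_mul, abs_of_nonneg (sq_nonneg y), abs_of_pos (by norm_num : (0 : ℝ) < 2)]
  gcongr
  exact hW ξ (hsub (Ioo_subset_Icc_self hξ))

theorem fderivWithin_prod_apply_snd {E : Type*} [NormedAddCommGroup E] [NormedSpace ℝ E]
    {w : E × ℝ → ℝ} {S : Set E} {I : Set ℝ} {x : E} {y : ℝ} (hx : x ∈ S)
    (hw : DifferentiableWithinAt ℝ w (S ×ˢ I) (x, y)) (hI : UniqueDiffWithinAt ℝ I y) :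
    fderivWithin ℝ w (S ×ˢ I) (x, y) (0, 1) = derivWithin (fun t => w (x, t)) I y := by
  have hpath : HasDerivWithinAt (fun t : ℝ => (x, t)) ((0 : E), (1 : ℝ)) I y :=
    (hasDerivWithinAt_const y I x).prodMk (hasDerivWithinAt_id y I)
  have := hw.hasFDerivWithinAt.comp_hasDerivWithinAt y hpath fun t ht => ⟨hx, ht⟩
  exact (this.derivWithin hI).symm

theorem tensorNormH_iteratedFDerivWithin_zero {d : ℕ} (H : Matrix (Fin d) (Fin d) ℝ)
    (f : RVec d → ℝ) (S : Set (RVec d)) (x : RVec d) :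
    tensorNormH H (iteratedFDerivWithin ℝ 0 f S x) = |f x| := by
  have : {a : ℝ | ∃ v : Fin 0 → RVec d, (∀ i, normH H (v i) = 1) ∧
      a = |iteratedFDerivWithin ℝ 0 f S x v|} = {|f x|} := by
    ext a
    simp only [iteratedFDerivWithin_zero_apply, mem_ofPred_eq, mem_singleton_iff]
    exact ⟨fun ⟨_, _, h⟩ => h, fun h => ⟨Fin.elim0, fun i => i.elim0, h⟩⟩
  rw [tensorNormH, this, csSup_singleton]

namespace BoundaryMinSetting

variable {d : ℕ} {D : Set (RVec d × ℝ)} {z : RVec d × ℝ → ℝ} {Ω : Set (RVec d)}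
  {ψ : RVec d → ℝ} {ρ₀ : ℝ}

theorem contDiffAt_pullbackW_snd (h : BoundaryMinSetting D z Ω ψ ρ₀) {x : RVec d}
    (hx : x ∈ ballH (matH z ψ) ρ₀) {y : ℝ} (hy : y ∈ Icc 0 ρ₀) :
    ContDiffAt ℝ 2 (fun t => pullbackW z ψ (x, t)) y :=
  ContDiffAt.comp y (h.contDiffAt_z (h.boundaryMap_mem hx hy))
    (by simp only [boundaryMap]; fun_prop)

theorem partialY_pullbackW (h : BoundaryMinSetting D z Ω ψ ρ₀) {x : RVec d}
    (hx : x ∈ ballH (matH z ψ) ρ₀) {y : ℝ} (hy : y ∈ Icc 0 ρ₀) {k : ℕ} (hk : k ≤ 2) :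
    partialY (pullbackW z ψ) k x y = iteratedDeriv k (fun t => pullbackW z ψ (x, t)) y :=
  iteratedDerivWithin_eq_iteratedDeriv (uniqueDiffOn_Ici 0)
    ((h.contDiffAt_pullbackW_snd hx hy).of_le (by exact_mod_cast hk)) hy.1

theorem deriv_pullbackW_snd (h : BoundaryMinSetting D z Ω ψ ρ₀) {x : RVec d}
    (hx : x ∈ ballH (matH z ψ) ρ₀) {y : ℝ} (hy : y ∈ Icc 0 ρ₀) :
    ∀ᶠ t in nhds y, deriv (fun t => pullbackW z ψ (x, t)) t =
      fderiv ℝ z (boundaryMap ψ (x, t)) (0, 1) := by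
  have hpath : ∀ t, HasDerivAt (fun t : ℝ => boundaryMap ψ (x, t)) ((0 : RVec d), (1 : ℝ)) t :=
    fun t => (hasDerivAt_const t x).prodMk ((hasDerivAt_id t).const_add (ψ x))
  have hev := eventually_differentiableAt_of_contDiffAt (h.contDiffAt_z (h.boundaryMap_mem hx hy))
  filter_upwards [(hpath y).continuousAt.eventually hev] with t ht
  exact (ht.hasFDerivAt.comp_hasDerivAt t (hpath t)).deriv

theorem iteratedDeriv_two_pullbackW_snd (h : BoundaryMinSetting D z Ω ψ ρ₀) {x : RVec d}
    (hx : x ∈ ballH (matH z ψ) ρ₀) {y : ℝ} (hy : y ∈ Icc 0 ρ₀) :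
    iteratedDeriv 2 (fun t => pullbackW z ψ (x, t)) y =
      fderiv ℝ (fderiv ℝ z) (boundaryMap ψ (x, y)) (0, 1) (0, 1) := by
  have hpath : HasDerivAt (fun t : ℝ => boundaryMap ψ (x, t)) ((0 : RVec d), (1 : ℝ)) y :=
    (hasDerivAt_const y x).prodMk ((hasDerivAt_id y).const_add (ψ x))
  rw [iteratedDeriv_succ, iteratedDeriv_one,
    Filter.EventuallyEq.deriv_eq (h.deriv_pullbackW_snd hx hy)]
  have h1 := hasFDerivAt_fderiv_of_contDiffAt (h.contDiffAt_z (h.boundaryMap_mem hx hy))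
  have h2 : HasFDerivAt (fun u => fderiv ℝ z u (0, 1))
      ((fderiv ℝ (fderiv ℝ z) (boundaryMap ψ (x, y))).flip (0, 1)) (boundaryMap ψ (x, y)) := by
    simpa using h1.clm_apply (hasFDerivAt_const ((0 : RVec d), (1 : ℝ)) (boundaryMap ψ (x, y)))
  exact (h2.comp_hasDerivAt y hpath).deriv

/-- This will be needed up to height `r`, while C⁴ smoothness of `w` reaches only height `r²`. The
supremum is finite because `z` is C² near `D` and the chart maps a compact set into `D`. -/
theorem abs_partialY_two_le_omegaSup (h : BoundaryMinSetting D z Ω ψ ρ₀) {r s : ℝ}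
    (hr : r ≤ ρ₀) (hs : s ≤ ρ₀) (S : Set (RVec d)) {x : RVec d}
    (hx : x ∈ ballH (matH z ψ) r) {y : ℝ} (hy : y ∈ Icc 0 s) :
    |iteratedDeriv 2 (fun t => pullbackW z ψ (x, t)) y| ≤
      omegaSup (matH z ψ) (pullbackW z ψ) S 0 2 r s := by
  obtain ⟨L, hL, -⟩ := exists_equiv_normH h.posDef_H
  have hball := ballH_mono (H := matH z ψ) hr
  have hIcc : Icc 0 s ⊆ Icc 0 ρ₀ := Icc_subset_Icc_right hs
  obtain ⟨U, hU, hDU, hz⟩ := h.z_smooth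
  have hcont : ContinuousOn (fun u => fderiv ℝ (fderiv ℝ z) u (0, 1) (0, 1)) U := by
    have h1 : ContDiffOn ℝ 1 (fderiv ℝ z) U := hz.fderiv_of_isOpen hU (by norm_num)
    have h2 : ContinuousOn (fderiv ℝ (fderiv ℝ z)) U :=
      (h1.fderiv_of_isOpen hU (m := 0) (by norm_num)).continuousOn
    exact (h2.clm_apply continuousOn_const).clm_apply continuousOn_const
  have hψc : ContinuousOn ψ (ballH (matH z ψ) ρ₀) := h.ψ_smooth.continuousOn.mono h.ball_subset
  have hΘ : ContinuousOn (boundaryMap ψ) (ballH (matH z ψ) ρ₀ ×ˢ Icc 0 ρ₀) := by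
    unfold boundaryMap
    exact continuousOn_fst.prodMk
      ((hψc.comp continuousOn_fst fun p hp => hp.1).add continuousOn_snd)
  have hcomp := hcont.comp hΘ fun p hp => hDU (h.boundaryMap_mem hp.1 hp.2)
  obtain ⟨C, hC⟩ := ((isCompact_ballH hL ρ₀).prod
    (isCompact_Icc (a := (0 : ℝ)) (b := ρ₀))).exists_bound_of_continuousOn hcomp
  rw [← h.partialY_pullbackW (hball hx) (hIcc hy) le_rfl]
  refine le_csSup ⟨C, ?_⟩ ⟨x, hx, y, hy, ?_⟩
  · rintro a ⟨x, hx, y, hy, rfl⟩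
    rw [tensorNormH_iteratedFDerivWithin_zero, h.partialY_pullbackW (hball hx) (hIcc hy) le_rfl,
      h.iteratedDeriv_two_pullbackW_snd (hball hx) (hIcc hy)]
    exact hC (x, y) ⟨hball hx, hIcc hy⟩
  · rw [tensorNormH_iteratedFDerivWithin_zero]

theorem abs_pullbackW_sub_le (h : BoundaryMinSetting D z Ω ψ ρ₀) {r s : ℝ}
    (hr : r ≤ ρ₀) (hs : s ≤ ρ₀) (S : Set (RVec d)) {x : RVec d}
    (hx : x ∈ ballH (matH z ψ) r) {y : ℝ} (hy : y ∈ Icc 0 s) :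
    |pullbackW z ψ (x, y) - pullbackW z ψ (x, 0) - partialY (pullbackW z ψ) 1 x 0 * y| ≤
      omegaSup (matH z ψ) (pullbackW z ψ) S 0 2 r s * y ^ 2 / 2 := by
  have hball := ballH_mono (H := matH z ψ) hr
  rw [h.partialY_pullbackW (hball hx) ⟨le_rfl, h.ρ₀_pos.le⟩ (by norm_num), iteratedDeriv_one]
  exact abs_sub_taylor_one_le (g := fun t => pullbackW z ψ (x, t))
    (fun t ht => h.contDiffAt_pullbackW_snd (hball hx) ⟨ht.1, ht.2.trans hs⟩)
    (fun t ht => h.abs_partialY_two_le_omegaSup hr hs S hx ht) hy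

theorem partialY_one_zero (h : BoundaryMinSetting D z Ω ψ ρ₀) :
    partialY (pullbackW z ψ) 1 0 0 = 1 := by
  obtain ⟨L, hL, -⟩ := exists_equiv_normH h.posDef_H
  have h0 := zero_mem_ballH (H := matH z ψ) hL h.ρ₀_pos.le
  have hy : (0 : ℝ) ∈ Icc 0 ρ₀ := ⟨le_rfl, h.ρ₀_pos.le⟩
  rw [h.partialY_pullbackW h0 hy (by norm_num), iteratedDeriv_one,
    (h.deriv_pullbackW_snd h0 hy).self_of_nhds]
  have : boundaryMap ψ (0, 0) = 0 := by simp [boundaryMap, h.ψ_zero]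
  rw [this, h.grad_z.fderiv]; simp

/-- The normal derivative at height 0 is the derivative of `w` within the product set applied to
`(0, 1)`, so exactly one order of smoothness is lost. -/
theorem contDiffOn_partialY_one (h : BoundaryMinSetting D z Ω ψ ρ₀) {r : ℝ} (hr : 0 < r)
    (hrρ : r ≤ ρ₀) {s : ℝ} (hs : 0 < s)
    (hw : ContDiffOn ℝ 4 (pullbackW z ψ) (ballH (matH z ψ) r ×ˢ Icc 0 s)) :
    ContDiffOn ℝ 3 (fun x => partialY (pullbackW z ψ) 1 x 0) (ballH (matH z ψ) r) := by
  obtain ⟨L, hL, -⟩ := exists_equiv_normH h.posDef_H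
  have hI := uniqueDiffOn_Icc hs
  have huniq := (uniqueDiffOn_ballH (H := matH z ψ) hL hr).prod hI
  have h0s : (0 : ℝ) ∈ Icc 0 s := ⟨le_rfl, hs.le⟩
  have h1 : ContDiffOn ℝ 3 (fderivWithin ℝ (pullbackW z ψ) (ballH (matH z ψ) r ×ˢ Icc 0 s))
      (ballH (matH z ψ) r ×ˢ Icc 0 s) := hw.fderivWithin huniq (by norm_num)
  have h2 : ContDiffOn ℝ 3 (fun x : RVec d => (x, (0 : ℝ))) (ballH (matH z ψ) r) := by fun_prop
  have h3 := (h1.comp h2 fun x hx => ⟨hx, h0s⟩).clm_apply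
    (contDiffOn_const (c := ((0 : RVec d), (1 : ℝ))))
  refine h3.congr fun x hx => ?_
  have hd := h.contDiffAt_pullbackW_snd (ballH_mono hrρ hx) (y := 0) ⟨le_rfl, h.ρ₀_pos.le⟩
  simp only [Function.comp_apply]
  rw [h.partialY_pullbackW (ballH_mono hrρ hx) ⟨le_rfl, h.ρ₀_pos.le⟩ (by norm_num),
    iteratedDeriv_one, fderivWithin_prod_apply_snd hx
      ((hw (x, 0) ⟨hx, h0s⟩).differentiableWithinAt (by norm_num)) (hI 0 h0s)]
  exact ((hd.differentiableAt (by norm_num)).derivWithin (hI 0 h0s)).symm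

theorem contDiffOn_partialY_zero {r : ℝ} {s : ℝ} (hs : 0 < s)
    (hw : ContDiffOn ℝ 4 (pullbackW z ψ) (ballH (matH z ψ) r ×ˢ Icc 0 s)) :
    ContDiffOn ℝ 4 (fun x => partialY (pullbackW z ψ) 0 x 0) (ballH (matH z ψ) r) := by
  have h2 : ContDiffOn ℝ 4 (fun x : RVec d => (x, (0 : ℝ))) (ballH (matH z ψ) r) := by fun_prop
  refine (hw.comp h2 fun x hx => ⟨hx, le_rfl, hs.le⟩).congr fun x _ => ?_
  simp [partialY]

end BoundaryMinSetting

/-! ### Expansions at the minimizer and growth of the phase -/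

namespace BoundaryMinSetting

variable {d : ℕ} {D : Set (RVec d × ℝ)} {z : RVec d × ℝ → ℝ} {Ω : Set (RVec d)}
  {ψ : RVec d → ℝ} {ρ₀ r : ℝ}

theorem pullbackW_zero (h : BoundaryMinSetting D z Ω ψ ρ₀) : pullbackW z ψ (0, 0) = z 0 := by
  simp only [pullbackW, boundaryMap, h.ψ_zero, add_zero]
  rfl

theorem partialY_zero_eq (w : RVec d × ℝ → ℝ) :
    (fun x => partialY w 0 x 0) = fun x => w (x, 0) := by
  ext x; simp [partialY]

theorem contDiffAt_pullbackW_fst (h : BoundaryMinSetting D z Ω ψ ρ₀) :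
    ContDiffAt ℝ 2 (fun x => pullbackW z ψ (x, 0)) 0 := by
  have hz := h.contDiffAt_z h.zero_mem
  have h00 : boundaryMap ψ ((0 : RVec d), (0 : ℝ)) = 0 := by simp [boundaryMap, h.ψ_zero]
  refine ContDiffAt.comp (0 : RVec d) (by rw [h00]; exact hz) ?_
  simp only [boundaryMap]
  exact contDiffAt_id.prodMk ((h.contDiffAt_ψ h.zero_mem_Ω).add contDiffAt_const)

theorem fderiv_pullbackW_fst (h : BoundaryMinSetting D z Ω ψ ρ₀) (v : RVec d) :
    fderiv ℝ (fun x => pullbackW z ψ (x, 0)) 0 v = 0 := by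
  have h00 : boundaryMap ψ ((0 : RVec d), (0 : ℝ)) = 0 := by simp [boundaryMap, h.ψ_zero]
  have h1 : HasFDerivAt (fun x : RVec d => boundaryMap ψ (x, 0))
      ((ContinuousLinearMap.id ℝ (RVec d)).prod 0) 0 := by
    simp only [boundaryMap, add_zero]
    exact (hasFDerivAt_id 0).prodMk h.grad_ψ
  have h2 : HasFDerivAt (fun x : RVec d => pullbackW z ψ (x, 0)) _ 0 :=
    HasFDerivAt.comp (0 : RVec d) (by rw [h00]; exact h.grad_z) h1
  rw [h2.fderiv]; simp

theorem iteratedFDerivWithin_one_pullbackW (h : BoundaryMinSetting D z Ω ψ ρ₀) (hr : 0 < r)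
    (x : RVec d) : iteratedFDerivWithin ℝ 1 (fun x => pullbackW z ψ (x, 0))
      (ballH (matH z ψ) r) 0 (fun _ => x) = 0 := by
  obtain ⟨L, hL, -⟩ := exists_equiv_normH h.posDef_H
  rw [iteratedFDerivWithin_eq_iteratedFDeriv (uniqueDiffOn_ballH hL hr)
    (h.contDiffAt_pullbackW_fst.of_le (by norm_num)) (zero_mem_ballH hL hr.le),
    iteratedFDeriv_one_apply, h.fderiv_pullbackW_fst]

theorem iteratedFDerivWithin_two_pullbackW (h : BoundaryMinSetting D z Ω ψ ρ₀) (hr : 0 < r)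
    (x : RVec d) : iteratedFDerivWithin ℝ 2 (fun x => pullbackW z ψ (x, 0))
      (ballH (matH z ψ) r) 0 (fun _ => x) = normH (matH z ψ) x ^ 2 := by
  obtain ⟨L, hL, -⟩ := exists_equiv_normH h.posDef_H
  rw [iteratedFDerivWithin_eq_iteratedFDeriv (uniqueDiffOn_ballH hL hr)
    h.contDiffAt_pullbackW_fst (zero_mem_ballH hL hr.le),
    iteratedFDeriv_two_apply, h.fderiv_fderiv_pullbackW]

/-- Fourth-order expansion of `w(·, 0)` at the minimizer. -/
theorem abs_pullbackW_sub_cubic_le (h : BoundaryMinSetting D z Ω ψ ρ₀) (hr : 0 < r)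
    (hw : ContDiffOn ℝ 4 (pullbackW z ψ) (ballH (matH z ψ) r ×ˢ Icc 0 (r ^ 2))) {x : RVec d}
    (hx : x ∈ ballH (matH z ψ) r) :
    |pullbackW z ψ (x, 0) - z 0 - normH (matH z ψ) x ^ 2 / 2 -
      iteratedFDerivWithin ℝ 3 (fun x => pullbackW z ψ (x, 0)) (ballH (matH z ψ) r) 0
        (fun _ => x) / 6| ≤
      omegaSup (matH z ψ) (pullbackW z ψ) (ballH (matH z ψ) r) 4 0 r 0 *
        normH (matH z ψ) x ^ 4 / 24 := by
  obtain ⟨L, hL, -⟩ := exists_equiv_normH h.posDef_H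
  have hf := contDiffOn_partialY_zero (by positivity) hw
  obtain ⟨ξ, hξ, hT⟩ := exists_taylor_ray (n := 3) (convex_ballH hL r)
    (zero_mem_interior_ballH hL hr) hf hx
  have hξx : ξ • x ∈ ballH (matH z ψ) r :=
    (convex_ballH hL r).starConvex (zero_mem_ballH hL hr.le) |>.smul_mem hx hξ.1.le hξ.2.le
  have h4 := (abs_const_le_tensorNormH hL (iteratedFDerivWithin ℝ 4
      (fun x => partialY (pullbackW z ψ) 0 x 0) (ballH (matH z ψ) r) (ξ • x)) x).trans
    (mul_le_mul_of_nonneg_right (tensorNormH_le_omegaSup_zero hL hr le_rfl hf le_rfl hξx)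
      (pow_nonneg (normH_nonneg _ x) 4))
  rw [partialY_zero_eq] at hT h4
  simp only [Finset.sum_range_succ, Finset.sum_range_zero, iteratedFDerivWithin_zero_apply,
    h.iteratedFDerivWithin_one_pullbackW hr, h.iteratedFDerivWithin_two_pullbackW hr,
    h.pullbackW_zero, congrFun (partialY_zero_eq (pullbackW z ψ)) x] at hT
  norm_num [Nat.factorial] at hT
  rw [hT]
  have := abs_le.mp h4
  rw [abs_le]
  constructor <;> linarith

/-- On the half ball the third derivative times the norm is at most 3/2, so the cubic remainder
takes away at most half of the quadratic term `‖x‖_H² / 2`. -/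
theorem le_pullbackW_sub (h : BoundaryMinSetting D z Ω ψ ρ₀) (hr : 0 < r)
    (hw : ContDiffOn ℝ 4 (pullbackW z ψ) (ballH (matH z ψ) r ×ˢ Icc 0 (r ^ 2)))
    (h3 : r * omegaSup (matH z ψ) (pullbackW z ψ) (ballH (matH z ψ) r) 3 0 r 0 ≤ 3) {x : RVec d}
    (hx : x ∈ ballH (matH z ψ) (r / 2)) :
    normH (matH z ψ) x ^ 2 / 4 ≤ pullbackW z ψ (x, 0) - z 0 := by
  obtain ⟨L, hL, -⟩ := exists_equiv_normH h.posDef_H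
  have hxr : x ∈ ballH (matH z ψ) r := ballH_mono (by linarith) hx
  have hf := contDiffOn_partialY_zero (by positivity) hw
  obtain ⟨ξ, hξ, hT⟩ := exists_taylor_ray (n := 2) (convex_ballH hL r)
    (zero_mem_interior_ballH hL hr) (hf.of_le (by norm_num)) hxr
  have hξx : ξ • x ∈ ballH (matH z ψ) r :=
    (convex_ballH hL r).starConvex (zero_mem_ballH hL hr.le) |>.smul_mem hxr hξ.1.le hξ.2.le
  have h4 := (abs_const_le_tensorNormH hL (iteratedFDerivWithin ℝ 3
      (fun x => partialY (pullbackW z ψ) 0 x 0) (ballH (matH z ψ) r) (ξ • x)) x).trans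
    (mul_le_mul_of_nonneg_right (tensorNormH_le_omegaSup_zero hL hr le_rfl hf (by norm_num) hξx)
      (pow_nonneg (normH_nonneg _ x) 3))
  rw [partialY_zero_eq] at hT h4
  simp only [Finset.sum_range_succ, Finset.sum_range_zero, iteratedFDerivWithin_zero_apply,
    h.iteratedFDerivWithin_one_pullbackW hr, h.iteratedFDerivWithin_two_pullbackW hr,
    h.pullbackW_zero, congrFun (partialY_zero_eq (pullbackW z ψ)) x] at hT
  norm_num [Nat.factorial] at hT
  rw [hT]
  set N := normH (matH z ψ) x with hN
  set W := omegaSup (matH z ψ) (pullbackW z ψ) (ballH (matH z ψ) r) 3 0 r 0 with hW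
  have hN0 : 0 ≤ N := normH_nonneg _ x
  have hNr : N ≤ r / 2 := hx
  have hWN : W * N ≤ 3 / 2 := by
    rcases le_or_gt W 0 with hW0 | hW0
    · nlinarith
    · nlinarith
  have h5 : W * N ^ 3 ≤ 3 / 2 * N ^ 2 := by nlinarith [sq_nonneg N]
  have := (abs_le.mp h4).1
  linarith

/-- The derivative at `0` of the normal derivative `∂_y w(·, 0)`. -/
noncomputable def normalSlope (z : RVec d × ℝ → ℝ) (ψ : RVec d → ℝ) (r : ℝ) : RVec d →L[ℝ] ℝ :=
  fderivWithin ℝ (fun x => partialY (pullbackW z ψ) 1 x 0) (ballH (matH z ψ) r) 0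

theorem abs_normalSlope_le (h : BoundaryMinSetting D z Ω ψ ρ₀) (hr : 0 < r) (hrρ : r ≤ ρ₀)
    (hw : ContDiffOn ℝ 4 (pullbackW z ψ) (ballH (matH z ψ) r ×ˢ Icc 0 (r ^ 2))) (x : RVec d) :
    |normalSlope z ψ r x| ≤
      omegaSup (matH z ψ) (pullbackW z ψ) (ballH (matH z ψ) r) 1 1 0 0 * normH (matH z ψ) x := by
  obtain ⟨L, hL, -⟩ := exists_equiv_normH h.posDef_H
  have hp := h.contDiffOn_partialY_one hr hrρ (by positivity) hw
  have huniq := uniqueDiffOn_ballH hL hr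
  have h1 := (abs_const_le_tensorNormH hL (iteratedFDerivWithin ℝ 1
      (fun x => partialY (pullbackW z ψ) 1 x 0) (ballH (matH z ψ) r) 0) x).trans
    (mul_le_mul_of_nonneg_right (tensorNormH_le_omegaSup_zero hL hr hr.le hp (by norm_num)
      (zero_mem_ballH hL le_rfl)) (pow_nonneg (normH_nonneg _ x) 1))
  rwa [iteratedFDerivWithin_one_apply (huniq 0 (zero_mem_ballH hL hr.le)), pow_one] at h1

theorem abs_partialY_sub_le (h : BoundaryMinSetting D z Ω ψ ρ₀) (hr : 0 < r) (hrρ : r ≤ ρ₀)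
    (hw : ContDiffOn ℝ 4 (pullbackW z ψ) (ballH (matH z ψ) r ×ˢ Icc 0 (r ^ 2))) {x : RVec d}
    (hx : x ∈ ballH (matH z ψ) r) :
    |partialY (pullbackW z ψ) 1 x 0 - 1 - normalSlope z ψ r x| ≤
      omegaSup (matH z ψ) (pullbackW z ψ) (ballH (matH z ψ) r) 2 1 r 0 *
        normH (matH z ψ) x ^ 2 / 2 := by
  obtain ⟨L, hL, -⟩ := exists_equiv_normH h.posDef_H
  have hp := h.contDiffOn_partialY_one hr hrρ (by positivity) hw
  have huniq := uniqueDiffOn_ballH hL hr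
  obtain ⟨ξ, hξ, hT⟩ := exists_taylor_ray (n := 1) (convex_ballH hL r)
    (zero_mem_interior_ballH hL hr) (hp.of_le (by norm_num)) hx
  have hξx : ξ • x ∈ ballH (matH z ψ) r :=
    (convex_ballH hL r).starConvex (zero_mem_ballH hL hr.le) |>.smul_mem hx hξ.1.le hξ.2.le
  have h4 := (abs_const_le_tensorNormH hL (iteratedFDerivWithin ℝ 2
      (fun x => partialY (pullbackW z ψ) 1 x 0) (ballH (matH z ψ) r) (ξ • x)) x).trans
    (mul_le_mul_of_nonneg_right (tensorNormH_le_omegaSup_zero hL hr le_rfl hp (by norm_num) hξx)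
      (pow_nonneg (normH_nonneg _ x) 2))
  simp only [Finset.sum_range_succ, Finset.sum_range_zero, iteratedFDerivWithin_zero_apply,
    iteratedFDerivWithin_one_apply (huniq 0 (zero_mem_ballH hL hr.le)),
    h.partialY_one_zero] at hT
  norm_num [Nat.factorial] at hT
  rw [hT, normalSlope]
  have := abs_le.mp h4
  rw [abs_le]
  constructor <;> linarith

/-- The normal derivative is 1 at the origin, and its variation is paid for by the smallness
condition. The surplus with `ω_{0,2}` is kept to absorb the second-order term in `y` when
integrating up to height `r`. -/
theorem half_le_partialY_sub (h : BoundaryMinSetting D z Ω ψ ρ₀) (hr : 0 < r) (hrρ : r ≤ ρ₀)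
    (hw : ContDiffOn ℝ 4 (pullbackW z ψ) (ballH (matH z ψ) r ×ˢ Icc 0 (r ^ 2)))
    (hω : r * (omegaSup (matH z ψ) (pullbackW z ψ) (ballH (matH z ψ) r) 1 1 0 0 +
        omegaSup (matH z ψ) (pullbackW z ψ) (ballH (matH z ψ) r) 0 2 r r) +
      r ^ 2 * omegaSup (matH z ψ) (pullbackW z ψ) (ballH (matH z ψ) r) 2 1 r 0 ≤ 1 / 2)
    {x : RVec d} (hx : x ∈ ballH (matH z ψ) r) :
    1 / 2 + r / 2 * omegaSup (matH z ψ) (pullbackW z ψ) (ballH (matH z ψ) r) 0 2 r r ≤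
      partialY (pullbackW z ψ) 1 x 0 := by
  have h1 := (abs_le.mp (h.abs_normalSlope_le hr hrρ hw x)).1
  have h2 := (abs_le.mp (h.abs_partialY_sub_le hr hrρ hw hx)).1
  have hN0 : 0 ≤ normH (matH z ψ) x := normH_nonneg _ x
  have hNr : normH (matH z ψ) x ≤ r := hx
  have hom : ∀ l j r₁ s, 0 ≤ omegaSup (matH z ψ) (pullbackW z ψ) (ballH (matH z ψ) r) l j r₁ s := by
    intro l j r₁ s
    refine Real.sSup_nonneg ?_
    rintro a ⟨x, -, y, -, rfl⟩
    exact tensorNormH_nonneg _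
  have h11 := mul_le_mul_of_nonneg_left hNr (hom 1 1 0 0)
  have h21 := mul_le_mul_of_nonneg_left (pow_le_pow_left₀ hN0 hNr 2) (hom 2 1 r 0)
  have h02 := mul_nonneg hr.le (hom 0 2 r r)
  have h21' := mul_nonneg (sq_nonneg r) (hom 2 1 r 0)
  linarith

theorem add_half_le_pullbackW (h : BoundaryMinSetting D z Ω ψ ρ₀) (hr : 0 < r) (hrρ : r ≤ ρ₀)
    (hw : ContDiffOn ℝ 4 (pullbackW z ψ) (ballH (matH z ψ) r ×ˢ Icc 0 (r ^ 2)))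
    (hω : r * (omegaSup (matH z ψ) (pullbackW z ψ) (ballH (matH z ψ) r) 1 1 0 0 +
        omegaSup (matH z ψ) (pullbackW z ψ) (ballH (matH z ψ) r) 0 2 r r) +
      r ^ 2 * omegaSup (matH z ψ) (pullbackW z ψ) (ballH (matH z ψ) r) 2 1 r 0 ≤ 1 / 2)
    {x : RVec d} (hx : x ∈ ballH (matH z ψ) r) {y : ℝ} (hy : y ∈ Icc 0 r) :
    y / 2 ≤ pullbackW z ψ (x, y) - pullbackW z ψ (x, 0) := by
  have h1 := h.half_le_partialY_sub hr hrρ hw hω hx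
  have h2 := (abs_le.mp (h.abs_pullbackW_sub_le hrρ hrρ (ballH (matH z ψ) r) hx hy)).1
  set W := omegaSup (matH z ψ) (pullbackW z ψ) (ballH (matH z ψ) r) 0 2 r r
  have hW : 0 ≤ W := by
    refine Real.sSup_nonneg ?_
    rintro a ⟨x, -, y, -, rfl⟩
    exact tensorNormH_nonneg _
  have h3 := mul_le_mul_of_nonneg_right h1 hy.1
  have h4 : W * y ^ 2 ≤ W * (r * y) := by
    refine mul_le_mul_of_nonneg_left ?_ hW
    rw [sq]; exact mul_le_mul_of_nonneg_right hy.2 hy.1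
  linarith

/-- Local quadratic growth of `z` near the minimizer, in the coordinates `(x, t)`. -/
theorem growth_of_normH1_le (h : BoundaryMinSetting D z Ω ψ ρ₀) (hr : 0 < r) (hrρ : r ≤ ρ₀)
    (hw : ContDiffOn ℝ 4 (pullbackW z ψ) (ballH (matH z ψ) r ×ˢ Icc 0 (r ^ 2)))
    (hδ : r * deltaSup (matH z ψ) ψ 2 (r / 2) ≤ 2)
    (hω : r * (omegaSup (matH z ψ) (pullbackW z ψ) (ballH (matH z ψ) r) 1 1 0 0 +
        omegaSup (matH z ψ) (pullbackW z ψ) (ballH (matH z ψ) r) 0 2 r r) +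
      r ^ 2 * omegaSup (matH z ψ) (pullbackW z ψ) (ballH (matH z ψ) r) 2 1 r 0 ≤ 1 / 2)
    (h3 : r * omegaSup (matH z ψ) (pullbackW z ψ) (ballH (matH z ψ) r) 3 0 r 0 ≤ 3)
    {u : RVec d × ℝ} (hu : u ∈ D) (hur : normH1 (matH z ψ) u ≤ r / 2) :
    ∃ y ∈ Icc 0 r, u = boundaryMap ψ (u.1, y) ∧ u.1 ∈ ballH (matH z ψ) (r / 2) ∧
      |u.2 - y| ≤ normH (matH z ψ) u.1 ^ 2 / r ∧
      normH (matH z ψ) u.1 ^ 2 / 4 + y / 2 ≤ z u - z 0 := by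
  obtain ⟨L, hL, -⟩ := exists_equiv_normH h.posDef_H
  have hsq : normH (matH z ψ) u.1 ^ 2 + u.2 ^ 2 ≤ (r / 2) ^ 2 := by
    rw [normH1, Real.sqrt_le_left (by linarith)] at hur
    exact hur
  have hN0 : 0 ≤ normH (matH z ψ) u.1 := normH_nonneg _ _
  have hNr : normH (matH z ψ) u.1 ≤ r / 2 :=
    abs_le_of_sq_le_sq' (by nlinarith [sq_nonneg u.2]) (by linarith) |>.2
  have htr : u.2 ≤ r / 2 :=
    abs_le_of_sq_le_sq' (by nlinarith [sq_nonneg (normH (matH z ψ) u.1)]) (by linarith) |>.2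
  have hx2 : u.1 ∈ ballH (matH z ψ) (r / 2) := hNr
  have hxr : u.1 ∈ ballH (matH z ψ) r := ballH_mono (by linarith) hx2
  obtain ⟨⟨x, y⟩, ⟨-, hy⟩, hxy⟩ := h.above_boundary ⟨hu, ballH_mono hrρ hxr, mem_univ _⟩
  have hx1 : x = u.1 := congrArg Prod.fst hxy
  subst hx1
  have hu2 : u.2 = ψ u.1 + y := (congrArg Prod.snd hxy).symm
  have hψ := h.abs_ψ_le hr hrρ hδ hx2
  have hψr : normH (matH z ψ) u.1 ^ 2 / r ≤ r / 4 := by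
    rw [div_le_iff₀ hr]; nlinarith
  have hyr : y ∈ Icc 0 r := ⟨hy, by linarith [(abs_le.mp hψ).1]⟩
  refine ⟨y, hyr, hxy.symm, hx2, ?_, ?_⟩
  · rw [hu2, add_sub_cancel_right]; exact hψ
  · have h4 := h.le_pullbackW_sub hr hw h3 hx2
    have h5 := h.add_half_le_pullbackW hr hrρ hw hω hxr hyr
    have h6 : pullbackW z ψ (u.1, y) = z u := by rw [pullbackW, hxy]
    linarith

/-- Linear growth of `z` away from a neighbourhood of the minimizer. -/
theorem linear_growth (h : BoundaryMinSetting D z Ω ψ ρ₀) (hr : 0 < r) (hr1 : r ≤ 1) (hrρ : r ≤ ρ₀)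
    (hstar : StarConvex ℝ 0 D) (hconv : ∀ u ∈ D, ConvexOn ℝ (segment ℝ 0 u) z)
    (hw : ContDiffOn ℝ 4 (pullbackW z ψ) (ballH (matH z ψ) r ×ˢ Icc 0 (r ^ 2)))
    (hδ : r * deltaSup (matH z ψ) ψ 2 (r / 2) ≤ 2)
    (hω : r * (omegaSup (matH z ψ) (pullbackW z ψ) (ballH (matH z ψ) r) 1 1 0 0 +
        omegaSup (matH z ψ) (pullbackW z ψ) (ballH (matH z ψ) r) 0 2 r r) +
      r ^ 2 * omegaSup (matH z ψ) (pullbackW z ψ) (ballH (matH z ψ) r) 2 1 r 0 ≤ 1 / 2)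
    (h3 : r * omegaSup (matH z ψ) (pullbackW z ψ) (ballH (matH z ψ) r) 3 0 r 0 ≤ 3)
    {u : RVec d × ℝ} (hu : u ∈ D)
    (huP : u ∉ boundaryMap ψ '' (ballH (matH z ψ) (r / 2) ×ˢ Ico 0 (r ^ 2))) :
    r ^ 2 / 128 + r / 64 * normH1 (matH z ψ) u ≤ z u - z 0 := by
  obtain ⟨L, hL, -⟩ := exists_equiv_normH h.posDef_H
  set N := normH1 (matH z ψ) u with hN
  rcases le_or_gt N (r / 2) with hNr | hNr
  · obtain ⟨y, hy, hxy, hx, -, hz⟩ := h.growth_of_normH1_le hr hrρ hw hδ hω h3 hu hNr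
    -- Over the half ball a point outside the cap must have height at least `r²`, and the normal
    -- growth `y / 2` alone is enough.
    have hyr : r ^ 2 ≤ y := by
      by_contra hlt
      exact huP ⟨(u.1, y), ⟨hx, hy.1, not_le.mp hlt⟩, hxy.symm⟩
    have := mul_le_mul_of_nonneg_left hNr (by linarith : 0 ≤ r / 64)
    nlinarith [sq_nonneg (normH (matH z ψ) u.1), sq_nonneg r]
  · have hN0 : 0 < N := by linarith
    set s := r / 2 / N with hs
    have hs0 : 0 < s := by positivity
    have hs1 : s ≤ 1 := by rw [hs, div_le_one hN0]; exact hNr.le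
    have hsu : s • u ∈ D := hstar.smul_mem hu hs0.le hs1
    have hNs : normH1 (matH z ψ) (s • u) = r / 2 := by
      have : normH1 (matH z ψ) (s • u) = s * N := by
        rw [hN, normH1, normH1, Prod.smul_fst, Prod.smul_snd, normH_smul hL, smul_eq_mul,
          ← Real.sqrt_sq hs0.le, ← Real.sqrt_mul (sq_nonneg s), Real.sqrt_sq hs0.le]
        congr 1
        rw [mul_pow, sq_abs]; ring
      rw [this, hs]; field_simp
    obtain ⟨y, hy, hxy, hx, hty, hz⟩ := h.growth_of_normH1_le hr hrρ hw hδ hω h3 hsu hNs.le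
    set X := normH (matH z ψ) (s • u).1 with hX
    have hX0 : 0 ≤ X := normH_nonneg _ _
    have hXr : X ≤ r / 2 := hx
    have hsq : X ^ 2 + (s • u).2 ^ 2 = (r / 2) ^ 2 := by
      have h1 : normH1 (matH z ψ) (s • u) ^ 2 = (r / 2) ^ 2 := by rw [hNs]
      rwa [normH1, Real.sq_sqrt (by positivity)] at h1
    -- On the sphere of radius `r / 2` one of two terms is large. If `X ≥ r/4`, then `X² / 4 ≥ r² /
    -- 64`. Otherwise `t² ≥ 3r²/16` and `|t - y| ≤ r/16` force `y ≥ r/4`, and `r ≤ 1` makes `y / 2`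
    -- sufficient.
    have hmin : r ^ 2 / 64 ≤ z (s • u) - z 0 := by
      rcases le_or_gt (r / 4) X with hXc | hXc
      · nlinarith [hy.1]
      · have hX2 : X ^ 2 ≤ (r / 4) ^ 2 := by gcongr
        have hXr' : X ^ 2 / r ≤ r / 16 := by rw [div_le_iff₀ hr]; nlinarith
        have ht := abs_le.mp hty
        have hy2 : r / 4 ≤ y := by
          by_contra hlt
          push Not at hlt
          have h1 : (s • u).2 ≤ 5 / 16 * r := by linarith [ht.2]
          have h2 : -(5 / 16 * r) ≤ (s • u).2 := by linarith [ht.1, hy.1]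
          have h3 : (s • u).2 ^ 2 ≤ (5 / 16 * r) ^ 2 := sq_le_sq' h2 h1
          nlinarith [sq_pos_of_pos hr]
        nlinarith [sq_nonneg X]
    have hcv := (hconv u hu).2 (left_mem_segment ℝ 0 u) (right_mem_segment ℝ 0 u)
      (by linarith : 0 ≤ 1 - s) hs0.le (by ring)
    rw [smul_zero, zero_add, smul_eq_mul, smul_eq_mul] at hcv
    have h1 : r ^ 2 / 64 ≤ s * (z u - z 0) := by linarith
    have h2 : s * N = r / 2 := by rw [hs]; field_simp
    -- Convexity along the ray divides the growth at `s • u` by `s = r / (2N)`. Half of the outcome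
    -- is at least `r² / 128` because `N > r / 2`.
    have h4 : r / 32 * N ≤ z u - z 0 := by
      have : s * (r / 32 * N) ≤ s * (z u - z 0) := by
        calc s * (r / 32 * N) = r / 32 * (s * N) := by ring
          _ = r ^ 2 / 64 := by rw [h2]; ring
          _ ≤ _ := h1
      exact le_of_mul_le_mul_left this hs0
    nlinarith

end BoundaryMinSetting

/-- Uncurrying of a trilinear form. -/
theorem exists_trilinear_eq {E : Type*} [NormedAddCommGroup E] [NormedSpace ℝ E]
    (T : ContinuousMultilinearMap ℝ (fun _ : Fin 3 => E) ℝ) :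
    ∃ A : E →L[ℝ] E →L[ℝ] E →L[ℝ] ℝ, ∀ x y z, A x y z = T ![x, y, z] := by
  let c1 : ContinuousMultilinearMap ℝ (fun _ : Fin 1 => E) ℝ →L[ℝ] (E →L[ℝ] ℝ) :=
    ((continuousMultilinearCurryFin1 ℝ E ℝ).toContinuousLinearEquiv :
      ContinuousMultilinearMap ℝ (fun _ : Fin 1 => E) ℝ →L[ℝ] (E →L[ℝ] ℝ))
  let c2 : ContinuousMultilinearMap ℝ (fun _ : Fin 2 => E) ℝ →L[ℝ]
      (E →L[ℝ] ContinuousMultilinearMap ℝ (fun _ : Fin 1 => E) ℝ) :=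
    ((continuousMultilinearCurryLeftEquiv ℝ (fun _ : Fin 2 => E) ℝ).toContinuousLinearEquiv :
      ContinuousMultilinearMap ℝ (fun _ : Fin 2 => E) ℝ →L[ℝ]
        (E →L[ℝ] ContinuousMultilinearMap ℝ (fun _ : Fin 1 => E) ℝ))
  refine ⟨((ContinuousLinearMap.compL ℝ E (ContinuousMultilinearMap ℝ (fun _ : Fin 1 => E) ℝ)
    (E →L[ℝ] ℝ) c1).comp c2).comp T.curryLeft, fun x y z => ?_⟩
  simp only [c1, c2, ContinuousLinearMap.comp_apply, ContinuousLinearMap.compL_apply]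
  change T (Fin.cons x (Fin.cons y _)) = _
  congr 1
  ext i
  fin_cases i <;> rfl

/-! ### One-dimensional Laplace integrals in the normal variable -/

section Amplitude

theorem abs_exp_neg_sub_exp_neg_le {a b m : ℝ} (ha : m ≤ a) (hb : m ≤ b) :
    |exp (-a) - exp (-b)| ≤ |a - b| * exp (-m) := by
  wlog hab : a ≤ b generalizing a b
  · rw [abs_sub_comm, abs_sub_comm a]
    exact this hb ha (le_of_not_ge hab)
  rw [abs_of_nonneg (sub_nonneg.mpr (exp_le_exp.mpr (by linarith))), abs_sub_comm,
    abs_of_nonneg (sub_nonneg.mpr hab)]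
  have h1 : exp (-b) = exp (-a) * exp (-(b - a)) := by rw [← exp_add]; congr 1; ring
  have h2 := add_one_le_exp (-(b - a))
  have h3 : exp (-a) ≤ exp (-m) := exp_le_exp.mpr (by linarith)
  calc exp (-a) - exp (-b) = exp (-a) * (1 - exp (-(b - a))) := by rw [h1]; ring
    _ ≤ exp (-a) * (b - a) := by
      refine mul_le_mul_of_nonneg_left ?_ (exp_pos _).le
      linarith
    _ ≤ exp (-m) * (b - a) := mul_le_mul_of_nonneg_right h3 (by linarith)
    _ = _ := by ring

theorem setIntegral_Ico_exp_neg {c L : ℝ} (hc : c ≠ 0) (hL : 0 ≤ L) :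
    ∫ y in Ico 0 L, exp (-(c * y)) = (1 - exp (-(c * L))) / c := by
  rw [integral_Ico_eq_integral_Ioo, ← integral_Ioc_eq_integral_Ioo,
    ← intervalIntegral.integral_of_le hL]
  have hd : ∀ y ∈ uIcc 0 L, HasDerivAt (fun y => -exp (-(c * y)) / c) (exp (-(c * y))) y := by
    intro y _
    have h1 : HasDerivAt (fun y => -(c * y)) (-(c * 1)) y := ((hasDerivAt_id y).const_mul c).neg
    refine (h1.exp.neg.div_const c).congr_deriv ?_
    field_simp
  rw [intervalIntegral.integral_eq_sub_of_hasDerivAt hd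
    ((by fun_prop : Continuous fun y => exp (-(c * y))).intervalIntegrable _ _)]
  simp; ring

theorem setIntegral_Ico_exp_neg_le {c L : ℝ} (hc : 0 < c) (hL : 0 ≤ L) :
    ∫ y in Ico 0 L, exp (-(c * y)) ≤ 1 / c := by
  rw [setIntegral_Ico_exp_neg hc.ne' hL]
  gcongr
  linarith [exp_pos (-(c * L))]

theorem integrableOn_Ico_of_continuousOn {f : ℝ → ℝ} {L : ℝ} (hf : ContinuousOn f (Icc 0 L)) :
    IntegrableOn f (Ico 0 L) :=
  (hf.integrableOn_compact isCompact_Icc).mono_set Ico_subset_Icc_self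

variable {h : ℝ → ℝ} {lam L p W : ℝ}

theorem mul_setIntegral_exp_neg_le (hlam : 0 < lam) (hL : 0 ≤ L) (hc : ContinuousOn h (Icc 0 L))
    (hh : ∀ y ∈ Icc 0 L, y / 2 ≤ h y) : lam * ∫ y in Ico 0 L, exp (-(lam * h y)) ≤ 2 := by
  have h1 : ∫ y in Ico 0 L, exp (-(lam * h y)) ≤ ∫ y in Ico 0 L, exp (-(lam / 2 * y)) := by
    refine setIntegral_mono_on (integrableOn_Ico_of_continuousOn (by fun_prop))
      (integrableOn_Ico_of_continuousOn (by fun_prop)) measurableSet_Ico fun y hy => ?_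
    rw [exp_le_exp]
    have := mul_le_mul_of_nonneg_left (hh y (Ico_subset_Icc_self hy)) hlam.le
    linarith
  have h2 := setIntegral_Ico_exp_neg_le (by positivity : 0 < lam / 2) hL
  calc lam * ∫ y in Ico 0 L, exp (-(lam * h y)) ≤ lam * (1 / (lam / 2)) := by gcongr; linarith
    _ = 2 := by field_simp

/-- One-dimensional Laplace integral with a linearly growing phase. -/
theorem abs_mul_setIntegral_exp_neg_sub_le (hlam : 0 < lam) (hL : 0 ≤ L)
    (hc : ContinuousOn h (Icc 0 L)) (hp : 1 / 2 ≤ p) (hh : ∀ y ∈ Icc 0 L, y / 2 ≤ h y)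
    (hW0 : 0 ≤ W) (hW : ∀ y ∈ Icc 0 L, |h y - p * y| ≤ W * y ^ 2 / 2) :
    |lam * (∫ y in Ico 0 L, exp (-(lam * h y))) - 1 / p| ≤
      64 * W / lam + 2 * exp (-(lam * L / 2)) := by
  have hp0 : 0 < p := by linarith
  have hpt : ∀ y ∈ Ico 0 L, |exp (-(lam * h y)) - exp (-(lam * p * y))| ≤
      16 * W / lam * exp (-(lam / 4 * y)) := by
    intro y hy
    have hy' := Ico_subset_Icc_self hy
    have h1 := mul_le_mul_of_nonneg_left (hh y hy') hlam.le
    have h2 : lam * (y / 2) ≤ lam * p * y := by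
      have := mul_le_mul_of_nonneg_right hp (mul_nonneg hlam.le hy'.1)
      linarith
    refine (abs_exp_neg_sub_exp_neg_le h1 h2).trans ?_
    have h3 : |lam * h y - lam * p * y| ≤ lam * (W * y ^ 2 / 2) := by
      rw [mul_assoc, ← mul_sub, abs_mul, abs_of_pos hlam]
      gcongr; exact hW y hy'
    -- From `s² / 2 ≤ exp s` with `s = λ y / 4`: the quadratic factor costs half of the decay `exp
    -- (-λ y / 2)`.
    have h4 : (lam * y) ^ 2 ≤ 32 * exp (lam / 4 * y) := by
      have := quadratic_le_exp_of_nonneg (mul_nonneg (by positivity : 0 ≤ lam / 4) hy'.1)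
      nlinarith [mul_nonneg (by positivity : 0 ≤ lam / 4) hy'.1]
    have h5 : exp (-(lam * (y / 2))) = exp (-(lam / 4 * y)) * exp (-(lam / 4 * y)) := by
      rw [← exp_add]; congr 1; ring
    have h6 : exp (lam / 4 * y) * exp (-(lam / 4 * y)) = 1 := by rw [← exp_add]; simp
    calc |lam * h y - lam * p * y| * exp (-(lam * (y / 2)))
        ≤ lam * (W * y ^ 2 / 2) * exp (-(lam * (y / 2))) := by gcongr
      _ = W / (2 * lam) * (lam * y) ^ 2 * (exp (-(lam / 4 * y)) * exp (-(lam / 4 * y))) := by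
          rw [h5]; field_simp
      _ ≤ W / (2 * lam) * (32 * exp (lam / 4 * y)) *
          (exp (-(lam / 4 * y)) * exp (-(lam / 4 * y))) := by gcongr
      _ = 16 * W / lam * (exp (lam / 4 * y) * exp (-(lam / 4 * y))) * exp (-(lam / 4 * y)) := by
          field_simp; ring
      _ = _ := by rw [h6, mul_one]
  have hi1 : IntegrableOn (fun y => exp (-(lam * h y))) (Ico 0 L) :=
    integrableOn_Ico_of_continuousOn (by fun_prop)
  have hi2 : IntegrableOn (fun y => exp (-(lam * p * y))) (Ico 0 L) :=
    integrableOn_Ico_of_continuousOn (by fun_prop)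
  have hi3 : IntegrableOn (fun y => 16 * W / lam * exp (-(lam / 4 * y))) (Ico 0 L) :=
    integrableOn_Ico_of_continuousOn (by fun_prop)
  have hdiff : |(∫ y in Ico 0 L, exp (-(lam * h y))) - ∫ y in Ico 0 L, exp (-(lam * p * y))| ≤
      16 * W / lam * (1 / (lam / 4)) := by
    rw [← integral_sub hi1 hi2, ← Real.norm_eq_abs]
    refine (norm_integral_le_of_norm_le hi3 ?_).trans ?_
    · filter_upwards [ae_restrict_mem measurableSet_Ico] with y hy
      exact hpt y hy
    · rw [integral_const_mul]
      gcongr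
      exact setIntegral_Ico_exp_neg_le (by positivity) hL
  rw [setIntegral_Ico_exp_neg (by positivity) hL] at hdiff
  have h7 : exp (-(lam * p * L)) / p ≤ 2 * exp (-(lam * L / 2)) := by
    rw [div_le_iff₀ hp0]
    have h8 : exp (-(lam * p * L)) ≤ exp (-(lam * L / 2)) := by
      rw [exp_le_exp]
      have := mul_le_mul_of_nonneg_right hp (mul_nonneg hlam.le hL)
      linarith
    nlinarith [exp_pos (-(lam * L / 2))]
  have h9 : lam * (∫ y in Ico 0 L, exp (-(lam * h y))) - 1 / p =
      lam * ((∫ y in Ico 0 L, exp (-(lam * h y))) - (1 - exp (-(lam * p * L))) / (lam * p)) -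
        exp (-(lam * p * L)) / p := by field_simp; ring
  rw [h9]
  refine (abs_sub _ _).trans (add_le_add ?_ ?_)
  · rw [abs_mul, abs_of_pos hlam]
    calc lam * _ ≤ lam * (16 * W / lam * (1 / (lam / 4))) := by gcongr
      _ = 64 * W / lam := by field_simp; ring
  · rwa [abs_of_nonneg (by positivity)]

/-- Writing `p = 1 + a + s`, the difference equals `(a² - s + a s) / p` with `1 / p ≤ 2`: it is
quadratic in `a` and linear in `s`. -/
theorem abs_one_div_sub_le {a β : ℝ} (hp : 1 / 2 ≤ p) (ha : |a| ≤ 1) (hβ : |p - 1 - a| ≤ β) :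
    |1 / p - (1 - a)| ≤ 2 * a ^ 2 + 4 * β := by
  have hp0 : 0 < p := by linarith
  have h1 : 1 / p - (1 - a) = (a ^ 2 - (p - 1 - a) + a * (p - 1 - a)) / p := by
    field_simp; ring
  rw [h1, abs_div, abs_of_pos hp0, div_le_iff₀ hp0]
  have h2 : |a * (p - 1 - a)| ≤ β := by
    rw [abs_mul]
    nlinarith [abs_nonneg a, abs_nonneg (p - 1 - a)]
  have hβ0 : 0 ≤ β := (abs_nonneg _).trans hβ
  have h3 : |a ^ 2 - (p - 1 - a) + a * (p - 1 - a)| ≤ a ^ 2 + 2 * β := by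
    have := abs_le.mp h2
    have := abs_le.mp hβ
    rw [abs_le]
    constructor <;> nlinarith [sq_nonneg a]
  nlinarith [sq_nonneg a]

end Amplitude

/-! ### The boundary chart as a volume-preserving shear -/

section Shear

variable {d : ℕ}

/-- The shear `(x, y) ↦ (x, φ(x) + y)` as a measurable equivalence. -/
def shearEquiv {φ : RVec d → ℝ} (hφ : Measurable φ) : (RVec d × ℝ) ≃ᵐ (RVec d × ℝ) where
  toFun p := (p.1, φ p.1 + p.2)
  invFun p := (p.1, p.2 - φ p.1)
  left_inv p := by simp
  right_inv p := by simp
  measurable_toFun := measurable_fst.prodMk ((hφ.comp measurable_fst).add measurable_snd)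
  measurable_invFun := measurable_fst.prodMk (measurable_snd.sub (hφ.comp measurable_fst))

theorem measurePreserving_shearEquiv {φ : RVec d → ℝ} (hφ : Measurable φ) :
    MeasurePreserving (shearEquiv hφ) volume volume := by
  refine MeasurePreserving.skew_product (g := fun x y => φ x + y) (MeasurePreserving.id volume)
    ((hφ.comp measurable_fst).add measurable_snd) (.of_forall fun x => ?_)
  exact map_add_left_eq_self volume (φ x)

variable {ψ : RVec d → ℝ} {K : Set (RVec d)} {B : Set (RVec d × ℝ)}

/-- Outside `K` nothing is known about `ψ`, not even measurability. Replacing it there by 0 gives a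
globally measurable shear with the same effect over `K`. -/
theorem exists_shear_eqOn (hK : IsClosed K) (hψ : ContinuousOn ψ K) :
    ∃ φ : RVec d → ℝ, Measurable φ ∧ EqOn φ ψ K := by
  classical
  refine ⟨K.piecewise ψ 0, ?_, fun x hx => by simp [hx]⟩
  exact hψ.measurable_piecewise continuousOn_const hK.measurableSet

theorem boundaryMap_image_eq {φ : RVec d → ℝ} (hφ : Measurable φ) (h : EqOn φ ψ K)
    (hB : ∀ p ∈ B, p.1 ∈ K) : boundaryMap ψ '' B = shearEquiv hφ '' B :=
  image_congr fun p hp => by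
    change (p.1, ψ p.1 + p.2) = (p.1, φ p.1 + p.2)
    rw [h (hB p hp)]

theorem measurableSet_boundaryMap_image (hK : IsClosed K) (hψ : ContinuousOn ψ K)
    (hBm : MeasurableSet B) (hB : ∀ p ∈ B, p.1 ∈ K) : MeasurableSet (boundaryMap ψ '' B) := by
  obtain ⟨φ, hφ, h⟩ := exists_shear_eqOn hK hψ
  rw [boundaryMap_image_eq hφ h hB]
  exact (shearEquiv hφ).measurableEmbedding.measurableSet_image' hBm

theorem volume_boundaryMap_image (hK : IsClosed K) (hψ : ContinuousOn ψ K)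
    (hB : ∀ p ∈ B, p.1 ∈ K) : volume (boundaryMap ψ '' B) = volume B := by
  obtain ⟨φ, hφ, h⟩ := exists_shear_eqOn hK hψ
  rw [boundaryMap_image_eq hφ h hB, ← (measurePreserving_shearEquiv hφ).measure_preimage_equiv,
    preimage_image_eq _ (shearEquiv hφ).injective]

theorem setIntegral_boundaryMap_image (hK : IsClosed K) (hψ : ContinuousOn ψ K)
    (hBm : MeasurableSet B) (hB : ∀ p ∈ B, p.1 ∈ K) (g : RVec d × ℝ → ℝ) :
    ∫ u in boundaryMap ψ '' B, g u = ∫ p in B, g (boundaryMap ψ p) := by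
  obtain ⟨φ, hφ, h⟩ := exists_shear_eqOn hK hψ
  rw [boundaryMap_image_eq hφ h hB, (measurePreserving_shearEquiv hφ).setIntegral_image_emb
    (shearEquiv hφ).measurableEmbedding]
  refine setIntegral_congr_fun hBm fun p hp => ?_
  change g (p.1, φ p.1 + p.2) = g (p.1, ψ p.1 + p.2)
  rw [h (hB p hp)]

theorem integrableOn_comp_boundaryMap (hK : IsClosed K) (hψ : ContinuousOn ψ K)
    (hBm : MeasurableSet B) (hB : ∀ p ∈ B, p.1 ∈ K) {g : RVec d × ℝ → ℝ}
    (hg : IntegrableOn g (boundaryMap ψ '' B)) : IntegrableOn (fun p => g (boundaryMap ψ p)) B := by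
  obtain ⟨φ, hφ, h⟩ := exists_shear_eqOn hK hψ
  rw [boundaryMap_image_eq hφ h hB] at hg
  have := ((measurePreserving_shearEquiv hφ).integrableOn_image
    (shearEquiv hφ).measurableEmbedding).mp hg
  refine this.congr_fun (fun p hp => ?_) hBm
  change g (p.1, φ p.1 + p.2) = g (p.1, ψ p.1 + p.2)
  rw [h (hB p hp)]

end Shear

/-! ### Localization to the boundary cap and integration in the normal direction -/

theorem omegaSup_nonneg {d : ℕ} (H : Matrix (Fin d) (Fin d) ℝ) (w : RVec d × ℝ → ℝ)
    (S : Set (RVec d)) (l j : ℕ) (r r' : ℝ) : 0 ≤ omegaSup H w S l j r r' := by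
  refine Real.sSup_nonneg ?_
  rintro a ⟨x, -, y, -, rfl⟩
  exact tensorNormH_nonneg _

/-- The conditions on the radius `r` under which the Laplace integral is localized. -/
structure LocalizationRadius {d : ℕ} (D : Set (RVec d × ℝ)) (z : RVec d × ℝ → ℝ)
    (Ω : Set (RVec d)) (ψ : RVec d → ℝ) (ρ₀ r : ℝ) : Prop where
  setting : BoundaryMinSetting D z Ω ψ ρ₀
  pos : 0 < r
  le_one : r ≤ 1
  le_radius : r ≤ ρ₀
  smooth : ContDiffOn ℝ 4 (pullbackW z ψ) (ballH (matH z ψ) r ×ˢ Icc 0 (r ^ 2))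
  slope_le : r * (omegaSup (matH z ψ) (pullbackW z ψ) (ballH (matH z ψ) r) 1 1 0 0 +
        omegaSup (matH z ψ) (pullbackW z ψ) (ballH (matH z ψ) r) 0 2 r r) +
      r ^ 2 * omegaSup (matH z ψ) (pullbackW z ψ) (ballH (matH z ψ) r) 2 1 r 0 ≤ 1 / 2
  third_le : r * omegaSup (matH z ψ) (pullbackW z ψ) (ballH (matH z ψ) r) 3 0 r 0 ≤ 3
  growth : ∀ u ∈ D, u ∉ boundaryMap ψ '' (ballH (matH z ψ) (r / 2) ×ˢ Ico 0 (r ^ 2)) →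
    r ^ 2 / 128 + r / 64 * normH1 (matH z ψ) u ≤ z u - z 0

/-- The part of `D` over `U_H(r/2)` at height less than `r²` above the boundary. -/
def boundaryCap {d : ℕ} (z : RVec d × ℝ → ℝ) (ψ : RVec d → ℝ) (r : ℝ) : Set (RVec d × ℝ) :=
  boundaryMap ψ '' (ballH (matH z ψ) (r / 2) ×ˢ Ico 0 (r ^ 2))

/-- The amplitude left after integrating out the normal variable. -/
noncomputable def normalAmplitude {d : ℕ} (z : RVec d × ℝ → ℝ) (ψ : RVec d → ℝ) (lam r : ℝ)
    (x : RVec d) : ℝ :=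
  lam * ∫ y in Ico 0 (r ^ 2), exp (-(lam * (pullbackW z ψ (x, y) - pullbackW z ψ (x, 0))))

namespace LocalizationRadius

variable {d : ℕ} {D : Set (RVec d × ℝ)} {z : RVec d × ℝ → ℝ} {Ω : Set (RVec d)}
  {ψ : RVec d → ℝ} {ρ₀ r lam R ε : ℝ}

theorem sq_le_self (h : LocalizationRadius D z Ω ψ ρ₀ r) : r ^ 2 ≤ r := by
  nlinarith [h.pos, h.le_one]

theorem half_ball_subset (h : LocalizationRadius D z Ω ψ ρ₀ r) :
    ballH (matH z ψ) (r / 2) ⊆ ballH (matH z ψ) r := ballH_mono (by linarith [h.pos])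

theorem cap_subset (h : LocalizationRadius D z Ω ψ ρ₀ r) : boundaryCap z ψ r ⊆ D := by
  rintro _ ⟨⟨x, y⟩, ⟨hx, hy⟩, rfl⟩
  exact h.setting.boundaryMap_mem (ballH_mono (by linarith [h.pos, h.le_radius]) hx)
    ⟨hy.1, by linarith [hy.2, h.sq_le_self, h.le_radius]⟩

theorem isCompact_half_ball (h : LocalizationRadius D z Ω ψ ρ₀ r) :
    IsCompact (ballH (matH z ψ) (r / 2)) := by
  obtain ⟨L, hL, -⟩ := exists_equiv_normH h.setting.posDef_H
  exact isCompact_ballH hL _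

theorem continuousOn_ψ (h : LocalizationRadius D z Ω ψ ρ₀ r) :
    ContinuousOn ψ (ballH (matH z ψ) (r / 2)) :=
  h.setting.ψ_smooth.continuousOn.mono
    ((ballH_mono (by linarith [h.pos, h.le_radius])).trans h.setting.ball_subset)

theorem measurableSet_prod (h : LocalizationRadius D z Ω ψ ρ₀ r) :
    MeasurableSet (ballH (matH z ψ) (r / 2) ×ˢ Ico 0 (r ^ 2)) :=
  h.isCompact_half_ball.isClosed.measurableSet.prod measurableSet_Ico

theorem measurableSet_cap (h : LocalizationRadius D z Ω ψ ρ₀ r) :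
    MeasurableSet (boundaryCap z ψ r) :=
  measurableSet_boundaryMap_image h.isCompact_half_ball.isClosed h.continuousOn_ψ
    h.measurableSet_prod fun _ hp => hp.1

theorem volume_cap_lt_top (h : LocalizationRadius D z Ω ψ ρ₀ r) :
    volume (boundaryCap z ψ r) < ⊤ := by
  unfold boundaryCap
  rw [volume_boundaryMap_image h.isCompact_half_ball.isClosed h.continuousOn_ψ fun _ hp => hp.1]
  refine (measure_mono (prod_mono_right Ico_subset_Icc_self)).trans_lt ?_
  exact (h.isCompact_half_ball.prod isCompact_Icc).measure_lt_top

theorem aestronglyMeasurable_exp (h : LocalizationRadius D z Ω ψ ρ₀ r) (lam : ℝ) :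
    AEStronglyMeasurable (fun u => exp (-lam * z u)) (volume.restrict D) := by
  have := h.setting.continuousOn_z
  exact ContinuousOn.aestronglyMeasurable (by fun_prop) h.setting.isClosed_D.measurableSet

theorem integrableOn_cap (h : LocalizationRadius D z Ω ψ ρ₀ r) (hlam : 0 < lam) :
    IntegrableOn (fun u => exp (-lam * z u)) (boundaryCap z ψ r) := by
  refine Integrable.mono' (g := fun _ => exp (-lam * z 0))
    (integrableOn_const h.volume_cap_lt_top.ne)
    ((h.aestronglyMeasurable_exp lam).mono_measure (Measure.restrict_mono h.cap_subset le_rfl)) ?_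
  filter_upwards [ae_restrict_mem h.measurableSet_cap] with u hu
  have := mul_le_mul_of_nonneg_left (h.setting.z_zero_le (h.cap_subset hu)) hlam.le
  rw [Real.norm_eq_abs, abs_of_pos (exp_pos _), exp_le_exp]
  linarith

theorem exp_le_of_notMem_cap (h : LocalizationRadius D z Ω ψ ρ₀ r) (hlam : 0 < lam)
    {u : RVec d × ℝ} (hu : u ∈ D \ boundaryCap z ψ r) :
    ‖exp (-lam * z u)‖ ≤ exp (-lam * z 0) * exp (-(lam * r ^ 2 / 128)) *
      exp (-(lam * r / 64 * normH1 (matH z ψ) u)) := by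
  have := mul_le_mul_of_nonneg_left (h.growth u hu.1 hu.2) hlam.le
  rw [Real.norm_eq_abs, abs_of_pos (exp_pos _), ← exp_add, ← exp_add, exp_le_exp]
  linarith

theorem integrableOn_diff_cap (h : LocalizationRadius D z Ω ψ ρ₀ r) (hlam : 0 < lam)
    (hi : Integrable fun u => exp (-(lam * r / 64 * normH1 (matH z ψ) u))) :
    IntegrableOn (fun u => exp (-lam * z u)) (D \ boundaryCap z ψ r) := by
  refine Integrable.mono' (g := fun u => exp (-lam * z 0) * exp (-(lam * r ^ 2 / 128)) *
      exp (-(lam * r / 64 * normH1 (matH z ψ) u))) (hi.const_mul _).integrableOn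
    ((h.aestronglyMeasurable_exp lam).mono_measure (Measure.restrict_mono sdiff_subset le_rfl)) ?_
  filter_upwards [ae_restrict_mem (h.setting.isClosed_D.measurableSet.diff h.measurableSet_cap)]
    with u hu
  exact h.exp_le_of_notMem_cap hlam hu

theorem abs_setIntegral_diff_cap_le (h : LocalizationRadius D z Ω ψ ρ₀ r) (hlam : 0 < lam)
    (hi : Integrable fun u => exp (-(lam * r / 64 * normH1 (matH z ψ) u))) :
    |∫ u in D \ boundaryCap z ψ r, exp (-lam * z u)| ≤
      exp (-lam * z 0) * exp (-(lam * r ^ 2 / 128)) *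
        ∫ u, exp (-(lam * r / 64 * normH1 (matH z ψ) u)) := by
  rw [← integral_const_mul, ← Real.norm_eq_abs]
  have hi' := hi.const_mul (exp (-lam * z 0) * exp (-(lam * r ^ 2 / 128)))
  have h1 := norm_integral_le_of_norm_le (f := fun u => exp (-lam * z u))
    (hi'.integrableOn (s := D \ boundaryCap z ψ r)) (by
      filter_upwards [ae_restrict_mem
        (h.setting.isClosed_D.measurableSet.diff h.measurableSet_cap)] with u hu
      exact h.exp_le_of_notMem_cap hlam hu)
  exact h1.trans (setIntegral_le_integral hi' (.of_forall fun u => by positivity))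

theorem integrableOn_D (h : LocalizationRadius D z Ω ψ ρ₀ r) (hlam : 0 < lam)
    (hi : Integrable fun u => exp (-(lam * r / 64 * normH1 (matH z ψ) u))) :
    IntegrableOn (fun u => exp (-lam * z u)) D := by
  have := (h.integrableOn_cap hlam).union (h.integrableOn_diff_cap hlam hi)
  rwa [union_sdiff_cancel h.cap_subset] at this

theorem setIntegral_D (h : LocalizationRadius D z Ω ψ ρ₀ r) (hlam : 0 < lam)
    (hi : Integrable fun u => exp (-(lam * r / 64 * normH1 (matH z ψ) u))) :
    ∫ u in D, exp (-lam * z u) = (∫ u in boundaryCap z ψ r, exp (-lam * z u)) +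
      ∫ u in D \ boundaryCap z ψ r, exp (-lam * z u) := by
  rw [← setIntegral_union disjoint_sdiff_right
    (h.setting.isClosed_D.measurableSet.diff h.measurableSet_cap) (h.integrableOn_cap hlam)
    (h.integrableOn_diff_cap hlam hi), union_sdiff_cancel h.cap_subset]

theorem setIntegral_exp_pullbackW (hlam : 0 < lam) (x : RVec d) :
    ∫ y in Ico 0 (r ^ 2), exp (-lam * pullbackW z ψ (x, y)) =
      exp (-lam * z 0) / lam * (exp (-(lam * (pullbackW z ψ (x, 0) - z 0))) *
        normalAmplitude z ψ lam r x) := by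
  have h1 : ∀ y, exp (-lam * pullbackW z ψ (x, y)) =
      exp (-lam * pullbackW z ψ (x, 0)) *
        exp (-(lam * (pullbackW z ψ (x, y) - pullbackW z ψ (x, 0)))) := by
    intro y; rw [← exp_add]; congr 1; ring
  have h2 : exp (-lam * pullbackW z ψ (x, 0)) =
      exp (-lam * z 0) * exp (-(lam * (pullbackW z ψ (x, 0) - z 0))) := by
    rw [← exp_add]; congr 1; ring
  rw [integral_congr_ae (.of_forall h1), integral_const_mul, h2, normalAmplitude]
  field_simp

theorem integrableOn_prod (h : LocalizationRadius D z Ω ψ ρ₀ r) (hlam : 0 < lam) :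
    Integrable (fun p => exp (-lam * pullbackW z ψ p))
      ((volume.restrict (ballH (matH z ψ) (r / 2))).prod (volume.restrict (Ico 0 (r ^ 2)))) := by
  rw [Measure.prod_restrict]
  exact integrableOn_comp_boundaryMap h.isCompact_half_ball.isClosed h.continuousOn_ψ
    h.measurableSet_prod (fun _ hp => hp.1) (h.integrableOn_cap hlam)

/-- Fubini on the cap gives integrability of the inner integral, so no regularity of the amplitude
in `x` has to be studied. -/
theorem integrableOn_amplitude (h : LocalizationRadius D z Ω ψ ρ₀ r) (hlam : 0 < lam) :
    IntegrableOn (fun x => exp (-(lam * (pullbackW z ψ (x, 0) - z 0))) *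
      normalAmplitude z ψ lam r x) (ballH (matH z ψ) (r / 2)) := by
  have h1 := (h.integrableOn_prod hlam).integral_prod_left
  simp_rw [setIntegral_exp_pullbackW hlam] at h1
  have h2 := h1.const_mul (exp (-lam * z 0) / lam)⁻¹
  have h3 : exp (-lam * z 0) / lam ≠ 0 := by positivity
  simp only [inv_mul_cancel_left₀ h3] at h2
  exact h2

theorem setIntegral_cap (h : LocalizationRadius D z Ω ψ ρ₀ r) (hlam : 0 < lam) :
    ∫ u in boundaryCap z ψ r, exp (-lam * z u) = exp (-lam * z 0) / lam *
      ∫ x in ballH (matH z ψ) (r / 2), exp (-(lam * (pullbackW z ψ (x, 0) - z 0))) *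
        normalAmplitude z ψ lam r x := by
  unfold boundaryCap
  rw [setIntegral_boundaryMap_image h.isCompact_half_ball.isClosed h.continuousOn_ψ
    h.measurableSet_prod fun _ hp => hp.1, Measure.volume_eq_prod, ← Measure.prod_restrict]
  refine (integral_prod _ (h.integrableOn_prod hlam)).trans ?_
  rw [← integral_const_mul]
  exact integral_congr_ae (.of_forall fun x => setIntegral_exp_pullbackW hlam x)

theorem continuousOn_normal (h : LocalizationRadius D z Ω ψ ρ₀ r) {x : RVec d}
    (hx : x ∈ ballH (matH z ψ) r) :
    ContinuousOn (fun y => pullbackW z ψ (x, y) - pullbackW z ψ (x, 0)) (Icc 0 (r ^ 2)) := by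
  intro y hy
  have := (h.setting.contDiffAt_pullbackW_snd (ballH_mono h.le_radius hx)
    ⟨hy.1, by linarith [hy.2, h.sq_le_self, h.le_radius]⟩).continuousAt
  exact (this.sub continuousAt_const).continuousWithinAt

theorem half_le_normal (h : LocalizationRadius D z Ω ψ ρ₀ r) {x : RVec d}
    (hx : x ∈ ballH (matH z ψ) r) : ∀ y ∈ Icc 0 (r ^ 2),
      y / 2 ≤ pullbackW z ψ (x, y) - pullbackW z ψ (x, 0) := fun _ hy =>
  h.setting.add_half_le_pullbackW h.pos h.le_radius h.smooth h.slope_le hx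
    ⟨hy.1, hy.2.trans h.sq_le_self⟩

theorem abs_normalAmplitude_le (h : LocalizationRadius D z Ω ψ ρ₀ r) (hlam : 0 < lam) {x : RVec d}
    (hx : x ∈ ballH (matH z ψ) r) : |normalAmplitude z ψ lam r x| ≤ 2 := by
  have h0 : 0 ≤ ∫ y in Ico 0 (r ^ 2),
      exp (-(lam * (pullbackW z ψ (x, y) - pullbackW z ψ (x, 0)))) :=
    integral_nonneg fun _ => (exp_pos _).le
  rw [normalAmplitude, abs_of_nonneg (by positivity)]
  exact mul_setIntegral_exp_neg_le hlam (sq_nonneg r) (h.continuousOn_normal hx)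
    (h.half_le_normal hx)

theorem mul_slope_le (h : LocalizationRadius D z Ω ψ ρ₀ r) :
    r * omegaSup (matH z ψ) (pullbackW z ψ) (ballH (matH z ψ) r) 1 1 0 0 ≤ 1 / 2 := by
  have h1 := h.slope_le
  have h2 := mul_nonneg h.pos.le
    (omegaSup_nonneg (matH z ψ) (pullbackW z ψ) (ballH (matH z ψ) r) 0 2 r r)
  have h3 := mul_nonneg (sq_nonneg r)
    (omegaSup_nonneg (matH z ψ) (pullbackW z ψ) (ballH (matH z ψ) r) 2 1 r 0)
  linarith

/-- The value `1 / ∂_y w(x, 0)` is the intermediate term: the normal Laplace integral is compared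
with it, and it is then linearized. The halves in the last two terms come from `‖x‖_H ≤ r / 2`. -/
theorem abs_normalAmplitude_sub_le (h : LocalizationRadius D z Ω ψ ρ₀ r) (hlam : 0 < lam)
    {x : RVec d} (hx : x ∈ ballH (matH z ψ) (r / 2)) :
    |normalAmplitude z ψ lam r x - (1 - BoundaryMinSetting.normalSlope z ψ r x)| ≤
      64 * omegaSup (matH z ψ) (pullbackW z ψ) (ballH (matH z ψ) r) 0 2 r (r ^ 2) / lam +
        2 * exp (-(lam * r ^ 2 / 2)) +
      (omegaSup (matH z ψ) (pullbackW z ψ) (ballH (matH z ψ) r) 1 1 0 0 ^ 2 * r ^ 2 / 2 +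
        omegaSup (matH z ψ) (pullbackW z ψ) (ballH (matH z ψ) r) 2 1 r 0 * r ^ 2 / 2) := by
  have hxr := h.half_ball_subset hx
  have hn0 := normH_nonneg (matH z ψ) x
  have hn : normH (matH z ψ) x ≤ r / 2 := hx
  have ho11 := omegaSup_nonneg (matH z ψ) (pullbackW z ψ) (ballH (matH z ψ) r) 1 1 0 0
  have ho02 := omegaSup_nonneg (matH z ψ) (pullbackW z ψ) (ballH (matH z ψ) r) 0 2 r r
  have ho21 := omegaSup_nonneg (matH z ψ) (pullbackW z ψ) (ballH (matH z ψ) r) 2 1 r 0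
  have hp : 1 / 2 ≤ partialY (pullbackW z ψ) 1 x 0 := by
    have := h.setting.half_le_partialY_sub h.pos h.le_radius h.smooth h.slope_le hxr
    have := mul_nonneg (by linarith [h.pos] : 0 ≤ r / 2) ho02
    linarith
  have h1 := abs_mul_setIntegral_exp_neg_sub_le hlam (sq_nonneg r) (h.continuousOn_normal hxr) hp
    (h.half_le_normal hxr)
    (omegaSup_nonneg (matH z ψ) (pullbackW z ψ) (ballH (matH z ψ) r) 0 2 r (r ^ 2))
    fun y hy => h.setting.abs_pullbackW_sub_le h.le_radius (h.sq_le_self.trans h.le_radius) _ hxr hy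
  have ha : |BoundaryMinSetting.normalSlope z ψ r x| ≤
      omegaSup (matH z ψ) (pullbackW z ψ) (ballH (matH z ψ) r) 1 1 0 0 * (r / 2) :=
    (h.setting.abs_normalSlope_le h.pos h.le_radius h.smooth x).trans (by gcongr)
  have hβ : |partialY (pullbackW z ψ) 1 x 0 - 1 - BoundaryMinSetting.normalSlope z ψ r x| ≤
      omegaSup (matH z ψ) (pullbackW z ψ) (ballH (matH z ψ) r) 2 1 r 0 * (r / 2) ^ 2 / 2 :=
    (h.setting.abs_partialY_sub_le h.pos h.le_radius h.smooth hxr).trans (by gcongr)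
  have h2 := abs_one_div_sub_le hp (ha.trans (by linarith [h.mul_slope_le])) hβ
  have h3 : BoundaryMinSetting.normalSlope z ψ r x ^ 2 ≤
      (omegaSup (matH z ψ) (pullbackW z ψ) (ballH (matH z ψ) r) 1 1 0 0 * (r / 2)) ^ 2 :=
    sq_le_sq' (abs_le.mp ha).1 (abs_le.mp ha).2
  refine (abs_sub_le _ (1 / partialY (pullbackW z ψ) 1 x 0) _).trans (add_le_add h1 ?_)
  linarith

end LocalizationRadius

/-! ### Rescaling the tangential integral to Gaussian coordinates -/

namespace LocalizationRadius

variable {d : ℕ} {D : Set (RVec d × ℝ)} {z : RVec d × ℝ → ℝ} {Ω : Set (RVec d)}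
  {ψ : RVec d → ℝ} {ρ₀ r lam R : ℝ}

/-- The cubic form of the phase in the coordinates that turn `√λ ‖·‖_H` into the Euclidean norm. -/
theorem exists_scaled_cubic (h : LocalizationRadius D z Ω ψ ρ₀ r) (hlam : 0 < lam)
    {e : RVec d ≃L[ℝ] RVec d} (he : ∀ x, ‖e x‖ = √lam * normH (matH z ψ) x) :
    ∃ A : RVec d →L[ℝ] RVec d →L[ℝ] RVec d →L[ℝ] ℝ,
      (∀ X, A X X X = lam * iteratedFDerivWithin ℝ 3 (fun x => pullbackW z ψ (x, 0))
        (ballH (matH z ψ) r) 0 fun _ => e.symm X) ∧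
      ∀ X Y Z, |A X Y Z| ≤
        omegaSup (matH z ψ) (pullbackW z ψ) (ballH (matH z ψ) r) 3 0 0 0 / √lam *
          (‖X‖ * ‖Y‖ * ‖Z‖) := by
  obtain ⟨L, hL, -⟩ := exists_equiv_normH h.setting.posDef_H
  set T := iteratedFDerivWithin ℝ 3 (fun x => pullbackW z ψ (x, 0)) (ballH (matH z ψ) r) 0 with hT
  obtain ⟨A, hA⟩ := exists_trilinear_eq
    (lam • T.compContinuousLinearMap fun _ => (e.symm : RVec d →L[ℝ] RVec d))
  refine ⟨A, fun X => ?_, fun X Y Z => ?_⟩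
  · rw [hA]
    change lam * T (fun i => e.symm (![X, X, X] i)) = _
    congr 2
    funext i
    fin_cases i <;> rfl
  · rw [hA]
    change |lam * T (fun i => e.symm (![X, Y, Z] i))| ≤ _
    have hs : 0 < √lam := Real.sqrt_pos.mpr hlam
    have hn : ∀ X, normH (matH z ψ) (e.symm X) = ‖X‖ / √lam := fun X => by
      have := he (e.symm X)
      rw [e.apply_symm_apply] at this
      rw [this]; field_simp
    have h1 := abs_le_tensorNormH_mul_prod hL T (fun i => e.symm (![X, Y, Z] i))
    have h2 : tensorNormH (matH z ψ) T ≤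
        omegaSup (matH z ψ) (pullbackW z ψ) (ballH (matH z ψ) r) 3 0 0 0 := by
      have := tensorNormH_le_omegaSup_zero (l := 3) hL h.pos h.pos.le
        (BoundaryMinSetting.contDiffOn_partialY_zero (by have := h.pos; positivity) h.smooth)
        (by norm_num) (zero_mem_ballH hL le_rfl)
      rwa [BoundaryMinSetting.partialY_zero_eq] at this
    have h3 : ∏ i, normH (matH z ψ) (e.symm (![X, Y, Z] i)) = ‖X‖ * ‖Y‖ * ‖Z‖ / √lam ^ 3 := by
      rw [Fin.prod_univ_three, hn, hn, hn]
      simp only [Matrix.cons_val_zero, Matrix.cons_val_one, Matrix.cons_val]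
      field_simp
    rw [h3] at h1
    rw [abs_mul, abs_of_pos hlam]
    calc lam * |T _| ≤ lam *
          (omegaSup (matH z ψ) (pullbackW z ψ) (ballH (matH z ψ) r) 3 0 0 0 *
            (‖X‖ * ‖Y‖ * ‖Z‖ / √lam ^ 3)) := by
          gcongr; exact h1.trans (by gcongr)
      _ = √lam ^ 2 * (omegaSup (matH z ψ) (pullbackW z ψ) (ballH (matH z ψ) r) 3 0 0 0 *
            (‖X‖ * ‖Y‖ * ‖Z‖ / √lam ^ 3)) := by rw [Real.sq_sqrt hlam.le]
      _ = _ := by field_simp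

theorem exists_scaled_slope (h : LocalizationRadius D z Ω ψ ρ₀ r) (hlam : 0 < lam)
    {e : RVec d ≃L[ℝ] RVec d} (he : ∀ x, ‖e x‖ = √lam * normH (matH z ψ) x) :
    ∃ g : RVec d, (∀ X, ⟪X, g⟫ = BoundaryMinSetting.normalSlope z ψ r (e.symm X)) ∧
      ‖g‖ ≤ omegaSup (matH z ψ) (pullbackW z ψ) (ballH (matH z ψ) r) 1 1 0 0 / √lam := by
  set l : RVec d →L[ℝ] ℝ := (BoundaryMinSetting.normalSlope z ψ r).comp
    (e.symm : RVec d →L[ℝ] RVec d) with hl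
  refine ⟨(InnerProductSpace.toDual ℝ (RVec d)).symm l, fun X => ?_, ?_⟩
  · rw [real_inner_comm, InnerProductSpace.toDual_symm_apply]; rfl
  · rw [LinearIsometryEquiv.norm_map]
    have ho := omegaSup_nonneg (matH z ψ) (pullbackW z ψ) (ballH (matH z ψ) r) 1 1 0 0
    refine l.opNorm_le_bound (by positivity) fun X => ?_
    have h1 := h.setting.abs_normalSlope_le h.pos h.le_radius h.smooth (e.symm X)
    have h2 := he (e.symm X)
    rw [e.apply_symm_apply] at h2
    have hs : 0 < √lam := Real.sqrt_pos.mpr hlam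
    refine h1.trans_eq ?_
    rw [h2]; field_simp

theorem third_zero_le (h : LocalizationRadius D z Ω ψ ρ₀ r) :
    omegaSup (matH z ψ) (pullbackW z ψ) (ballH (matH z ψ) r) 3 0 0 0 ≤
      omegaSup (matH z ψ) (pullbackW z ψ) (ballH (matH z ψ) r) 3 0 r 0 := by
  obtain ⟨L, hL, -⟩ := exists_equiv_normH h.setting.posDef_H
  refine csSup_le ⟨_, 0, zero_mem_ballH hL le_rfl, 0, by simp, rfl⟩ ?_
  rintro a ⟨x, hx, y, hy, rfl⟩
  obtain rfl : y = 0 := le_antisymm hy.2 hy.1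
  exact tensorNormH_le_omegaSup_zero (l := 3) hL h.pos le_rfl
    (BoundaryMinSetting.contDiffOn_partialY_zero (by have := h.pos; positivity) h.smooth)
    (by norm_num) (ballH_mono h.pos.le hx)

/-- In coordinates with `‖X‖ = √λ ‖x‖_H` the half ball has radius `R √d / 2`. The data become `b =
ω_{3,0} / √λ`, a slope of norm at most `ω_{1,1} / √λ`, and a quartic error of order `R⁴ ω_{4,0} d² /
λ`, so `(b d)²` is the term `ω_{3,0}² d² / λ`. -/
theorem abs_scaled_integral_sub_le (h : LocalizationRadius D z Ω ψ ρ₀ r) (hlam : 1 ≤ lam)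
    (hd : 1 ≤ d) (hR : 24 ≤ R) (hr : √lam * r = R * √d) {B c : ℝ}
    (hB : ∀ x, |deriv smoothTransition x| ≤ B)
    (hc : (omegaSup (matH z ψ) (pullbackW z ψ) (ballH (matH z ψ) r) 3 0 0 0 ^ 2 +
      omegaSup (matH z ψ) (pullbackW z ψ) (ballH (matH z ψ) r) 4 0 r 0) * (d ^ 2 / lam) ≤ c)
    {m : ℝ} (hm : exp (-(R ^ 2 * d / 128)) ≤ m) :
    |lam ^ ((d : ℝ) / 2) * √(matH z ψ).det *
        (∫ x in ballH (matH z ψ) (r / 2), exp (-(lam * (pullbackW z ψ (x, 0) - z 0))) *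
          normalAmplitude z ψ lam r x) - (2 * π) ^ ((d : ℝ) / 2)| ≤
      (2 * π) ^ ((d : ℝ) / 2) *
        (cubicMomentConst B R c * (2 * exp (R ^ 4 * c) + 2 * R ^ 4) * (64 * R ^ 4 *
        ((omegaSup (matH z ψ) (pullbackW z ψ) (ballH (matH z ψ) r) 3 0 0 0 ^ 2 +
          omegaSup (matH z ψ) (pullbackW z ψ) (ballH (matH z ψ) r) 4 0 r 0) * (d ^ 2 / lam) +
        (omegaSup (matH z ψ) (pullbackW z ψ) (ballH (matH z ψ) r) 1 1 0 0 ^ 2 +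
          omegaSup (matH z ψ) (pullbackW z ψ) (ballH (matH z ψ) r) 2 1 r 0) * (d / lam) +
        omegaSup (matH z ψ) (pullbackW z ψ) (ballH (matH z ψ) r) 0 2 r (r ^ 2) * (1 / lam) +
        m))) := by
  have hlam0 : 0 < lam := by linarith
  have hs : 0 < √lam := Real.sqrt_pos.mpr hlam0
  have hd1 : (1 : ℝ) ≤ d := by exact_mod_cast hd
  obtain ⟨L, hL, -⟩ := exists_equiv_normH h.setting.posDef_H
  obtain ⟨e, he, hdet⟩ := exists_equiv_scaled h.setting.posDef_H hlam0
  obtain ⟨A, hA, hAb⟩ := h.exists_scaled_cubic hlam0 he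
  obtain ⟨g, hg, hgn⟩ := h.exists_scaled_slope hlam0 he
  have hw3 := h.third_zero_le
  have hw3' := h.third_le
  have hw11' := h.mul_slope_le
  have hamp := fun x hx => h.abs_normalAmplitude_sub_le hlam0 (x := x) hx
  have hquart := fun x hx => h.setting.abs_pullbackW_sub_cubic_le h.pos h.smooth (x := x) hx
  have ho30 := omegaSup_nonneg (matH z ψ) (pullbackW z ψ) (ballH (matH z ψ) r) 3 0 0 0
  have ho11 := omegaSup_nonneg (matH z ψ) (pullbackW z ψ) (ballH (matH z ψ) r) 1 1 0 0
  have ho40 := omegaSup_nonneg (matH z ψ) (pullbackW z ψ) (ballH (matH z ψ) r) 4 0 r 0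
  have ho21 := omegaSup_nonneg (matH z ψ) (pullbackW z ψ) (ballH (matH z ψ) r) 2 1 r 0
  have ho02 := omegaSup_nonneg (matH z ψ) (pullbackW z ψ) (ballH (matH z ψ) r) 0 2 r (r ^ 2)
  -- From here on the suprema matter only through the inequalities collected above and are treated
  -- as plain reals.
  generalize omegaSup (matH z ψ) (pullbackW z ψ) (ballH (matH z ψ) r) 3 0 0 0 = o30 at *
  generalize omegaSup (matH z ψ) (pullbackW z ψ) (ballH (matH z ψ) r) 3 0 r 0 = o3 at *
  generalize omegaSup (matH z ψ) (pullbackW z ψ) (ballH (matH z ψ) r) 4 0 r 0 = o40 at *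
  generalize omegaSup (matH z ψ) (pullbackW z ψ) (ballH (matH z ψ) r) 1 1 0 0 = o11 at *
  generalize omegaSup (matH z ψ) (pullbackW z ψ) (ballH (matH z ψ) r) 2 1 r 0 = o21 at *
  generalize omegaSup (matH z ψ) (pullbackW z ψ) (ballH (matH z ψ) r) 0 2 r (r ^ 2) = o02 at *
  have hsq : √lam ^ 2 = lam := Real.sq_sqrt hlam0.le
  have hdq : √(d : ℝ) ^ 2 = d := Real.sq_sqrt (by positivity)
  have hr2 : r ^ 2 = R ^ 2 * (d / lam) := by
    have : lam * r ^ 2 = R ^ 2 * d := by rw [← hsq, ← hdq, ← mul_pow, hr, mul_pow]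
    field_simp; linarith
  have hn : ∀ X, normH (matH z ψ) (e.symm X) = ‖X‖ / √lam := fun X => by
    have := he (e.symm X)
    rw [e.apply_symm_apply] at this
    rw [this]; field_simp
  have hmem : ∀ X, ‖X‖ ≤ √lam * r / 2 ↔ e.symm X ∈ ballH (matH z ψ) (r / 2) := fun X => by
    change _ ↔ normH (matH z ψ) (e.symm X) ≤ r / 2
    rw [hn, div_le_iff₀ hs]
    constructor <;> intro h <;> linarith
  have hpre : e.symm ⁻¹' ballH (matH z ψ) (r / 2) = Metric.closedBall 0 (√lam * r / 2) := by
    ext X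
    rw [mem_closedBall_zero_iff, hmem]; rfl
  have hsub := h.half_ball_subset
  have hR1 : 1 ≤ R := by linarith
  have hR2 : R ^ 2 ≤ R ^ 4 := pow_le_pow_right₀ hR1 (by norm_num)
  have hR4 : 1 ≤ R ^ 4 := one_le_pow₀ hR1
  set X := (o30 ^ 2 + o40) * (d ^ 2 / lam) with hX
  have hX1 : o30 ^ 2 * (d ^ 2 / lam) ≤ X := by
    rw [hX]; gcongr; linarith
  have hX2 : o40 * (d ^ 2 / lam) ≤ X := by
    rw [hX]; gcongr; linarith [sq_nonneg o30]
  have hcb : CubicBound A (o30 / √lam) R (√lam * r / 2) c :=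
    { one_le_dim := hd
      le_R := hR
      rho_eq := by rw [hr]
      nonneg := by positivity
      bound := hAb
      mul_rho_le := by
        have := mul_le_mul_of_nonneg_left hw3 h.pos.le
        calc o30 / √lam * (√lam * r / 2) = r * o30 / 2 := by field_simp
          _ ≤ 3 / 2 := by linarith
      sq_le := by
        rw [mul_pow, div_pow, hsq]
        refine le_trans (le_of_eq ?_) (hX1.trans hc)
        ring }
  have hgρ : ‖g‖ * (√lam * r / 2) ≤ 1 / 2 := by
    calc ‖g‖ * (√lam * r / 2) ≤ o11 / √lam * (√lam * r / 2) := by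
          have := h.pos
          gcongr
      _ = r * o11 / 2 := by field_simp
      _ ≤ 1 / 2 := by linarith
  -- The quartic Taylor remainder on the half ball; 384 is `2⁴ * 24`, and `λ r⁴ = R⁴ d² / λ`.
  have hq : lam * (o40 * (r / 2) ^ 4 / 24) = R ^ 4 / 384 * (o40 * (d ^ 2 / lam)) := by
    have : r ^ 4 = R ^ 4 * (d ^ 2 / lam ^ 2) := by
      rw [show r ^ 4 = (r ^ 2) ^ 2 by ring, hr2]; ring
    rw [div_pow, this]; field_simp; ring
  have hqX : lam * (o40 * (r / 2) ^ 4 / 24) ≤ R ^ 4 * (o40 * (d ^ 2 / lam)) := by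
    rw [hq]
    have : 0 ≤ o40 * (d ^ 2 / lam) := by positivity
    gcongr; linarith
  have hcore := hcb.abs_setIntegral_sub_le (B := B) hB hgρ
    (F := fun X => lam * (pullbackW z ψ (e.symm X, 0) - z 0))
    (J := fun X => normalAmplitude z ψ lam r (e.symm X))
    (q := lam * (o40 * (r / 2) ^ 4 / 24))
    (e := 64 * o02 / lam + 2 * exp (-(lam * r ^ 2 / 2)) +
      (o11 ^ 2 * r ^ 2 / 2 + o21 * r ^ 2 / 2))
    (hqX.trans (by gcongr; exact hX2.trans hc)) (by positivity)
    (by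
      intro X hX
      have hx := (hmem X).mp hX
      have h1 := hquart _ (hsub hx)
      have h2 : lam * (pullbackW z ψ (e.symm X, 0) - z 0) - (‖X‖ ^ 2 / 2 + cubicForm A X) =
          lam * (pullbackW z ψ (e.symm X, 0) - z 0 - normH (matH z ψ) (e.symm X) ^ 2 / 2 -
      iteratedFDerivWithin ℝ 3 (fun x => pullbackW z ψ (x, 0)) (ballH (matH z ψ) r) 0
        (fun _ => e.symm X) / 6) := by
        rw [cubicForm, hA, hn, div_pow, hsq]; field_simp; ring
      rw [h2, abs_mul, abs_of_pos hlam0]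
      have h0 := normH_nonneg (matH z ψ) (e.symm X)
      have h3 : normH (matH z ψ) (e.symm X) ≤ r / 2 := hx
      gcongr
      exact h1.trans (by gcongr))
    (by
      intro X hX
      have h1 := h.setting.le_pullbackW_sub h.pos h.smooth h.third_le ((hmem X).mp hX)
      rw [hn, div_pow, hsq] at h1
      calc ‖X‖ ^ 2 / 4 = lam * (‖X‖ ^ 2 / lam / 4) := by field_simp
        _ ≤ _ := by gcongr)
    (by
      intro X hX
      rw [hg]
      exact hamp _ ((hmem X).mp hX))
    (fun X hX => h.abs_normalAmplitude_le hlam0 (hsub ((hmem X).mp hX)))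
    (by
      rw [← hpre]
      exact integrableOn_comp_equiv_symm e (h.integrableOn_amplitude hlam0))
  rw [← hpre, setIntegral_comp_equiv_symm e (fun x => exp (-(lam * (pullbackW z ψ (x, 0) - z 0))) *
    normalAmplitude z ψ lam r x) h.isCompact_half_ball.isClosed.measurableSet, hdet] at hcore
  have hg2 : ‖g‖ ^ 2 ≤ o11 ^ 2 * (d / lam) := by
    calc ‖g‖ ^ 2 ≤ (o11 / √lam) ^ 2 := by gcongr
      _ = o11 ^ 2 * (1 / lam) := by rw [div_pow, hsq]; ring
      _ ≤ _ := by gcongr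
  have hexp : exp (-(lam * r ^ 2 / 2)) ≤ m := by
    refine le_trans ?_ hm
    rw [exp_le_exp, hr2]
    have : lam * (R ^ 2 * (d / lam)) = R ^ 2 * d := by field_simp
    rw [this]
    have : 0 ≤ R ^ 2 * d := by positivity
    linarith
  have hm0 : 0 < m := (exp_pos _).trans_le hm
  have hconst : 0 ≤ cubicMomentConst B R c := by
    have hB0 : 0 ≤ B := (abs_nonneg _).trans (hB 0)
    rw [cubicMomentConst]; positivity
  refine hcore.trans ?_
  gcongr
  have e1 : (o30 / √lam * d) ^ 2 = o30 ^ 2 * (d ^ 2 / lam) := by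
    rw [mul_pow, div_pow, hsq]; ring
  have e2 : o11 ^ 2 * r ^ 2 / 2 + o21 * r ^ 2 / 2 = R ^ 2 / 2 * ((o11 ^ 2 + o21) * (d / lam)) := by
    rw [hr2]; ring
  have e3 : X = o30 ^ 2 * (d ^ 2 / lam) + o40 * (d ^ 2 / lam) := by rw [hX]; ring
  have e4 : 64 * o02 / lam = 64 * (o02 * (1 / lam)) := by ring
  rw [e1, e2, e3, e4]
  have f1 : 0 ≤ o30 ^ 2 * (d ^ 2 / lam) := by positivity
  have f2 : 0 ≤ o40 * (d ^ 2 / lam) := by positivity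
  have f3 : 0 ≤ (o11 ^ 2 + o21) * (d / lam) := by positivity
  have f4 : 0 ≤ o02 * (1 / lam) := by positivity
  have f5 : o11 ^ 2 * (d / lam) ≤ (o11 ^ 2 + o21) * (d / lam) := by gcongr; linarith
  have g1 := mul_le_mul_of_nonneg_right hR4 f1
  have g2 := mul_le_mul_of_nonneg_right hR4 f2
  have g3 := mul_le_mul_of_nonneg_right hR4 f3
  have g3' := mul_le_mul_of_nonneg_right hR2 f3
  have g4 := mul_le_mul_of_nonneg_right hR4 f4
  have g5 := mul_le_mul_of_nonneg_right hR4 hm0.le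
  linarith

end LocalizationRadius

/-! ### The constant, the exterior contribution and the conclusion -/

theorem cubicMomentConst_pos {B R c : ℝ} (hB : 0 < B) : 0 < cubicMomentConst B R c := by
  rw [cubicMomentConst]; positivity

theorem cubicMomentConst_mono {B R R' c c' : ℝ} (hR : 0 < R) (hRR : R ≤ R') (hc : 0 < c)
    (hcc : c ≤ c') : cubicMomentConst B R c ≤ cubicMomentConst B R' c' := by
  rw [cubicMomentConst, cubicMomentConst]; gcongr

/-- The constant in the Laplace expansion. -/
noncomputable def laplaceConst (B R c : ℝ) : ℝ :=
  cubicMomentConst B R c * (2 * exp (R ^ 4 * c) + 2 * R ^ 4) * (64 * R ^ 4) + 8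

theorem laplaceConst_pos {B R c : ℝ} (hB : 0 < B) : 0 < laplaceConst B R c := by
  have := cubicMomentConst_pos (R := R) (c := c) hB
  rw [laplaceConst]; positivity

theorem laplaceConst_mono {B R R' c c' : ℝ} (hB : 0 < B) (hR : 0 < R) (hRR : R ≤ R') (hc : 0 < c)
    (hcc : c ≤ c') : laplaceConst B R c ≤ laplaceConst B R' c' := by
  have h1 := cubicMomentConst_mono (B := B) hR hRR hc hcc
  have h2 := cubicMomentConst_pos (R := R) (c := c) hB
  have h3 := cubicMomentConst_pos (R := R') (c := c') hB
  rw [laplaceConst, laplaceConst]; gcongr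

/-- The contribution of `D` away from the boundary cap is negligible. -/
theorem LocalizationRadius.abs_setIntegral_diff_cap_le_rpow {d : ℕ} {D : Set (RVec d × ℝ)}
    {z : RVec d × ℝ → ℝ} {Ω : Set (RVec d)} {ψ : RVec d → ℝ} {ρ₀ lam R ε M : ℝ}
    (h : LocalizationRadius D z Ω ψ ρ₀ (R * ε)) (hlam : 1 ≤ lam) (hd : 1 ≤ d)
    (hε : ε = √(d / lam)) (hR : 24 ≤ R) (hr : √lam * (R * ε) = R * √d) (hM : 1 ≤ M)
    (hRM : R = 24 + 2 * (1 + 2 * M) * log lam / d) :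
    |∫ u in D \ boundaryCap z ψ (R * ε), exp (-lam * z u)| ≤
      exp (-lam * z 0) / (lam ^ ((d : ℝ) / 2) * √(matH z ψ).det) / lam * (8 * (1 / lam ^ M)) := by
  have hlam0 : 0 < lam := by linarith
  have hH := h.setting.posDef_H
  have hdet : 0 < √(matH z ψ).det := Real.sqrt_pos.mpr hH.det_pos
  have hpow : 0 < lam ^ ((d : ℝ) / 2) := Real.rpow_pos_of_pos hlam0 _
  have hs : 0 < √lam := Real.sqrt_pos.mpr hlam0
  have hrpos := h.pos
  have hM' : 0 < 1 / lam ^ M := by positivity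
  have hd1 : (1 : ℝ) ≤ √d := by rw [Real.one_le_sqrt]; exact_mod_cast hd
  -- This turns the factor `192 / (√λ R ε)` below into the constant 8.
  have hsr : 24 ≤ √lam * (R * ε) := by rw [hr]; nlinarith
  have hlr : lam * (R * ε) ^ 2 = R ^ 2 * d := by
    calc lam * (R * ε) ^ 2 = (√lam * (R * ε)) ^ 2 := by rw [mul_pow √lam, Real.sq_sqrt hlam0.le]
      _ = _ := by rw [hr, mul_pow, Real.sq_sqrt (Nat.cast_nonneg d)]
  have h1 := h.abs_setIntegral_diff_cap_le hlam0 (integrable_exp_neg_normH1 hH hlam0 hd hε hR)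
  have h2 := integral_exp_neg_normH1_le hH hlam0 hd hε hR
  have h3 := exp_neg_sq_mul_dim_le hlam hd hM hRM
  rw [hlr] at h1
  calc _ ≤ exp (-lam * z 0) * exp (-(R ^ 2 * d / 128)) *
        (8 ^ d / (lam ^ ((d : ℝ) / 2) * √(matH z ψ).det) * (192 / (lam * (R * ε)))) := by
        refine h1.trans ?_
        gcongr
    _ = exp (-lam * z 0) / (lam ^ ((d : ℝ) / 2) * √(matH z ψ).det) / lam *
        ((8 ^ d * exp (-(R ^ 2 * d / 128))) * (192 / (R * ε))) := by
        field_simp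
    -- The spare factor `1 / √λ`, obtained from `M + 1/2` in place of `M`, offsets the possible
    -- largeness of `1 / (R ε)`.
    _ ≤ exp (-lam * z 0) / (lam ^ ((d : ℝ) / 2) * √(matH z ψ).det) / lam *
        ((1 / lam ^ M / √lam) * (192 / (R * ε))) := by gcongr
    _ = exp (-lam * z 0) / (lam ^ ((d : ℝ) / 2) * √(matH z ψ).det) / lam *
        (192 / (√lam * (R * ε)) * (1 / lam ^ M)) := by
        simp only [div_eq_mul_inv, mul_inv]; ring
    _ ≤ _ := by
        gcongr
        rw [div_le_iff₀ (by linarith)]; linarith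

/-- The remainder is defined by solving for it. The bound on `T` lacks the factor `N` of the leading
term, and `N ≥ 1` supplies it. -/
theorem exists_rem_of_split {Q m I T K X N : ℝ} (hQ : 0 < Q) (hm : 0 < m) (hN : 1 ≤ N)
    (hI : |Q * I - N| ≤ N * (K * X)) {t : ℝ} (ht : |T| ≤ m / Q * (8 * t)) (ht0 : 0 ≤ t) :
    ∃ Rem : ℝ, m * I + T = N / Q * m * (1 + Rem) ∧ |Rem| ≤ K * X + 8 * t := by
  have hN0 : 0 < N := by linarith
  refine ⟨(Q * I - N) / N + Q * T / (N * m), by field_simp; ring, ?_⟩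
  refine (abs_add_le _ _).trans (add_le_add ?_ ?_)
  · rw [abs_div, abs_of_pos hN0, div_le_iff₀ hN0]; linarith
  · rw [abs_div, abs_mul, abs_of_pos hQ, abs_of_pos (mul_pos hN0 hm),
      div_le_iff₀ (mul_pos hN0 hm)]
    calc Q * |T| ≤ Q * (m / Q * (8 * t)) := by gcongr
      _ = 1 * (8 * t * m) := by field_simp
      _ ≤ N * (8 * t * m) := by gcongr
      _ = _ := by ring

theorem proposition3p4 :
    -- the suppressed constant: a positive function, increasing in `R` and in `C₃₄`
    ∃ C : ℝ → ℝ → ℝ,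
      (∀ a b : ℝ, 0 < a → 0 < b → 0 < C a b) ∧
      (∀ a a' b b' : ℝ, 0 < a → a ≤ a' → 0 < b → b ≤ b' → C a b ≤ C a' b') ∧
      ∀ (d : ℕ) (_hd : 1 ≤ d) (lam : ℝ) (_hlam : 1 ≤ lam) (M : ℝ) (_hM : 1 ≤ M)
        (D : Set (RVec d × ℝ)) (z : RVec d × ℝ → ℝ) (Ω : Set (RVec d)) (ψ : RVec d → ℝ)
        (ρ₀ : ℝ) (_hset : BoundaryMinSetting D z Ω ψ ρ₀)
        (_hstar : StarConvex ℝ 0 D)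
        (_hconv : ∀ u ∈ D, ConvexOn ℝ (segment ℝ 0 u) z)
        (H : Matrix (Fin d) (Fin d) ℝ) (_hH : H = matH z ψ)
        (w : RVec d × ℝ → ℝ) (_hw : w = pullbackW z ψ)
        (ε : ℝ) (_hε : ε = √(d / lam))
        (R : ℝ) (_hR : R = 24 + 2 * (1 + 2 * M) * Real.log lam / d)
        (ω : ℕ → ℕ → ℝ → ℝ → ℝ) (_hω : ω = omegaSup H w (ballH H (R * ε)))
        (C₃₄ : ℝ) (_hC₃₄ : 0 < C₃₄)
        (_hwC4 : ContDiffOn ℝ 4 w (ballH H (R * ε) ×ˢ Icc 0 ((R * ε) ^ 2)))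
        (_hRε : R * ε ≤ min 1 ρ₀)
        (_hδ : R * ε * deltaSup H ψ 2 (R * ε / 2) ≤ 2)
        (_hω1 : R * ε * (ω 1 1 0 0 + ω 0 2 (R * ε) (R * ε))
          + (R * ε) ^ 2 * ω 2 1 (R * ε) 0 ≤ 1 / 2)
        (_hω2 : (ω 3 0 0 0 ^ 2 + ω 4 0 (R * ε) 0) * (d ^ 2 / lam) ≤ C₃₄)
        (_hω3 : R * ε * ω 3 0 (R * ε) 0 ≤ 3),
        IntegrableOn (fun u => Real.exp (-lam * z u)) D ∧
        ∃ Rem : ℝ,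
          ∫ u in D, Real.exp (-lam * z u)
            = (2 * π / lam) ^ ((d : ℝ) / 2) * Real.exp (-lam * z 0) / (lam * √H.det)
              * (1 + Rem) ∧
          |Rem| ≤ C R C₃₄ *
            ((ω 3 0 0 0 ^ 2 + ω 4 0 (R * ε) 0) * (d ^ 2 / lam)
              + (ω 1 1 0 0 ^ 2 + ω 2 1 (R * ε) 0) * (d / lam)
              + ω 0 2 (R * ε) ((R * ε) ^ 2) * (1 / lam)
              + 1 / lam ^ M) := by
  obtain ⟨B, hB0, hB, -⟩ := Real.exists_bound_deriv_smoothTransition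
  -- The number `B` depends only on the fixed cutoff profile and is obtained before `d`, `λ` and all
  -- other data are introduced.
  refine ⟨laplaceConst B, fun a b _ _ => laplaceConst_pos hB0,
    fun a a' b b' ha haa hb hbb => laplaceConst_mono hB0 ha haa hb hbb, ?_⟩
  intro d hd lam hlam M hM D z Ω ψ ρ₀ hset hstar hconv H hH w hw ε hε R hR ω hω c hc0 hwC4 hRε hδ
    hω1 hω2 hω3
  subst hH hw hω
  have hlam0 : 0 < lam := by linarith
  have hd0 : (0 : ℝ) < d := by exact_mod_cast hd
  have hR24 : 24 ≤ R := by
    have : 0 ≤ 2 * (1 + 2 * M) * Real.log lam / d := by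
      have := Real.log_nonneg hlam
      positivity
    linarith
  have hε0 : 0 < ε := by rw [hε]; positivity
  have hr0 : 0 < R * ε := by positivity
  have hr : √lam * (R * ε) = R * √d := by
    rw [hε, Real.sqrt_div hd0.le]
    have : √lam ≠ 0 := (Real.sqrt_pos.mpr hlam0).ne'
    field_simp
  have hr1 := hRε.trans (min_le_left _ _)
  have hrρ := hRε.trans (min_le_right _ _)
  have h : LocalizationRadius D z Ω ψ ρ₀ (R * ε) :=
    ⟨hset, hr0, hr1, hrρ, hwC4, hω1, hω3, fun u hu huP =>
      hset.linear_growth hr0 hr1 hrρ hstar hconv hwC4 hδ hω1 hω3 hu huP⟩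
  have hi := integrable_exp_neg_normH1 hset.posDef_H hlam0 hd hε hR24
  refine ⟨h.integrableOn_D hlam0 hi, ?_⟩
  have hm : exp (-(R ^ 2 * d / 128)) ≤ 1 / lam ^ M := by
    have h1 := exp_neg_sq_mul_dim_le hlam hd hM hR
    have h2 : (1 : ℝ) ≤ 8 ^ d := one_le_pow₀ (by norm_num)
    have h3 : 1 ≤ √lam := Real.one_le_sqrt.mpr hlam
    calc exp (-(R ^ 2 * d / 128)) ≤ 8 ^ d * exp (-(R ^ 2 * d / 128)) :=
          le_mul_of_one_le_left (exp_pos _).le h2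
      _ ≤ 1 / lam ^ M / √lam := h1
      _ ≤ 1 / lam ^ M := div_le_self (by positivity) h3
  have hcore := h.abs_scaled_integral_sub_le hlam hd hR24 hr hB hω2 hm
  have htail := h.abs_setIntegral_diff_cap_le_rpow hlam hd hε hR24 hr hM hR
  have hdet : 0 < √(matH z ψ).det := Real.sqrt_pos.mpr hset.posDef_H.det_pos
  have hpow : 0 < lam ^ ((d : ℝ) / 2) := Real.rpow_pos_of_pos hlam0 _
  have hN : 1 ≤ (2 * π) ^ ((d : ℝ) / 2) :=
    Real.one_le_rpow (by nlinarith [Real.pi_gt_three]) (by positivity)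
  have htail' : |∫ u in D \ boundaryCap z ψ (R * ε), exp (-lam * z u)| ≤
      exp (-lam * z 0) / lam / (lam ^ ((d : ℝ) / 2) * √(matH z ψ).det) * (8 * (1 / lam ^ M)) := by
    rwa [div_right_comm]
  obtain ⟨Rem, hRem, hle⟩ := exists_rem_of_split (by positivity) (by positivity) hN hcore htail'
    (by positivity)
  refine ⟨Rem, ?_, hle.trans ?_⟩
  · rw [h.setIntegral_D hlam0 hi, h.setIntegral_cap hlam0, hRem,
      Real.div_rpow (by positivity) hlam0.le]
    field_simp
  · have o1 := omegaSup_nonneg (matH z ψ) (pullbackW z ψ) (ballH (matH z ψ) (R * ε)) 4 0 (R * ε) 0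
    have o2 := omegaSup_nonneg (matH z ψ) (pullbackW z ψ) (ballH (matH z ψ) (R * ε)) 2 1 (R * ε) 0
    have o3 := omegaSup_nonneg (matH z ψ) (pullbackW z ψ) (ballH (matH z ψ) (R * ε)) 0 2 (R * ε)
      ((R * ε) ^ 2)
    -- The summand 8 of the constant pays for the exterior part, whose size `1 / λ^M` is one of the
    -- nonnegative terms in the bracket.
    rw [laplaceConst, add_mul (_ * (64 * R ^ 4)), mul_assoc _ (64 * R ^ 4)]
    gcongr
    refine le_add_of_nonneg_left ?_
    positivity
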